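/- Let $d\ge 0$ be an integer and $\omega>0$. Let $\Lambda(\mathbb C^d)$ carry the inner product in which the vectors $e_{i_1}\wedge\dots\wedge e_{i_k}$ ($i_1<\dots<i_k$) are orthonormal, let $b_\mu^*$ be exterior multiplication by $e_\mu$, let $b_\mu$ be its adjoint, and let $\Gamma=(-1)^k$ on $\Lambda^k(\mathbb C^d)$. Let $\mathcal H=L^2(\mathbb R^d)\otimes\Lambda(\mathbb C^d)=L^2(\mathbb R^d;\Lambda(\mathbb C^d))$, graded by $1\otimes\Gamma$, and let $A=C_0(\mathbb R^d)$ act on it by the representation $\pi$ by multiplication operators; let $\mathcal A=\mathcal S(\mathbb R^d)\subset A$ be the Schwartz algebra. Put $a_\mu=\omega x_\mu+\partial_\mu$, $a_\mu^*=\omega x_\mu-\partial_\mu$, and let $$\mathcal D_1=\sum_{\mu=1}^d(a_\mu\otimes b_\mu^*+a_\mu^*\otimes b_\mu),\qquad \mathcal D_2=\sum_{\mu=1}^d(a_\mu\otimes b_\mu+a_\mu^*\otimes b_\mu^*),\qquad \mathcal D=\sum_{\mu=1}^d\bigl(\omega x_\mu\otimes(b_\mu+b_\mu^*)-i\,\partial_\mu\otimes(b_\mu-b_\mu^*)\bigr)$$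 denote the closures in $\mathcal H$ of the operators given by these formulas on $\mathcal S(\mathbb R^d)\otimes\Lambda(\mathbb C^d)$. Definitions, for a $C^*$-algebra $A$ (trivially graded) with an even $*$-representation $\pi$ on a separable graded Hilbert space $\mathcal H$ and a separable dense $*$-subalgebra $\mathcal A\subset A$. A subspace $\mathcal E$ of the domain of an operator $T$ is a core for $T$ if the closure of $T|_{\mathcal E}$ is $T$, and $T$ is essentially self-adjoint on $\mathcal E$ if the closure of $T|_{\mathcal E}$ is self-adjoint. * A pair $(S,T)$ of self-adjoint operators is *almost anti-commuting* if $T$ has a core $\mathcal E$ such that for all real $m\neq0$ and $\xi\in\mathcal E$ one has $(S-im)^{-1}\xi\in\operatorname{Dom}S\cap\operatorname{Dom}T$ and $T(S-im)^{-1}\xi\in\operatorname{Dom}S$, and $(ST+TS)(S-im)^{-1}:\mathcal E\to\mathcal H$ is well defined and extends to a bounded operator on $\mathcal H$. * $(\mathcal A,\mathcal H,D)$ is an *even spectral triple* if $D$ is self-adjoint and odd, every $\pi(a)$ with $a\in\mathcal A$ preserves $\operatorname{Dom}D$ with $[D,\pi(a)]$ bounded, and $\pi(a):\operatorname{Dom}D\to\mathcal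 H$ is compact for the graph norm for all $a\in A$. * $(\mathcal A,\mathcal H,D_1,D_2)$ is an *even pair of spectral triples* if both $(\mathcal A,\mathcal H,D_j)$ are even spectral triples, $D_1$ and $D_2$ have a common core $\mathcal E$ on which $D_1+D_2$ and $D_1-D_2$ are essentially self-adjoint, and (the closures of) $D_1+D_2$, $D_1-D_2$, defined on $\operatorname{Dom}D_1\cap\operatorname{Dom}D_2$, form an almost anti-commuting pair. * For $D$ closed and densely defined let $\operatorname{Re}D$, $\operatorname{Im}D$ be the closures of $\frac12(D+D^*)$, $-\frac i2(D-D^*)$ on $\operatorname{Dom}D\cap\operatorname{Dom}D^*$. $(\mathcal A,\mathcal H,D)$ is an *even indefinite spectral triple* if $D$ is closed, densely defined and odd and: there is a subspace $\mathcal E\subset\operatorname{Dom}D\cap\operatorname{Dom}D^*$, dense there for the norm $(\|\psi\|^2+\|D\psi\|^2+\|D^*\psi\|^2)^{1/2}$, which is a core for $D$ and for $D^*$, on which $\operatorname{Re}D$ and $\operatorname{Im}D$ are essentially self-adjoint, and such that $\pi(a)\mathcal E\subset\operatorname{Dom}D\cap\operatorname{Dom}D^*$ with $[D,\pi(a)]$,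 $[D^*,\pi(a)]$ bounded on $\mathcal E$ for all $a\in\mathcal A$; $(\operatorname{Re}D,\operatorname{Im}D)$ is an almost anti-commuting pair; and $\pi(a):\operatorname{Dom}D\cap\operatorname{Dom}D^*\to\mathcal H$ is compact for the above norm for all $a\in A$. Then $(\mathcal S(\mathbb R^d),\mathcal H,\mathcal D_1,\mathcal D_2)$ is an even pair of spectral triples over $C_0(\mathbb R^d)$. The reverse Wick rotation of $(\mathcal D_1,\mathcal D_2)$, i.e. the closure of $\frac12(\mathcal D_1+\mathcal D_2)+\frac i2(\mathcal D_1-\mathcal D_2)$ on $\operatorname{Dom}\mathcal D_1\cap\operatorname{Dom}\mathcal D_2$, equals $\mathcal D$, and $(\mathcal S(\mathbb R^d),\mathcal H,\mathcal D)$ is an even indefinite spectral triple over $C_0(\mathbb R^d)$. -/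

import Mathlib

open MeasureTheory
open scoped SchwartzMap LineDeriv ZeroAtInfty LinearPMap ENNReal

noncomputable section

/-! ### The fermionic Fock space -/

/-- The fermionic Hilbert space `Λ(ℂ^d)`, in coordinates with respect to the standard basis
`e_s = e_{i₁} ∧ ⋯ ∧ e_{iₖ}` (`s = {i₁ < ⋯ < iₖ}`), which is declared orthonormal. -/
abbrev FermionSpace (d : ℕ) : Type := EuclideanSpace ℂ (Finset (Fin d))

namespace FermionSpace

variable {d : ℕ}

/-- The standard basis of the exterior algebra `Λ(ℂ^d)`: ordered wedge products of the `e_i`. -/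
abbrev wedgeBasis (d : ℕ) : Module.Basis (Finset (Fin d)) ℂ (ExteriorAlgebra ℂ (Fin d → ℂ)) :=
  (Pi.basisFun ℂ (Fin d)).ExteriorAlgebra

/-- The coordinate isomorphism from the exterior algebra, `e_s ↦` the unit vector at `s`. -/
def ofExterior (d : ℕ) : ExteriorAlgebra ℂ (Fin d → ℂ) ≃ₗ[ℂ] FermionSpace d :=
  (wedgeBasis d).equivFun.trans (WithLp.linearEquiv 2 ℂ _).symm

/-- The creation operator `b_μ^*`: exterior multiplication `ξ ↦ e_μ ∧ ξ`. -/
def creation (μ : Fin d) : FermionSpace d →L[ℂ] FermionSpace d :=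
  LinearMap.toContinuousLinearMap ((ofExterior d).toLinearMap ∘ₗ
    LinearMap.mulLeft ℂ (ExteriorAlgebra.ι ℂ (Pi.single μ (1 : ℂ))) ∘ₗ
      (ofExterior d).symm.toLinearMap)

/-- The annihilation operator `b_μ`, the Hilbert space adjoint of `b_μ^*`. -/
def annihilation (μ : Fin d) : FermionSpace d →L[ℂ] FermionSpace d :=
  ContinuousLinearMap.adjoint (creation μ)

/-- The grading operator `Γ = (-1)^{N_f}` on `Λ(ℂ^d)`: `Γ e_s = (-1)^{|s|} e_s`. -/
def grading (d : ℕ) : FermionSpace d →L[ℂ] FermionSpace d :=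
  LinearMap.toContinuousLinearMap
    { toFun := fun ξ => WithLp.toLp 2 fun s => (-1 : ℂ) ^ s.card * ξ s
      map_add' := fun ξ η => by ext s; simp [mul_add]
      map_smul' := fun c ξ => by ext s; simp [mul_left_comm] }

theorem ofExterior_basis (s : Finset (Fin d)) :
    ofExterior d (wedgeBasis d s) = EuclideanSpace.single s 1 := by
  ext t
  simp [ofExterior, wedgeBasis, Finsupp.single_apply, eq_comm]

theorem ι_eq_basis (μ : Fin d) :
    ExteriorAlgebra.ι ℂ (Pi.single μ (1 : ℂ)) = wedgeBasis d {μ} := by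
  rw [wedgeBasis, ExteriorAlgebra.basis_apply_ofCard (n := 1) _ (by simp)]
  have : (Set.powersetCard.ofFinEmbEquiv.symm
      (Set.powersetCard.ofCard (s := ({μ} : Finset (Fin d))) (Finset.card_singleton μ))) 0 = μ := by
    have h := (Set.powersetCard.mem_range_ofFinEmbEquiv_symm_iff_mem
      (Set.powersetCard.ofCard (s := ({μ} : Finset (Fin d))) (Finset.card_singleton μ)) _).1
        ⟨0, rfl⟩
    simpa [Set.powersetCard.ofCard] using h
  simp [ExteriorAlgebra.ιMulti_family, ExteriorAlgebra.ιMulti_apply, this]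

theorem ι_mul_basis_of_mem {μ : Fin d} {s : Finset (Fin d)} (h : μ ∈ s) :
    ExteriorAlgebra.ι ℂ (Pi.single μ (1 : ℂ)) * wedgeBasis d s = 0 := by
  rw [ι_eq_basis]
  exact ExteriorAlgebra.basis_mul_of_not_disjoint (Pi.basisFun ℂ (Fin d))
    (Set.powersetCard.ofCard (s := {μ}) rfl) (Set.powersetCard.ofCard (s := s) rfl)
    (by simpa [Set.powersetCard.ofCard] using h)

theorem ι_mul_basis_of_notMem {μ : Fin d} {s : Finset (Fin d)} (h : μ ∉ s) :
    ∃ u : ℤˣ, ExteriorAlgebra.ι ℂ (Pi.single μ (1 : ℂ)) * wedgeBasis d s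
      = u • wedgeBasis d (insert μ s) := by
  rw [ι_eq_basis]
  have hd : Disjoint (Set.powersetCard.ofCard (s := ({μ} : Finset (Fin d))) rfl).val
      (Set.powersetCard.ofCard (s := s) rfl).val := by
    simpa [Set.powersetCard.ofCard] using h
  have := ExteriorAlgebra.basis_mul_of_disjoint (Pi.basisFun ℂ (Fin d)) _ _ hd
  have h2 : ((Set.powersetCard.disjUnion hd).val : Finset (Fin d)) = insert μ s := by
    ext; simp [Set.powersetCard.disjUnion, Set.powersetCard.ofCard]
  rw [h2] at this
  exact ⟨_, this⟩

/-- Contraction of the exterior algebra with the `μ`-th coordinate functional. -/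
abbrev contract (μ : Fin d) :
    ExteriorAlgebra ℂ (Fin d → ℂ) →ₗ[ℂ] ExteriorAlgebra ℂ (Fin d → ℂ) :=
  CliffordAlgebra.contractLeft (Q := (0 : QuadraticForm ℂ (Fin d → ℂ))) (LinearMap.proj μ)

theorem contract_ι_mul (μ ν : Fin d) (x : ExteriorAlgebra ℂ (Fin d → ℂ)) :
    contract μ (ExteriorAlgebra.ι ℂ (Pi.single ν (1 : ℂ)) * x) =
      (if μ = ν then x else 0) - ExteriorAlgebra.ι ℂ (Pi.single ν (1 : ℂ)) * contract μ x := by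
  refine (CliffordAlgebra.contractLeft_ι_mul _ _ _).trans ?_
  by_cases h : μ = ν <;> simp [h]

theorem contract_basis_of_notMem {μ : Fin d} {s : Finset (Fin d)} (h : μ ∉ s) :
    contract μ (wedgeBasis d s) = 0 := by
  induction s using Finset.induction_on with
  | empty =>
    have : wedgeBasis d ∅ = 1 := by
      rw [wedgeBasis, ExteriorAlgebra.basis_apply_ofCard (n := 0) _ (by simp)]
      simp [ExteriorAlgebra.ιMulti_family, ExteriorAlgebra.ιMulti_apply]
    rw [this]
    exact CliffordAlgebra.contractLeft_one (Q := (0 : QuadraticForm ℂ (Fin d → ℂ)))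
      (LinearMap.proj μ)
  | insert ν s hν ih =>
    simp only [Finset.mem_insert, not_or] at h
    obtain ⟨u, hu⟩ := ι_mul_basis_of_notMem hν
    have h1 : wedgeBasis d (insert ν s) =
        ((u : ℤ) : ℂ) • (ExteriorAlgebra.ι ℂ (Pi.single ν (1 : ℂ)) * wedgeBasis d s) := by
      rw [hu]
      rcases Int.units_eq_one_or u with rfl | rfl <;> simp
    rw [h1, map_smul, contract_ι_mul, ih h.2]
    simp [h.1]

/-- The annihilation operator is contraction with the dual basis vector. -/
theorem annihilation_eq (μ : Fin d) (ξ : FermionSpace d) :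
    annihilation μ ξ = ofExterior d (contract μ ((ofExterior d).symm ξ)) := by
  have hin : ∀ r s : Finset (Fin d), inner ℂ (EuclideanSpace.single r (1 : ℂ))
      (EuclideanSpace.single s (1 : ℂ)) = if r = s then (1 : ℂ) else 0 := fun r s => by
    rw [EuclideanSpace.inner_single_left]
    simp
  have hunit : ∀ (v : ℤˣ) (r : Finset (Fin d)), ofExterior d (v • wedgeBasis d r) =
      ((v : ℤ) : ℂ) • EuclideanSpace.single r (1 : ℂ) := fun v r => by
    rcases Int.units_eq_one_or v with rfl | rfl <;> simp [ofExterior_basis]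
  have key : (ofExterior d).toLinearMap ∘ₗ contract μ ∘ₗ (ofExterior d).symm.toLinearMap =
      LinearMap.adjoint ((creation μ).toLinearMap) := by
    rw [LinearMap.eq_adjoint_iff_basis (EuclideanSpace.basisFun _ ℂ).toBasis
      (EuclideanSpace.basisFun _ ℂ).toBasis]
    intro t s
    have hs : ∀ r : Finset (Fin d), (ofExterior d).symm (EuclideanSpace.single r 1) =
        wedgeBasis d r := fun r => by
      rw [← ofExterior_basis, LinearEquiv.symm_apply_apply]
    have hc : creation μ (EuclideanSpace.single s 1) =
        ofExterior d (ExteriorAlgebra.ι ℂ (Pi.single μ (1 : ℂ)) * wedgeBasis d s) := by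
      simp [creation, hs]
    simp only [OrthonormalBasis.coe_toBasis, EuclideanSpace.basisFun_apply, LinearMap.comp_apply,
      LinearEquiv.coe_coe, ContinuousLinearMap.coe_coe, hs, hc]
    by_cases ht : μ ∈ t
    · obtain ⟨r, hr, rfl⟩ : ∃ r, μ ∉ r ∧ t = insert μ r :=
        ⟨t.erase μ, by simp, by simp [Finset.insert_erase ht]⟩
      obtain ⟨u, hu⟩ := ι_mul_basis_of_notMem hr
      have h1 : wedgeBasis d (insert μ r) =
          ((u : ℤ) : ℂ) • (ExteriorAlgebra.ι ℂ (Pi.single μ (1 : ℂ)) * wedgeBasis d r) := by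
        rw [hu]
        rcases Int.units_eq_one_or u with rfl | rfl <;> simp
      have h2 : contract μ (wedgeBasis d (insert μ r)) = ((u : ℤ) : ℂ) • wedgeBasis d r := by
        rw [h1, map_smul, contract_ι_mul, contract_basis_of_notMem hr]
        simp
      rw [h2, map_smul, ofExterior_basis, inner_smul_left, hin]
      by_cases hrs : r = s
      · subst hrs
        rw [hu]
        rcases Int.units_eq_one_or u with rfl | rfl <;> simp [ofExterior_basis]
      · by_cases hs' : μ ∈ s
        · rw [ι_mul_basis_of_mem hs']
          simp [hrs]
        · obtain ⟨v, hv⟩ := ι_mul_basis_of_notMem hs'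
          have h3 : insert μ r ≠ insert μ s := fun h => hrs (by
            rw [← Finset.erase_insert hr, h, Finset.erase_insert hs'])
          rw [hv, hunit, inner_smul_right, hin, if_neg hrs, if_neg h3]
          simp
    · rw [contract_basis_of_notMem ht]
      by_cases hs' : μ ∈ s
      · rw [ι_mul_basis_of_mem hs']; simp
      · obtain ⟨v, hv⟩ := ι_mul_basis_of_notMem hs'
        have h3 : t ≠ insert μ s := fun h => ht (h ▸ Finset.mem_insert_self _ _)
        rw [hv, hunit, inner_smul_right, hin, if_neg h3]
        simp
  have h := congrArg (fun L => L ξ) key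
  rw [LinearMap.adjoint_eq_toCLM_adjoint] at h
  exact h.symm

/-- The canonical anti-commutation relation `{b_μ, b_ν^*} = δ_{μν}`. -/
theorem annihilation_creation (μ ν : Fin d) :
    annihilation μ * creation ν + creation ν * annihilation μ = if μ = ν then 1 else 0 := by
  ext1 ξ
  have h := contract_ι_mul μ ν ((ofExterior d).symm ξ)
  have h2 : annihilation μ (creation ν ξ) + creation ν (annihilation μ ξ) =
      ofExterior d (if μ = ν then (ofExterior d).symm ξ else 0) := by
    rw [annihilation_eq, annihilation_eq]
    simp [creation, h]
  by_cases hμ : μ = ν <;> simpa [hμ] using h2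

/-- The canonical anti-commutation relation `{b_μ^*, b_ν^*} = 0`. -/
theorem creation_creation (μ ν : Fin d) :
    creation μ * creation ν + creation ν * creation μ = 0 := by
  ext1 ξ
  have h := ExteriorAlgebra.ι_add_mul_swap (R := ℂ) (Pi.single μ (1 : ℂ))
    (Pi.single ν (1 : ℂ) : Fin d → ℂ)
  have h2 : creation μ (creation ν ξ) + creation ν (creation μ ξ) = ofExterior d
      ((ExteriorAlgebra.ι ℂ (Pi.single μ (1 : ℂ)) * ExteriorAlgebra.ι ℂ (Pi.single ν (1 : ℂ)) +
        ExteriorAlgebra.ι ℂ (Pi.single ν (1 : ℂ)) * ExteriorAlgebra.ι ℂ (Pi.single μ (1 : ℂ))) *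
          (ofExterior d).symm ξ) := by
    rw [add_mul, mul_assoc, mul_assoc, map_add]
    simp [creation]
  rw [h] at h2
  simpa using h2

end FermionSpace

/-! ### Unbounded operators and (indefinite) spectral triples -/

section SpectralTriples

variable {A : Type*} [NonUnitalCStarAlgebra A]
variable {H : Type*} [NormedAddCommGroup H] [InnerProductSpace ℂ H] [CompleteSpace H]

namespace UnboundedOp

/-- `T` is essentially self-adjoint on the subspace `E`: the closure of the restriction `T|_E`
is self-adjoint. -/
def IsEssentiallySelfAdjointOn (T : H →ₗ.[ℂ] H) (E : Submodule ℂ H) : Prop :=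
  E ≤ T.domain ∧ IsSelfAdjoint (T.domRestrict E).closure

/-- `T` is odd for the grading operator `Γ`: `Γ` preserves the domain and `T Γ = - Γ T`. -/
def IsOdd (Γ : H →L[ℂ] H) (T : H →ₗ.[ℂ] H) : Prop :=
  ∀ ψ : T.domain, ∃ h : Γ ψ ∈ T.domain, T ⟨Γ ψ, h⟩ = -Γ (T ψ)

/-- The squared combined graph norm `‖ψ‖² + ‖Sψ‖² + ‖Tψ‖²` on `Dom S ∩ Dom T`. -/
def graphNormSq (S T : H →ₗ.[ℂ] H) (ψ : ↥(S.domain ⊓ T.domain)) : ℝ :=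
  ‖(ψ : H)‖ ^ 2 + ‖S ⟨ψ, ψ.2.1⟩‖ ^ 2 + ‖T ⟨ψ, ψ.2.2⟩‖ ^ 2

/-- The bounded operator `a`, restricted to `Dom S ∩ Dom T` with the combined graph norm, is a
compact operator into `H`: the image of the closed unit ball is relatively compact. -/
def IsCompactOnDomain (a : H →L[ℂ] H) (S T : H →ₗ.[ℂ] H) : Prop :=
  IsCompact (closure ((fun ψ : ↥(S.domain ⊓ T.domain) => a ψ) '' {ψ | graphNormSq S T ψ ≤ 1}))

/-- `a` maps `E` into `Dom T` and the commutator `[T, a]` is bounded on `E`. -/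
def HasBoundedCommutatorOn (T : H →ₗ.[ℂ] H) (a : H →L[ℂ] H) (E : Submodule ℂ H) : Prop :=
  E ≤ T.domain ∧ ∃ C : ℝ, ∀ ψ : T.domain, (ψ : H) ∈ E →
    ∃ h : a ψ ∈ T.domain, ‖T ⟨a ψ, h⟩ - a (T ψ)‖ ≤ C * ‖(ψ : H)‖

/-- `R` is the bounded everywhere defined inverse `(S - z)⁻¹`. -/
def IsResolvent (S : H →ₗ.[ℂ] H) (z : ℂ) (R : H →L[ℂ] H) : Prop :=
  (∀ ξ : H, ∃ h : R ξ ∈ S.domain, S ⟨R ξ, h⟩ - z • R ξ = ξ) ∧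
    ∀ ψ : S.domain, R (S ψ - z • (ψ : H)) = ψ

/-- Almost anti-commuting pairs of self-adjoint operators: there is a core `E` for `T` such that
for all `ξ ∈ E` and all real `m ≠ 0` the vector `(S - im)⁻¹ ξ` lies in `Dom S ∩ Dom T`,
`T (S - im)⁻¹ ξ` lies in `Dom S`, and `{S, T} (S - im)⁻¹ : E → H` is well defined and extends to
a bounded operator on `H`. -/
def IsAlmostAntiCommuting (S T : H →ₗ.[ℂ] H) : Prop :=
  IsSelfAdjoint S ∧ IsSelfAdjoint T ∧
  ∃ E : Submodule ℂ H, T.HasCore E ∧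
    ∀ m : ℝ, m ≠ 0 → ∃ R : H →L[ℂ] H, IsResolvent S (Complex.I * m) R ∧
      ∃ K : H →L[ℂ] H, ∀ ξ ∈ E, ∃ (hS : R ξ ∈ S.domain) (hT : R ξ ∈ T.domain)
        (hTS : T ⟨R ξ, hT⟩ ∈ S.domain) (hST : S ⟨R ξ, hS⟩ ∈ T.domain),
          K ξ = S ⟨T ⟨R ξ, hT⟩, hTS⟩ + T ⟨S ⟨R ξ, hS⟩, hST⟩

/-- The real part of `D`: the closure of `(D + D*)/2` on `Dom D ∩ Dom D*`. -/
def realPart (D : H →ₗ.[ℂ] H) : H →ₗ.[ℂ] H :=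
  ((1 / 2 : ℂ) • (D + D†)).closure

/-- The imaginary part of `D`: the closure of `-(i/2)(D - D*)` on `Dom D ∩ Dom D*`. -/
def imagPart (D : H →ₗ.[ℂ] H) : H →ₗ.[ℂ] H :=
  ((-(Complex.I / 2) : ℂ) • (D - D†)).closure

/-- The reverse Wick rotation of `(D₁, D₂)`: the closure of `(D₁ + D₂)/2 + (i/2)(D₁ - D₂)` on
`Dom D₁ ∩ Dom D₂`. -/
def reverseWick (D₁ D₂ : H →ₗ.[ℂ] H) : H →ₗ.[ℂ] H :=
  ((1 / 2 : ℂ) • (D₁ + D₂) + (Complex.I / 2 : ℂ) • (D₁ - D₂)).closure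

end UnboundedOp

open UnboundedOp

/-- The data common to all even triples over a trivially graded `C*`-algebra `A`: a separable
Hilbert space with grading operator `Γ`, an even `*`-representation `π` of `A`, and a separable
dense `*`-subalgebra `𝒜` of `A`. -/
structure IsGradedRepresentation (𝒜 : NonUnitalStarSubalgebra ℂ A)
    (π : A →⋆ₙₐ[ℂ] (H →L[ℂ] H)) (Γ : H →L[ℂ] H) : Prop where
  separableSpace : TopologicalSpace.SeparableSpace H
  isSelfAdjoint_grading : IsSelfAdjoint Γ
  grading_mul_self : Γ * Γ = 1
  even : ∀ a : A, Commute Γ (π a)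
  isSeparable : TopologicalSpace.IsSeparable (𝒜 : Set A)
  dense : Dense (𝒜 : Set A)

/-- `(𝒜, H, D)` is an even spectral triple over `A`. -/
structure IsEvenSpectralTriple (𝒜 : NonUnitalStarSubalgebra ℂ A)
    (π : A →⋆ₙₐ[ℂ] (H →L[ℂ] H)) (Γ : H →L[ℂ] H) (D : H →ₗ.[ℂ] H) : Prop
    extends IsGradedRepresentation 𝒜 π Γ where
  isSelfAdjoint : IsSelfAdjoint D
  odd : IsOdd Γ D
  bounded_commutator : ∀ a ∈ 𝒜, HasBoundedCommutatorOn D (π a) D.domain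
  locally_compact : ∀ a : A, IsCompactOnDomain (π a) D D

/-- `(𝒜, H, D₁, D₂)` is an even pair of spectral triples over `A`. -/
structure IsEvenPairOfSpectralTriples (𝒜 : NonUnitalStarSubalgebra ℂ A)
    (π : A →⋆ₙₐ[ℂ] (H →L[ℂ] H)) (Γ : H →L[ℂ] H) (D₁ D₂ : H →ₗ.[ℂ] H) : Prop where
  fst : IsEvenSpectralTriple 𝒜 π Γ D₁
  snd : IsEvenSpectralTriple 𝒜 π Γ D₂
  exists_core : ∃ E : Submodule ℂ H, D₁.HasCore E ∧ D₂.HasCore E ∧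
    IsEssentiallySelfAdjointOn (D₁ + D₂) E ∧ IsEssentiallySelfAdjointOn (D₁ - D₂) E
  almost_antiCommuting : IsAlmostAntiCommuting (D₁ + D₂).closure (D₁ - D₂).closure

/-- `(𝒜, H, D)` is an even indefinite spectral triple over `A`. On a Hilbert space every densely
defined closed operator is regular, so regularity amounts to being densely defined. -/
structure IsEvenIndefiniteSpectralTriple (𝒜 : NonUnitalStarSubalgebra ℂ A)
    (π : A →⋆ₙₐ[ℂ] (H →L[ℂ] H)) (Γ : H →L[ℂ] H) (D : H →ₗ.[ℂ] H) : Prop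
    extends IsGradedRepresentation 𝒜 π Γ where
  isClosed : D.IsClosed
  dense_domain : Dense (D.domain : Set H)
  odd : IsOdd Γ D
  exists_core : ∃ E : Submodule ℂ H,
    E ≤ D.domain ⊓ D†.domain ∧
    (∀ ψ : ↥(D.domain ⊓ D†.domain), ∀ ε : ℝ, 0 < ε → ∃ φ : ↥(D.domain ⊓ D†.domain),
      (φ : H) ∈ E ∧ graphNormSq D D† (ψ - φ) < ε) ∧
    D.HasCore E ∧ D†.HasCore E ∧
    IsEssentiallySelfAdjointOn (realPart D) E ∧ IsEssentiallySelfAdjointOn (imagPart D) E ∧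
    (∀ a ∈ 𝒜, (∀ ψ ∈ E, π a ψ ∈ D.domain ⊓ D†.domain) ∧
      HasBoundedCommutatorOn D (π a) E ∧ HasBoundedCommutatorOn D† (π a) E)
  almost_antiCommuting : IsAlmostAntiCommuting (realPart D) (imagPart D)
  locally_compact : ∀ a : A, IsCompactOnDomain (π a) D D†

end SpectralTriples

/-! ### The harmonic oscillator -/

namespace HarmonicOscillator

variable {d : ℕ}

/-- The Hilbert space `L²(ℝ^d) ⊗ Λ(ℂ^d) = L²(ℝ^d; Λ(ℂ^d))`. -/
abbrev L2 (d : ℕ) : Type :=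
  Lp (FermionSpace d) 2 (volume : Measure (EuclideanSpace ℝ (Fin d)))

/-- The space `𝓢(ℝ^d) ⊗ Λ(ℂ^d) = 𝓢(ℝ^d; Λ(ℂ^d))`. -/
abbrev Schwartz (d : ℕ) : Type := 𝓢(EuclideanSpace ℝ (Fin d), FermionSpace d)

/-- The grading operator `1 ⊗ Γ`. -/
def grading (d : ℕ) : L2 d →L[ℂ] L2 d :=
  (FermionSpace.grading d).compLpL 2 volume

/-- Multiplication by the coordinate `x_μ` on Schwartz functions. -/
def position (μ : Fin d) : Schwartz d →L[ℂ] Schwartz d :=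
  SchwartzMap.smulLeftCLM (FermionSpace d) (fun x : EuclideanSpace ℝ (Fin d) => (x μ : ℂ))

theorem position_apply (μ : Fin d) (f : Schwartz d) (x : EuclideanSpace ℝ (Fin d)) :
    position μ f x = (x μ : ℂ) • f x := by
  refine SchwartzMap.smulLeftCLM_apply_apply ?_ f x
  exact (Complex.ofRealCLM ∘L EuclideanSpace.proj μ).hasTemperateGrowth

/-- The partial derivative `∂_μ` on Schwartz functions. -/
def partialDeriv (μ : Fin d) : Schwartz d →L[ℂ] Schwartz d :=
  LineDeriv.lineDerivOpCLM ℂ (Schwartz d) (EuclideanSpace.single μ (1 : ℝ))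

/-- The operator `1 ⊗ c` on Schwartz functions, for `c` acting on `Λ(ℂ^d)`. -/
def fiberwise (c : FermionSpace d →L[ℂ] FermionSpace d) : Schwartz d →L[ℂ] Schwartz d :=
  SchwartzMap.postcompCLM c

/-- The bosonic annihilation operator `a_μ = ω x_μ + ∂_μ`. -/
def bosonAnnihilation (ω : ℝ) (μ : Fin d) : Schwartz d →L[ℂ] Schwartz d :=
  (ω : ℂ) • position μ + partialDeriv μ

/-- The bosonic creation operator `a_μ^* = ω x_μ - ∂_μ`. -/
def bosonCreation (ω : ℝ) (μ : Fin d) : Schwartz d →L[ℂ] Schwartz d :=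
  (ω : ℂ) • position μ - partialDeriv μ

open FermionSpace in
/-- `∑_μ (a_μ ⊗ b_μ^* + a_μ^* ⊗ b_μ)` on `𝓢(ℝ^d) ⊗ Λ(ℂ^d)`. -/
def schwartzD₁ (d : ℕ) (ω : ℝ) : Schwartz d →L[ℂ] Schwartz d :=
  ∑ μ : Fin d, (bosonAnnihilation ω μ ∘L fiberwise (creation μ) +
    bosonCreation ω μ ∘L fiberwise (annihilation μ))

open FermionSpace in
/-- `∑_μ (a_μ ⊗ b_μ + a_μ^* ⊗ b_μ^*)` on `𝓢(ℝ^d) ⊗ Λ(ℂ^d)`. -/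
def schwartzD₂ (d : ℕ) (ω : ℝ) : Schwartz d →L[ℂ] Schwartz d :=
  ∑ μ : Fin d, (bosonAnnihilation ω μ ∘L fiberwise (annihilation μ) +
    bosonCreation ω μ ∘L fiberwise (creation μ))

open FermionSpace in
/-- `∑_μ (ω x_μ ⊗ (b_μ + b_μ^*) - i ∂_μ ⊗ (b_μ - b_μ^*))` on `𝓢(ℝ^d) ⊗ Λ(ℂ^d)`. -/
def schwartzD (d : ℕ) (ω : ℝ) : Schwartz d →L[ℂ] Schwartz d :=
  ∑ μ : Fin d, (((ω : ℂ) • position μ) ∘L fiberwise (annihilation μ + creation μ) -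
    (Complex.I • partialDeriv μ) ∘L fiberwise (annihilation μ - creation μ))

/-- The inclusion `𝓢(ℝ^d; Λ(ℂ^d)) → L²(ℝ^d; Λ(ℂ^d))`. -/
def schwartzToL2 (d : ℕ) : Schwartz d →ₗ[ℂ] L2 d :=
  (SchwartzMap.toLpCLM ℂ (FermionSpace d) 2 volume).toLinearMap

theorem schwartzToL2_injective (d : ℕ) : Function.Injective (schwartzToL2 d) :=
  SchwartzMap.injective_toLp 2 volume

/-- An operator on `𝓢(ℝ^d; Λ(ℂ^d))`, regarded as an unbounded operator on `L²(ℝ^d; Λ(ℂ^d))`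
with domain the Schwartz functions. -/
def ofSchwartz (T : Schwartz d →L[ℂ] Schwartz d) : L2 d →ₗ.[ℂ] L2 d where
  domain := LinearMap.range (schwartzToL2 d)
  toFun := schwartzToL2 d ∘ₗ T.toLinearMap ∘ₗ
    (LinearEquiv.ofInjective (schwartzToL2 d) (schwartzToL2_injective d)).symm.toLinearMap

theorem ofSchwartz_apply (T : Schwartz d →L[ℂ] Schwartz d) (f : Schwartz d) :
    ofSchwartz T ⟨schwartzToL2 d f, LinearMap.mem_range_self _ f⟩ = schwartzToL2 d (T f) := by
  have h : (LinearEquiv.ofInjective (schwartzToL2 d) (schwartzToL2_injective d)).symm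
      ⟨schwartzToL2 d f, LinearMap.mem_range_self _ f⟩ = f :=
    (LinearEquiv.symm_apply_eq _).2 rfl
  exact congrArg (fun g => schwartzToL2 d (T g)) h

/-- `𝒟₁`, the closure of `∑_μ (a_μ ⊗ b_μ^* + a_μ^* ⊗ b_μ)`. -/
def D₁ (d : ℕ) (ω : ℝ) : L2 d →ₗ.[ℂ] L2 d := (ofSchwartz (schwartzD₁ d ω)).closure

/-- `𝒟₂`, the closure of `∑_μ (a_μ ⊗ b_μ + a_μ^* ⊗ b_μ^*)`. -/
def D₂ (d : ℕ) (ω : ℝ) : L2 d →ₗ.[ℂ] L2 d := (ofSchwartz (schwartzD₂ d ω)).closure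

/-- `𝒟`, the closure of `∑_μ (ω x_μ ⊗ (b_μ + b_μ^*) - i ∂_μ ⊗ (b_μ - b_μ^*))`. -/
def D (d : ℕ) (ω : ℝ) : L2 d →ₗ.[ℂ] L2 d := (ofSchwartz (schwartzD d ω)).closure

/-- The Schwartz algebra as a `*`-subalgebra of `C₀(ℝ^d)`. -/
def schwartzAlgebra (d : ℕ) : NonUnitalStarSubalgebra ℂ C₀(EuclideanSpace ℝ (Fin d), ℂ) where
  carrier := {f | ∃ g : 𝓢(EuclideanSpace ℝ (Fin d), ℂ), ∀ x, f x = g x}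
  add_mem' := by
    rintro _ _ ⟨f, hf⟩ ⟨g, hg⟩
    exact ⟨f + g, fun x => by simp [hf, hg]⟩
  zero_mem' := ⟨0, fun x => by simp⟩
  mul_mem' := by
    rintro _ _ ⟨f, hf⟩ ⟨g, hg⟩
    exact ⟨SchwartzMap.smulLeftCLM ℂ f g, fun x => by
      simp [hf, hg, SchwartzMap.smulLeftCLM_apply_apply f.hasTemperateGrowth]⟩
  smul_mem' := by
    rintro c _ ⟨f, hf⟩
    exact ⟨c • f, fun x => by simp [hf]⟩
  star_mem' := by
    rintro _ ⟨f, hf⟩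
    exact ⟨SchwartzMap.postcompCLM (𝕜 := ℝ) Complex.conjCLE.toContinuousLinearMap f,
      fun x => by simp [hf]⟩

theorem memLp_top (f : C₀(EuclideanSpace ℝ (Fin d), ℂ)) :
    MemLp f ∞ (volume : Measure (EuclideanSpace ℝ (Fin d))) :=
  memLp_top_of_bound f.continuous.aestronglyMeasurable ‖f.toBCF‖
    (Filter.Eventually.of_forall fun x => f.toBCF.norm_coe_le_norm x)

/-- Multiplication by `f ∈ C₀(ℝ^d)` on `L²(ℝ^d; Λ(ℂ^d))`. -/
def mulOp (f : C₀(EuclideanSpace ℝ (Fin d), ℂ)) : L2 d →L[ℂ] L2 d :=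
  (ContinuousLinearMap.lsmul ℂ ℂ).holderL volume ∞ 2 2 (memLp_top f).toLp

theorem mulOp_apply (f : C₀(EuclideanSpace ℝ (Fin d), ℂ)) (ψ : L2 d) :
    mulOp f ψ =ᵐ[volume] fun x => f x • ψ x := by
  have h1 := (ContinuousLinearMap.lsmul ℂ ℂ).coeFn_holder (r := 2) (memLp_top f).toLp ψ
  filter_upwards [h1, (memLp_top f).coeFn_toLp] with x h1 h2
  refine h1.trans ?_
  rw [h2]
  rfl

/-- The representation of `C₀(ℝ^d)` on `L²(ℝ^d; Λ(ℂ^d))` by multiplication operators. -/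
def rep (d : ℕ) : C₀(EuclideanSpace ℝ (Fin d), ℂ) →⋆ₙₐ[ℂ] (L2 d →L[ℂ] L2 d) where
  toFun := mulOp
  map_zero' := by
    ext1 ψ
    refine Lp.ext ?_
    filter_upwards [mulOp_apply 0 ψ, Lp.coeFn_zero (FermionSpace d) 2 volume] with x h1 h2
    rw [h1, show (0 : L2 d →L[ℂ] L2 d) ψ = 0 from rfl, h2]
    simp
  map_add' f g := by
    ext1 ψ
    refine Lp.ext ?_
    filter_upwards [mulOp_apply (f + g) ψ, mulOp_apply f ψ, mulOp_apply g ψ,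
      Lp.coeFn_add (mulOp f ψ) (mulOp g ψ)] with x h h1 h2 h3
    rw [h, show (mulOp f + mulOp g) ψ = mulOp f ψ + mulOp g ψ from rfl, h3, Pi.add_apply, h1, h2,
      ← add_smul]
    rfl
  map_smul' c f := by
    ext1 ψ
    refine Lp.ext ?_
    filter_upwards [mulOp_apply (c • f) ψ, mulOp_apply f ψ,
      Lp.coeFn_smul c (mulOp f ψ)] with x h h1 h3
    simp [h, h3, h1, mul_smul]
  map_mul' f g := by
    ext1 ψ
    refine Lp.ext ?_
    filter_upwards [mulOp_apply (f * g) ψ, mulOp_apply g ψ,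
      mulOp_apply f (mulOp g ψ)] with x h h1 h3
    rw [h, show (mulOp f * mulOp g) ψ = mulOp f (mulOp g ψ) from rfl, h3, h1]
    simp [mul_smul]
  map_star' f := by
    rw [ContinuousLinearMap.star_eq_adjoint, ContinuousLinearMap.eq_adjoint_iff]
    intro ψ φ
    rw [L2.inner_def, L2.inner_def]
    refine integral_congr_ae ?_
    filter_upwards [mulOp_apply (star f) ψ, mulOp_apply f φ] with x h1 h2
    simp [h1, h2, inner_smul_left, inner_smul_right]

end HarmonicOscillator

end

noncomputable section

/-! ### Oscillator algebra on Schwartz functions: commutation relations and formal adjoints. -/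

namespace HarmonicOscillator

variable {d : ℕ}

/-! ### The algebra of operators on Schwartz functions -/

/-! Put X = ∑ x_μ ⊗ (b_μ + b_μ^*) and P = ∑ ∂_μ ⊗ (b_μ^* - b_μ). Both are symmetric on Schwartz
functions, and the three given expressions are ωX + P, ωX - P and ωX + iP, the last with formal
adjoint ωX - iP. The Clifford relations give X² = |x|², P² = -Δ, and `cliffordPosition_dirac`: XP +
PX is a constant matrix acting on the fibres. On Schwartz functions everything is then algebra; the
real issue is domains.

Domains are handled by Friedrichs' mollifier argument, with Cesàro means R_n = ∑_{k<n} (1 - k/n) P_k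
of the energy projections of the harmonic oscillator as mollifiers. They are contractions of finite
rank with Schwartz range, and they tend strongly to 1 because the Hermite functions are complete
(`tendsto_regularizer`). The operator a_μ lowers the level by one, neighbouring weights differ by
1/n, and a_μ has norm at most √(2ωn) on the levels up to n; hence [R_n, a_μ] = O(n^{-1/2}), and by
duality the same holds for a_μ^*. So for each first order operator L used here, R_nψ → ψ and L R_nψ
tends to the weak value of L on ψ. Weak and strong extensions therefore agree
(`mem_graph_closure_iff`), which yields the adjoints of the closures, self-adjointness, the closures
of sums and differences, and a common core.

Compactness comes from ‖φ - R_nφ‖² ≤ (2ωn)⁻¹ ∑ ‖a_μφ‖² (`norm_sub_regularizer_le`) together with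
elliptic estimates bounding ∑ ‖a_μφ‖² by the graph norms. For ωX + iP and its adjoint this is the
parallelogram law; for ωX ± P it also uses that (ωX + P)² - (ωX - P)² = 2ω(XP + PX) is bounded.
Already the inclusion of the domain into L² is compact, so every bounded operator composed with it
is.

Almost anti-commutation uses the explicit resolvent (κX - im)⁻¹ = (κX + im)(κ²|x|² + m²)⁻¹, which
preserves Schwartz functions, so that the boundedness of XP + PX applies directly
(`isAlmostAntiCommuting_closure`). -/

theorem partialDeriv_apply (μ : Fin d) (f : Schwartz d) (x : EuclideanSpace ℝ (Fin d)) :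
    partialDeriv μ f x = fderiv ℝ f x (EuclideanSpace.single μ 1) := by
  rw [partialDeriv, LineDeriv.lineDerivOpCLM_apply, SchwartzMap.lineDerivOp_apply_eq_fderiv]

theorem fiberwise_apply (c : FermionSpace d →L[ℂ] FermionSpace d) (f : Schwartz d)
    (x : EuclideanSpace ℝ (Fin d)) : fiberwise c f x = c (f x) :=
  SchwartzMap.postcompCLM_apply c f x

theorem fiberwise_one : fiberwise (1 : FermionSpace d →L[ℂ] FermionSpace d) = 1 := by
  ext f x : 2
  simp [fiberwise_apply]

theorem fiberwise_mul (a b : FermionSpace d →L[ℂ] FermionSpace d) :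
    fiberwise (a * b) = fiberwise a * fiberwise b := by
  ext f x : 2
  simp [fiberwise_apply]

theorem fiberwise_add (a b : FermionSpace d →L[ℂ] FermionSpace d) :
    fiberwise (a + b) = fiberwise a + fiberwise b := by
  ext f x : 2
  simp [fiberwise_apply]

theorem fiberwise_sub (a b : FermionSpace d →L[ℂ] FermionSpace d) :
    fiberwise (a - b) = fiberwise a - fiberwise b := by
  ext f x : 2
  simp [fiberwise_apply]

theorem fiberwise_zero : fiberwise (0 : FermionSpace d →L[ℂ] FermionSpace d) = 0 := by
  ext f x : 2
  simp [fiberwise_apply]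

theorem fiberwise_neg (a : FermionSpace d →L[ℂ] FermionSpace d) :
    fiberwise (-a) = -fiberwise a := by
  ext f x : 2
  simp [fiberwise_apply]

theorem position_commute (μ ν : Fin d) : Commute (position μ) (position ν) := by
  refine ContinuousLinearMap.ext fun f => SchwartzMap.ext fun x => ?_
  simp [position_apply, smul_smul, mul_comm]

theorem position_commute_fiberwise (μ : Fin d) (c : FermionSpace d →L[ℂ] FermionSpace d) :
    Commute (position μ) (fiberwise c) := by
  refine ContinuousLinearMap.ext fun f => SchwartzMap.ext fun x => ?_
  simp [position_apply, fiberwise_apply]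

theorem partialDeriv_commute_fiberwise (μ : Fin d) (c : FermionSpace d →L[ℂ] FermionSpace d) :
    Commute (partialDeriv μ) (fiberwise c) := by
  refine ContinuousLinearMap.ext fun f => SchwartzMap.ext fun x => ?_
  have h : (fiberwise c f : EuclideanSpace ℝ (Fin d) → FermionSpace d) =
      fun x => (c.restrictScalars ℝ) (f x) := funext fun x => fiberwise_apply c f x
  change partialDeriv μ (fiberwise c f) x = fiberwise c (partialDeriv μ f) x
  have h1 : HasFDerivAt (fun x => (c.restrictScalars ℝ) (f x)) _ x :=
    (c.restrictScalars ℝ).hasFDerivAt.comp x (f.hasFDerivAt x)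
  rw [partialDeriv_apply, fiberwise_apply, partialDeriv_apply, h, h1.fderiv]
  rfl

theorem partialDeriv_commute (μ ν : Fin d) : Commute (partialDeriv μ) (partialDeriv ν) := by
  have key : ∀ (μ ν : Fin d) (f : Schwartz d) (x : EuclideanSpace ℝ (Fin d)),
      partialDeriv μ (partialDeriv ν f) x =
        fderiv ℝ (fderiv ℝ f) x (EuclideanSpace.single μ 1) (EuclideanSpace.single ν 1) := by
    intro μ ν f x
    have h : (partialDeriv ν f : EuclideanSpace ℝ (Fin d) → FermionSpace d) =
        fun x => fderiv ℝ f x (EuclideanSpace.single ν 1) :=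
      funext fun x => partialDeriv_apply ν f x
    have hd : DifferentiableAt ℝ (fderiv ℝ f) x :=
      ((f.smooth 2).fderiv_right (m := 1) (by norm_num)).differentiable (by norm_num) x
    rw [partialDeriv_apply, h, fderiv_clm_apply hd (differentiableAt_const _)]
    simp
  refine ContinuousLinearMap.ext fun f => SchwartzMap.ext fun x => ?_
  change partialDeriv μ (partialDeriv ν f) x = partialDeriv ν (partialDeriv μ f) x
  rw [key, key]
  exact ((f.contDiffAt 2).isSymmSndFDerivAt (by simp)).eq _ _

theorem hasFDerivAt_coord (ν : Fin d) (x : EuclideanSpace ℝ (Fin d)) :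
    HasFDerivAt (fun x : EuclideanSpace ℝ (Fin d) => (x ν : ℂ))
      (Complex.ofRealCLM ∘L EuclideanSpace.proj ν) x :=
  (Complex.ofRealCLM ∘L (EuclideanSpace.proj ν : _ →L[ℝ] ℝ)).hasFDerivAt

theorem partialDeriv_mul_position (μ ν : Fin d) :
    partialDeriv μ * position ν = position ν * partialDeriv μ + if μ = ν then 1 else 0 := by
  refine ContinuousLinearMap.ext fun f => SchwartzMap.ext fun x => ?_
  have h : (position ν f : EuclideanSpace ℝ (Fin d) → FermionSpace d) =
      fun x => (x ν : ℂ) • f x := funext fun x => position_apply ν f x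
  have h1 : partialDeriv μ (position ν f) x =
      (x ν : ℂ) • partialDeriv μ f x + ((if μ = ν then 1 else 0 : ℝ) : ℂ) • f x := by
    have h1 : HasFDerivAt (fun x => (x ν : ℂ) • f x) _ x :=
      (hasFDerivAt_coord ν x).smul (f.hasFDerivAt x)
    rw [partialDeriv_apply, partialDeriv_apply, h, h1.fderiv]
    simp [eq_comm]
  change partialDeriv μ (position ν f) x = _
  rw [h1]
  by_cases hμ : μ = ν <;> simp [hμ, position_apply]

/-! ### Canonical commutation relations -/

variable (ω : ℝ)

theorem bosonCreation_commute (μ ν : Fin d) :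
    Commute (bosonCreation ω μ) (bosonCreation ω ν) := by
  have h1 := (position_commute μ ν).eq
  have h2 := (partialDeriv_commute μ ν).eq
  have h3 := partialDeriv_mul_position μ ν
  have h4 := partialDeriv_mul_position ν μ
  simp only [Commute, SemiconjBy, bosonCreation, mul_sub, sub_mul, smul_mul_assoc,
    mul_smul_comm, h1, h2, h3, h4]
  -- The two cross terms produce the deltas of (μ, ν) and of (ν, μ); they cancel only once brought
  -- to the same form.
  simp only [eq_comm (a := ν)]
  module

theorem bosonAnnihilation_mul_creation (μ ν : Fin d) :
    bosonAnnihilation ω μ * bosonCreation ω ν =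
      bosonCreation ω ν * bosonAnnihilation ω μ + if μ = ν then (2 * ω : ℂ) • 1 else 0 := by
  have h1 := (position_commute μ ν).eq
  have h2 := (partialDeriv_commute μ ν).eq
  have h3 := partialDeriv_mul_position μ ν
  have h4 := partialDeriv_mul_position ν μ
  simp only [bosonAnnihilation, bosonCreation, mul_sub, sub_mul, mul_add, add_mul,
    smul_mul_assoc, mul_smul_comm, h1, h2, h3, h4]
  by_cases h : μ = ν
  · simp only [h, if_true]; module
  · simp only [h, Ne.symm h, if_false]; module

theorem bosonCreation_commute_fiberwise (μ : Fin d) (c : FermionSpace d →L[ℂ] FermionSpace d) :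
    Commute (bosonCreation ω μ) (fiberwise c) :=
  ((position_commute_fiberwise μ c).smul_left _).sub_left (partialDeriv_commute_fiberwise μ c)

/-! ### Formal adjoints -/

theorem denseRange_schwartzToL2 : DenseRange (schwartzToL2 d) :=
  SchwartzMap.denseRange_toLpCLM (by simp)

theorem inner_schwartzToL2 (f g : Schwartz d) :
    inner ℂ (schwartzToL2 d f) (schwartzToL2 d g) = ∫ x, inner ℂ (f x) (g x) :=
  SchwartzMap.inner_toL2_toL2_eq f g

/-- `L` and `L'` are formal adjoints of each other on the Schwartz functions. -/
def FormallyAdjoint (L L' : Schwartz d →L[ℂ] Schwartz d) : Prop :=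
  ∀ f g, inner ℂ (schwartzToL2 d (L f)) (schwartzToL2 d g) =
    inner ℂ (schwartzToL2 d f) (schwartzToL2 d (L' g))

namespace FormallyAdjoint

variable {L L' K K' : Schwartz d →L[ℂ] Schwartz d}

theorem symm (h : FormallyAdjoint L L') : FormallyAdjoint L' L := fun f g => by
  rw [← inner_conj_symm, ← h, inner_conj_symm]

theorem add (h : FormallyAdjoint L L') (k : FormallyAdjoint K K') :
    FormallyAdjoint (L + K) (L' + K') := fun f g => by
  simp [inner_add_left, inner_add_right, h f g, k f g]

theorem sub (h : FormallyAdjoint L L') (k : FormallyAdjoint K K') :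
    FormallyAdjoint (L - K) (L' - K') := fun f g => by
  simp [inner_sub_left, inner_sub_right, h f g, k f g]

theorem smul (h : FormallyAdjoint L L') (z : ℂ) :
    FormallyAdjoint (z • L) ((starRingEnd ℂ) z • L') := fun f g => by
  simp [inner_smul_left, inner_smul_right, h f g]

theorem mul (h : FormallyAdjoint L L') (k : FormallyAdjoint K K') :
    FormallyAdjoint (L * K) (K' * L') := fun f g => by
  change inner ℂ (schwartzToL2 d (L (K f))) _ = inner ℂ _ (schwartzToL2 d (K' (L' g)))
  rw [h, k]

theorem sum {ι : Type*} (s : Finset ι) {L L' : ι → Schwartz d →L[ℂ] Schwartz d}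
    (h : ∀ i, FormallyAdjoint (L i) (L' i)) :
    FormallyAdjoint (∑ i ∈ s, L i) (∑ i ∈ s, L' i) := fun f g => by
  simp [sum_inner, inner_sum, h _ f g]

theorem position (μ : Fin d) : FormallyAdjoint (position μ) (position μ) := fun f g => by
  rw [inner_schwartzToL2, inner_schwartzToL2]
  simp [position_apply]

theorem fiberwise (c : FermionSpace d →L[ℂ] FermionSpace d) :
    FormallyAdjoint (fiberwise c) (fiberwise (ContinuousLinearMap.adjoint c)) := fun f g => by
  rw [inner_schwartzToL2, inner_schwartzToL2]
  simp [fiberwise_apply, ContinuousLinearMap.adjoint_inner_right]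

theorem partialDeriv (μ : Fin d) : FormallyAdjoint (partialDeriv μ) (-partialDeriv μ) :=
    fun f g => by
  -- Integration by parts, with the inner product regarded as a bounded real-bilinear map.
  have h := SchwartzMap.integral_bilinear_lineDerivOp_right_eq_neg_left (μ := volume) f g
    (isBoundedBilinearMap_inner (𝕜 := ℂ) (E := FermionSpace d)).toContinuousLinearMap
    (EuclideanSpace.single μ 1)
  change ∫ x, inner ℂ (f x) (HarmonicOscillator.partialDeriv μ g x) =
    -∫ x, inner ℂ (HarmonicOscillator.partialDeriv μ f x) (g x) at h
  rw [inner_schwartzToL2, inner_schwartzToL2]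
  simp only [neg_apply, inner_neg_right,
    integral_neg, h, neg_neg]

end FormallyAdjoint

theorem formallyAdjoint_boson (μ : Fin d) :
    FormallyAdjoint (bosonAnnihilation ω μ) (bosonCreation ω μ) := by
  have h := ((FormallyAdjoint.position μ).smul (ω : ℂ)).add (FormallyAdjoint.partialDeriv μ)
  rwa [Complex.conj_ofReal, ← sub_eq_add_neg] at h

end HarmonicOscillator

/-! ### Ground states and spectrum of the harmonic oscillator. -/

namespace HarmonicOscillator

variable {d : ℕ}

/-! ### The Gaussian -/

/-- One has (1 + t)^n ≤ n! e^{1+t}, and completing the square gives t - bt² ≤ 1/(4b); these two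
bounds make up the constant. -/
theorem exists_pow_mul_exp_neg_sq_le {b : ℝ} (hb : 0 < b) (n : ℕ) :
    ∃ C : ℝ, ∀ t : ℝ, 0 ≤ t → (1 + t) ^ n * Real.exp (-b * t ^ 2) ≤ C := by
  refine ⟨n.factorial * Real.exp (1 + 1 / (4 * b)), fun t ht => ?_⟩
  have h1 : (1 + t) ^ n ≤ n.factorial * Real.exp (1 + t) := by
    have := Real.pow_div_factorial_le_exp (1 + t) (by positivity) n
    rwa [div_le_iff₀ (by positivity), mul_comm] at this
  calc (1 + t) ^ n * Real.exp (-b * t ^ 2)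
      ≤ n.factorial * Real.exp (1 + t) * Real.exp (-b * t ^ 2) := by gcongr
    _ = n.factorial * Real.exp (1 + t + -b * t ^ 2) := by rw [mul_assoc, ← Real.exp_add]
    _ ≤ _ := by
      refine mul_le_mul_of_nonneg_left (Real.exp_le_exp.2 ?_) (by positivity)
      have : 1 / (4 * b) - t + b * t ^ 2 = (2 * b * t - 1) ^ 2 / (4 * b) := by
        field_simp; ring
      have h2 : 0 ≤ (2 * b * t - 1) ^ 2 / (4 * b) := by positivity
      linarith

theorem contDiff_gaussian (E : Type*) [NormedAddCommGroup E] [InnerProductSpace ℝ E] (b : ℝ)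
    {n : WithTop ℕ∞} : ContDiff ℝ n fun x : E => Real.exp (-b * ‖x‖ ^ 2) :=
  Real.contDiff_exp.comp (contDiff_const.mul (contDiff_norm_sq ℝ))

/-- The Gaussian `exp (-b ‖x‖²)` as a Schwartz function. -/
def gaussian (E : Type*) [NormedAddCommGroup E] [InnerProductSpace ℝ E] (b : ℝ) (hb : 0 < b) :
    𝓢(E, ℝ) where
  toFun x := Real.exp (-b * ‖x‖ ^ 2)
  smooth' := contDiff_gaussian E b
  decay' k n := by
    have hf : Function.HasTemperateGrowth fun x : E => -b * ‖x‖ ^ 2 :=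
      (Function.HasTemperateGrowth.const (-b)).mul (Function.hasTemperateGrowth_norm_sq (H := E))
    obtain ⟨l, C, hC, h⟩ := hf.norm_iteratedFDeriv_le_uniform n
    obtain ⟨K, hK⟩ := exists_pow_mul_exp_neg_sq_le hb (k + l * n)
    refine ⟨n.factorial * (1 + C) ^ n * K, fun x => ?_⟩
    have h1 : (1 : ℝ) ≤ 1 + ‖x‖ := by linarith [norm_nonneg x]
    -- The bound for derivatives of a composition asks for D^i in order i. Enlarging C to 1 + C
    -- makes D ≥ 1, so a bound by D suffices.
    have hD : 1 ≤ (1 + C) * (1 + ‖x‖) ^ l :=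
      one_le_mul_of_one_le_of_one_le (by linarith) (one_le_pow₀ h1)
    have key := norm_iteratedFDeriv_comp_le (n := n) (N := n) (g := Real.exp)
      (f := fun x : E => -b * ‖x‖ ^ 2) Real.contDiff_exp
      (contDiff_const.mul (contDiff_norm_sq ℝ)) le_rfl x (C := Real.exp (-b * ‖x‖ ^ 2))
      (D := (1 + C) * (1 + ‖x‖) ^ l)
      (fun i _ => by
        rw [norm_iteratedFDeriv_eq_norm_iteratedDeriv, iteratedDeriv_eq_iterate, Real.iter_deriv_exp]
        simp)
      (fun i hi hin => by
        refine (h i hin x).trans (le_trans ?_ (le_self_pow₀ hD (by omega)))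
        gcongr
        linarith)
    calc ‖x‖ ^ k * ‖iteratedFDeriv ℝ n (Real.exp ∘ fun x : E => -b * ‖x‖ ^ 2) x‖
        ≤ (1 + ‖x‖) ^ k * (n.factorial * Real.exp (-b * ‖x‖ ^ 2) *
          ((1 + C) * (1 + ‖x‖) ^ l) ^ n) := by
          gcongr
          linarith
      _ = n.factorial * (1 + C) ^ n * ((1 + ‖x‖) ^ (k + l * n) * Real.exp (-b * ‖x‖ ^ 2)) := by
          rw [pow_add, pow_mul, mul_pow]; ring
      _ ≤ _ := by
          gcongr
          exact hK _ (norm_nonneg x)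

theorem gaussian_apply (E : Type*) [NormedAddCommGroup E] [InnerProductSpace ℝ E] (b : ℝ)
    (hb : 0 < b) (x : E) : gaussian E b hb x = Real.exp (-b * ‖x‖ ^ 2) := rfl

/-! ### Energy levels of the harmonic oscillator -/

variable {ω : ℝ} (hω : 0 < ω)

/-- The ground states `exp (-ω ‖x‖² / 2) ⊗ v`. -/
def vacuum : FermionSpace d →ₗ[ℂ] Schwartz d where
  toFun v := SchwartzMap.postcompCLM (𝕜 := ℝ) ((ContinuousLinearMap.id ℝ ℝ).smulRight v)
    (gaussian (EuclideanSpace ℝ (Fin d)) (ω / 2) (half_pos hω))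
  map_add' v w := by
    ext x : 1
    simp
  map_smul' c v := by
    ext x : 1
    exact smul_comm (Real.exp (-(ω / 2) * ‖x‖ ^ 2)) c v

theorem vacuum_apply (v : FermionSpace d) (x : EuclideanSpace ℝ (Fin d)) :
    vacuum hω v x = Real.exp (-(ω / 2) * ‖x‖ ^ 2) • v := by
  simp [vacuum, gaussian_apply]

theorem bosonAnnihilation_vacuum (μ : Fin d) (v : FermionSpace d) :
    bosonAnnihilation ω μ (vacuum hω v) = 0 := by
  ext x : 1
  have h : (vacuum hω v : EuclideanSpace ℝ (Fin d) → FermionSpace d) =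
      fun x => Real.exp (-(ω / 2) * ‖x‖ ^ 2) • v := funext fun x => vacuum_apply hω v x
  have h1 : HasFDerivAt (fun x : EuclideanSpace ℝ (Fin d) => Real.exp (-(ω / 2) * ‖x‖ ^ 2) • v)
      _ x := (((hasStrictFDerivAt_norm_sq x).hasFDerivAt.const_mul (-(ω / 2))).exp).smul_const v
  simp only [bosonAnnihilation, add_apply, smul_apply, position_apply, partialDeriv_apply]
  rw [h, h1.fderiv]
  have h2 : inner ℝ x (EuclideanSpace.single μ (1 : ℝ)) = x μ := by
    rw [EuclideanSpace.inner_single_right]; simp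
  ext s
  simp [h2]
  ring

/-- The `k`-th energy level: the span of the `k`-fold excitations of the ground states. -/
def level : ℕ → Submodule ℂ (Schwartz d)
  | 0 => LinearMap.range (vacuum hω)
  | k + 1 => ⨆ μ : Fin d, (level k).map (bosonCreation ω μ).toLinearMap

instance finiteDimensional_level (k : ℕ) : FiniteDimensional ℂ (level (d := d) hω k) := by
  induction k with
  | zero => exact inferInstanceAs (FiniteDimensional ℂ (LinearMap.range (vacuum hω)))
  | succ k ih => exact Submodule.finiteDimensional_iSup _

theorem bosonCreation_mem_level (μ : Fin d) {k : ℕ} {f : Schwartz d} (hf : f ∈ level hω k) :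
    bosonCreation ω μ f ∈ level hω (k + 1) :=
  Submodule.mem_iSup_of_mem μ (Submodule.mem_map_of_mem hf)

theorem level_succ_induction {k : ℕ} {p : Submodule ℂ (Schwartz d)}
    (h : ∀ μ, ∀ f ∈ level hω k, bosonCreation ω μ f ∈ p) : level hω (k + 1) ≤ p := by
  refine iSup_le fun μ => ?_
  rintro _ ⟨f, hf, rfl⟩
  exact h μ f hf

theorem bosonAnnihilation_creation_apply (μ ν : Fin d) (f : Schwartz d) :
    bosonAnnihilation ω μ (bosonCreation ω ν f) =
      bosonCreation ω ν (bosonAnnihilation ω μ f) + if μ = ν then (2 * ω : ℂ) • f else 0 := by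
  have h := congrArg (fun T => T f) (bosonAnnihilation_mul_creation ω μ ν)
  by_cases hμ : μ = ν <;> simpa [hμ] using h

theorem bosonAnnihilation_level_zero (μ : Fin d) {f : Schwartz d} (hf : f ∈ level hω 0) :
    bosonAnnihilation ω μ f = 0 := by
  obtain ⟨v, rfl⟩ := hf
  exact bosonAnnihilation_vacuum hω μ v

/-- Moving a_μ to the right past one creation operator costs a scalar, and a_μ kills level 0, so the
excitation number drops by one. -/
theorem bosonAnnihilation_mem_level (μ : Fin d) {k : ℕ} {f : Schwartz d}
    (hf : f ∈ level hω (k + 1)) : bosonAnnihilation ω μ f ∈ level hω k := by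
  induction k generalizing f with
  | zero =>
    refine level_succ_induction hω
      (p := (level hω 0).comap (bosonAnnihilation ω μ).toLinearMap) (fun ν g hg => ?_) hf
    rw [Submodule.mem_comap, ContinuousLinearMap.coe_coe, bosonAnnihilation_creation_apply,
      bosonAnnihilation_level_zero hω μ hg]
    split_ifs
    · simpa using Submodule.smul_mem _ _ hg
    · simp
  | succ k ih =>
    refine level_succ_induction hω
      (p := (level hω (k + 1)).comap (bosonAnnihilation ω μ).toLinearMap) (fun ν g hg => ?_) hf
    rw [Submodule.mem_comap, ContinuousLinearMap.coe_coe, bosonAnnihilation_creation_apply]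
    refine add_mem (bosonCreation_mem_level hω ν (ih hg)) ?_
    split_ifs
    · exact Submodule.smul_mem _ _ hg
    · exact zero_mem _

theorem fiberwise_mem_level (c : FermionSpace d →L[ℂ] FermionSpace d) {k : ℕ} {f : Schwartz d}
    (hf : f ∈ level hω k) : fiberwise c f ∈ level hω k := by
  induction k generalizing f with
  | zero =>
    obtain ⟨v, rfl⟩ := hf
    refine ⟨c v, ?_⟩
    ext x : 1
    rw [fiberwise_apply, vacuum_apply, vacuum_apply]
    exact ((c.restrictScalars ℝ).map_smul _ v).symm
  | succ k ih =>
    refine level_succ_induction hω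
      (p := (level hω (k + 1)).comap (fiberwise c).toLinearMap) (fun ν g hg => ?_) hf
    have h : fiberwise c (bosonCreation ω ν g) = bosonCreation ω ν (fiberwise c g) :=
      congrArg (fun T => T g) (bosonCreation_commute_fiberwise ω ν c).symm.eq
    rw [Submodule.mem_comap, ContinuousLinearMap.coe_coe, h]
    exact bosonCreation_mem_level hω ν (ih hg)

/-- The number operator acts on the `k`-th energy level as the scalar `2ωk`. -/
theorem number_level {k : ℕ} {f : Schwartz d} (hf : f ∈ level hω k) :
    ∑ μ, bosonCreation ω μ (bosonAnnihilation ω μ f) = (2 * ω * k : ℂ) • f := by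
  induction k generalizing f with
  | zero => simp [bosonAnnihilation_level_zero hω _ hf]
  | succ k ih =>
    have key : level (d := d) hω (k + 1) ≤ LinearMap.eqLocus
        (∑ μ : Fin d, (bosonCreation ω μ * bosonAnnihilation ω μ).toLinearMap)
        ((2 * ω * (k + 1 : ℕ) : ℂ) • LinearMap.id) := by
      refine level_succ_induction hω fun ν g hg => ?_
      rw [LinearMap.mem_eqLocus]
      simp only [LinearMap.sum_apply, ContinuousLinearMap.coe_coe, mul_apply_eq_comp,
        bosonAnnihilation_creation_apply, map_add, Finset.sum_add_distrib]
      -- Creation operators commute, so one part is a_ν^* applied to the number operator on g; the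
      -- delta term adds 2ω a_ν^* g and raises the eigenvalue by 2ω.
      have h : ∀ μ, bosonCreation ω μ (bosonCreation ω ν (bosonAnnihilation ω μ g)) =
          bosonCreation ω ν (bosonCreation ω μ (bosonAnnihilation ω μ g)) := fun μ =>
        congrArg (fun T => T (bosonAnnihilation ω μ g)) (bosonCreation_commute ω μ ν).eq
      simp only [h, ← map_sum, ih hg, apply_ite (bosonCreation ω _), map_smul, map_zero]
      simp
      module
    simpa using key hf

/-- Distinct levels are eigenspaces of the symmetric number operator for the distinct eigenvalues
2ωj and 2ωk. -/
theorem inner_level_eq_zero {j k : ℕ} (hjk : j ≠ k) {f g : Schwartz d} (hf : f ∈ level hω j)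
    (hg : g ∈ level hω k) : inner ℂ (schwartzToL2 d f) (schwartzToL2 d g) = 0 := by
  have hN : FormallyAdjoint (∑ μ : Fin d, bosonCreation ω μ * bosonAnnihilation ω μ)
      (∑ μ : Fin d, bosonCreation ω μ * bosonAnnihilation ω μ) :=
    FormallyAdjoint.sum _ fun μ => (formallyAdjoint_boson ω μ).symm.mul (formallyAdjoint_boson ω μ)
  have h := hN f g
  simp only [sum_apply, mul_apply_eq_comp, number_level hω hf,
    number_level hω hg, map_smul, inner_smul_left, inner_smul_right] at h
  have h1 : ((2 * ω * j : ℝ) - (2 * ω * k : ℝ) : ℂ) *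
      inner ℂ (schwartzToL2 d f) (schwartzToL2 d g) = 0 := by
    simp only [map_mul, Complex.conj_ofReal, map_ofNat, map_natCast] at h
    push_cast
    linear_combination h
  refine (mul_eq_zero.1 h1).resolve_left ?_
  norm_cast
  rw [← mul_sub]
  have : (j : ℝ) - k ≠ 0 := sub_ne_zero.2 (by exact_mod_cast hjk)
  positivity

/-- Since ‖a_μ f‖² = ⟨f, a_μ^* a_μ f⟩, the sum is the quadratic form of the number operator. -/
theorem sum_norm_sq_bosonAnnihilation {k : ℕ} {f : Schwartz d} (hf : f ∈ level hω k) :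
    ∑ μ, ‖schwartzToL2 d (bosonAnnihilation ω μ f)‖ ^ 2 = 2 * ω * k * ‖schwartzToL2 d f‖ ^ 2 := by
  have h : ∀ μ, (‖schwartzToL2 d (bosonAnnihilation ω μ f)‖ ^ 2 : ℂ) = inner ℂ (schwartzToL2 d f)
      (schwartzToL2 d (bosonCreation ω μ (bosonAnnihilation ω μ f))) := fun μ => by
    rw [← formallyAdjoint_boson ω μ, inner_self_eq_norm_sq_to_K]; rfl
  have h1 := congrArg (fun g => inner ℂ (schwartzToL2 d f) (schwartzToL2 d g)) (number_level hω hf)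
  simp only [map_sum, inner_sum, ← h, map_smul, inner_smul_right, inner_self_eq_norm_sq_to_K] at h1
  exact Complex.ofReal_injective (by push_cast; exact h1)

theorem norm_sq_bosonAnnihilation_le (μ : Fin d) {k : ℕ} {f : Schwartz d} (hf : f ∈ level hω k) :
    ‖schwartzToL2 d (bosonAnnihilation ω μ f)‖ ^ 2 ≤ 2 * ω * k * ‖schwartzToL2 d f‖ ^ 2 := by
  rw [← sum_norm_sq_bosonAnnihilation hω hf]
  exact Finset.single_le_sum
    (f := fun μ => ‖schwartzToL2 d (bosonAnnihilation ω μ f)‖ ^ 2) (fun _ _ => by positivity)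
    (Finset.mem_univ μ)

end HarmonicOscillator

namespace HarmonicOscillator

variable {d : ℕ} {ω : ℝ} (hω : 0 < ω)

/-! ### Projections onto the energy levels -/

/-- The orthogonal projection of `L²` onto the `k`-th energy level. -/
def levelProj (k : ℕ) : L2 d →ₗ[ℂ] Schwartz d :=
  (level hω k).subtype ∘ₗ
    (Submodule.equivMapOfInjective _ (schwartzToL2_injective d) (level hω k)).symm.toLinearMap ∘ₗ
      ((level hω k).map (schwartzToL2 d)).orthogonalProjectionOnto.toLinearMap

theorem levelProj_mem (k : ℕ) (ψ : L2 d) : levelProj hω k ψ ∈ level hω k :=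
  Submodule.coe_mem _

theorem schwartzToL2_levelProj (k : ℕ) (ψ : L2 d) : schwartzToL2 d (levelProj hω k ψ) =
    ((level hω k).map (schwartzToL2 d)).orthogonalProjectionOnto ψ := by
  rw [← LinearEquiv.apply_symm_apply
    (Submodule.equivMapOfInjective _ (schwartzToL2_injective d) (level hω k))
      (((level hω k).map (schwartzToL2 d)).orthogonalProjectionOnto ψ),
    Submodule.coe_equivMapOfInjective_apply]
  rfl

theorem inner_levelProj {k : ℕ} {g : Schwartz d} (hg : g ∈ level hω k) (ψ : L2 d) :
    inner ℂ (schwartzToL2 d g) (schwartzToL2 d (levelProj hω k ψ)) =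
      inner ℂ (schwartzToL2 d g) ψ := by
  rw [schwartzToL2_levelProj]
  exact Submodule.inner_orthogonalProjectionOnto_eq_of_mem_left
    (⟨_, Submodule.mem_map_of_mem hg⟩ : (level hω k).map (schwartzToL2 d)) ψ

/-- The difference of the two candidates lies in the level and is orthogonal to all of it, hence to
itself. This is the tool for commuting the projections with other operators. -/
theorem levelProj_eq {k : ℕ} {f : Schwartz d} (hf : f ∈ level hω k) {ψ : L2 d}
    (h : ∀ g ∈ level hω k, inner ℂ (schwartzToL2 d g) (schwartzToL2 d f) =
      inner ℂ (schwartzToL2 d g) ψ) : levelProj hω k ψ = f := by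
  have h1 := h _ (sub_mem (levelProj_mem hω k ψ) hf)
  have h2 := inner_levelProj hω (sub_mem (levelProj_mem hω k ψ) hf) ψ
  have h3 : inner ℂ (schwartzToL2 d (levelProj hω k ψ - f))
      (schwartzToL2 d (levelProj hω k ψ - f)) = 0 := by
    rw [map_sub (schwartzToL2 d), inner_sub_right, ← map_sub, h1, h2, sub_self]
  rw [inner_self_eq_zero] at h3
  exact sub_eq_zero.1 (schwartzToL2_injective d (h3.trans (map_zero _).symm))

theorem levelProj_self {k : ℕ} {f : Schwartz d} (hf : f ∈ level hω k) :
    levelProj hω k (schwartzToL2 d f) = f :=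
  levelProj_eq hω hf fun _ _ => rfl

theorem levelProj_of_ne {j k : ℕ} (hjk : j ≠ k) {f : Schwartz d} (hf : f ∈ level hω j) :
    levelProj hω k (schwartzToL2 d f) = 0 :=
  levelProj_eq hω (zero_mem _) fun g hg => by simp [inner_level_eq_zero hω hjk.symm hg hf]

/-- Tested against g in level k, a_μ moves over as a_μ^*, and a_μ^* g lies in level k + 1. -/
theorem levelProj_bosonAnnihilation (k : ℕ) (μ : Fin d) (φ : Schwartz d) :
    levelProj hω k (schwartzToL2 d (bosonAnnihilation ω μ φ)) =
      bosonAnnihilation ω μ (levelProj hω (k + 1) (schwartzToL2 d φ)) :=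
  levelProj_eq hω (bosonAnnihilation_mem_level hω μ (levelProj_mem hω _ _)) fun g hg => by
    rw [← (formallyAdjoint_boson ω μ).symm, ← (formallyAdjoint_boson ω μ).symm,
      inner_levelProj hω (bosonCreation_mem_level hω μ hg)]

theorem levelProj_fiberwise (k : ℕ) (c : FermionSpace d →L[ℂ] FermionSpace d) (φ : Schwartz d) :
    levelProj hω k (schwartzToL2 d (fiberwise c φ)) =
      fiberwise c (levelProj hω k (schwartzToL2 d φ)) :=
  levelProj_eq hω (fiberwise_mem_level hω c (levelProj_mem hω _ _)) fun g hg => by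
    rw [← (FormallyAdjoint.fiberwise c).symm, ← (FormallyAdjoint.fiberwise c).symm,
      inner_levelProj hω (fiberwise_mem_level hω _ hg)]

theorem inner_levelProj_left (k : ℕ) (ψ χ : L2 d) :
    inner ℂ (schwartzToL2 d (levelProj hω k ψ)) χ =
      inner ℂ ψ (schwartzToL2 d (levelProj hω k χ)) := by
  rw [← inner_levelProj hω (levelProj_mem hω k ψ), ← inner_conj_symm,
    inner_levelProj hω (levelProj_mem hω k χ), inner_conj_symm]

theorem norm_sq_sum_level {f : ℕ → Schwartz d} (hf : ∀ k, f k ∈ level hω k) (n : ℕ) :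
    ‖schwartzToL2 d (∑ k ∈ Finset.range n, f k)‖ ^ 2 =
      ∑ k ∈ Finset.range n, ‖schwartzToL2 d (f k)‖ ^ 2 := by
  induction n with
  | zero => simp
  | succ n ih =>
    have h : inner ℂ (schwartzToL2 d (∑ k ∈ Finset.range n, f k)) (schwartzToL2 d (f n)) = 0 := by
      rw [map_sum, sum_inner]
      exact Finset.sum_eq_zero fun k hk =>
        inner_level_eq_zero hω (Finset.mem_range.1 hk).ne (hf k) (hf n)
    rw [Finset.sum_range_succ, Finset.sum_range_succ, map_add, norm_add_sq (𝕜 := ℂ), h, ih]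
    simp

/-- Bessel's inequality: the partial sum u of the projections satisfies ⟨u, ψ⟩ = ‖u‖², so
Cauchy–Schwarz gives ‖u‖ ≤ ‖ψ‖. -/
theorem sum_norm_sq_levelProj_le (n : ℕ) (ψ : L2 d) :
    ∑ k ∈ Finset.range n, ‖schwartzToL2 d (levelProj hω k ψ)‖ ^ 2 ≤ ‖ψ‖ ^ 2 := by
  set u := schwartzToL2 d (∑ k ∈ Finset.range n, levelProj hω k ψ) with hu
  have h1 := norm_sq_sum_level hω (fun k => levelProj_mem hω k ψ) n
  have h2 : inner ℂ u ψ = (‖u‖ ^ 2 : ℂ) := by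
    have : ∀ k, inner ℂ (schwartzToL2 d (levelProj hω k ψ)) ψ =
        (‖schwartzToL2 d (levelProj hω k ψ)‖ ^ 2 : ℂ) := fun k => by
      rw [← inner_levelProj hω (levelProj_mem hω k ψ), inner_self_eq_norm_sq_to_K]; rfl
    rw [hu]
    norm_cast
    rw [h1, map_sum, sum_inner]
    push_cast
    exact Finset.sum_congr rfl fun k _ => this k
  have h3 : ‖u‖ ^ 2 ≤ ‖u‖ * ‖ψ‖ := by
    have := norm_inner_le_norm (𝕜 := ℂ) u ψ
    rw [h2] at this
    simpa using this
  rw [← h1, ← hu]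
  refine pow_le_pow_left₀ (norm_nonneg _) ?_ 2
  by_contra! h
  nlinarith [norm_nonneg ψ]

/-! ### The regularizing operators -/

/-- The regularizing operator `∑_{k < n} (1 - k / n) P_k`, with `P_k` the projection onto the
`k`-th energy level. -/
def regularizer (n : ℕ) : L2 d →ₗ[ℂ] Schwartz d :=
  ∑ k ∈ Finset.range n, ((1 - k / n : ℝ) : ℂ) • levelProj hω k

theorem regularizer_apply (n : ℕ) (ψ : L2 d) : regularizer hω n ψ =
    ∑ k ∈ Finset.range n, ((1 - k / n : ℝ) : ℂ) • levelProj hω k ψ := by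
  simp [regularizer]

theorem inner_regularizer (n : ℕ) (ψ χ : L2 d) :
    inner ℂ (schwartzToL2 d (regularizer hω n ψ)) χ =
      inner ℂ ψ (schwartzToL2 d (regularizer hω n χ)) := by
  simp only [regularizer_apply, map_sum, map_smul, sum_inner, inner_sum, inner_smul_left,
    inner_smul_right, Complex.conj_ofReal, inner_levelProj_left]

theorem norm_sq_sum_smul_levelProj (c : ℕ → ℝ) (n : ℕ) (ψ : L2 d) :
    ‖schwartzToL2 d (∑ k ∈ Finset.range n, (c k : ℂ) • levelProj hω k ψ)‖ ^ 2 =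
      ∑ k ∈ Finset.range n, c k ^ 2 * ‖schwartzToL2 d (levelProj hω k ψ)‖ ^ 2 := by
  rw [norm_sq_sum_level hω fun k => Submodule.smul_mem _ _ (levelProj_mem hω k ψ)]
  simp [norm_smul, mul_pow]

theorem norm_regularizer_le (n : ℕ) (ψ : L2 d) :
    ‖schwartzToL2 d (regularizer hω n ψ)‖ ≤ ‖ψ‖ := by
  refine (sq_le_sq₀ (norm_nonneg _) (norm_nonneg _)).1 ?_
  rw [regularizer_apply, norm_sq_sum_smul_levelProj hω fun k => 1 - k / n]
  refine (Finset.sum_le_sum fun k hk => ?_).trans (sum_norm_sq_levelProj_le hω n ψ)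
  have hk' : (k : ℝ) / n ≤ 1 :=
    div_le_one_of_le₀ (by exact_mod_cast (Finset.mem_range.1 hk).le) (by positivity)
  have hk0 : 0 ≤ (k : ℝ) / n := by positivity
  exact mul_le_of_le_one_left (by positivity) (pow_le_one₀ (by linarith) (by linarith))

theorem regularizer_fiberwise (n : ℕ) (c : FermionSpace d →L[ℂ] FermionSpace d)
    (φ : Schwartz d) : regularizer hω n (schwartzToL2 d (fiberwise c φ)) =
      fiberwise c (regularizer hω n (schwartzToL2 d φ)) := by
  simp only [regularizer_apply, map_sum, map_smul, levelProj_fiberwise]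

/-- Because a_μ carries level k + 1 to level k, the commutator compares the weights of neighbouring
levels, and these differ by exactly 1/n. -/
theorem regularizer_bosonAnnihilation (n : ℕ) (μ : Fin d) (φ : Schwartz d) :
    regularizer hω n (schwartzToL2 d (bosonAnnihilation ω μ φ)) -
      bosonAnnihilation ω μ (regularizer hω n (schwartzToL2 d φ)) =
    ∑ k ∈ Finset.range n, ((1 / n : ℝ) : ℂ) •
      levelProj hω k (schwartzToL2 d (bosonAnnihilation ω μ φ)) := by
  rcases n.eq_zero_or_pos with rfl | hn
  · simp [regularizer_apply]
  have hn' : (n : ℝ) ≠ 0 := by positivity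
  have h : bosonAnnihilation ω μ (regularizer hω n (schwartzToL2 d φ)) =
      ∑ k ∈ Finset.range n, ((1 - (k + 1 : ℕ) / n : ℝ) : ℂ) •
        levelProj hω k (schwartzToL2 d (bosonAnnihilation ω μ φ)) := by
    simp only [regularizer_apply, map_sum, map_smul, levelProj_bosonAnnihilation]
    -- The index shift loses nothing at either end: the weight 1 - n/n at k = n is zero, and a_μ
    -- annihilates level 0.
    have h1 := Finset.sum_range_succ (fun k => ((1 - (k : ℕ) / n : ℝ) : ℂ) •
      bosonAnnihilation ω μ (levelProj hω k (schwartzToL2 d φ))) n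
    rw [Finset.sum_range_succ', bosonAnnihilation_level_zero hω μ (levelProj_mem hω 0 _)] at h1
    simpa [hn'] using h1.symm
  rw [h, regularizer_apply, ← Finset.sum_sub_distrib]
  refine Finset.sum_congr rfl fun k _ => ?_
  rw [← sub_smul]
  congr 1
  push_cast
  ring

/-- On the levels k + 1 ≤ n that occur, the squared norm of a_μ is at most 2ωn; against the factor
1/n² this leaves 2ω/n. -/
theorem norm_regularizer_bosonAnnihilation_le (n : ℕ) (μ : Fin d) (φ : Schwartz d) :
    ‖schwartzToL2 d (regularizer hω n (schwartzToL2 d (bosonAnnihilation ω μ φ))) -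
      schwartzToL2 d (bosonAnnihilation ω μ (regularizer hω n (schwartzToL2 d φ)))‖ ≤
    √(2 * ω) / √n * ‖schwartzToL2 d φ‖ := by
  -- For n = 0 the right side is zero by the convention for division by zero, and the regularizer is
  -- an empty sum.
  rcases n.eq_zero_or_pos with rfl | hn
  · simp [regularizer_apply]
  have hn' : (0 : ℝ) < n := by positivity
  refine (sq_le_sq₀ (norm_nonneg _) (by positivity)).1 ?_
  rw [← map_sub, regularizer_bosonAnnihilation,
    norm_sq_sum_smul_levelProj hω fun _ => 1 / n, mul_pow, div_pow (√(2 * ω)),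
    Real.sq_sqrt (by positivity), Real.sq_sqrt (by positivity)]
  calc ∑ k ∈ Finset.range n, (1 / n : ℝ) ^ 2 *
        ‖schwartzToL2 d (levelProj hω k (schwartzToL2 d (bosonAnnihilation ω μ φ)))‖ ^ 2
      ≤ ∑ k ∈ Finset.range n, 2 * ω / n *
        ‖schwartzToL2 d (levelProj hω (k + 1) (schwartzToL2 d φ))‖ ^ 2 := by
        refine Finset.sum_le_sum fun k hk => ?_
        rw [levelProj_bosonAnnihilation]
        refine (mul_le_mul_of_nonneg_left
          (norm_sq_bosonAnnihilation_le hω μ (levelProj_mem hω (k + 1) _)) (by positivity)).trans ?_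
        rw [← mul_assoc]
        refine mul_le_mul_of_nonneg_right ?_ (by positivity)
        have hk' : ((k + 1 : ℕ) : ℝ) ≤ n := by exact_mod_cast Finset.mem_range.1 hk
        calc (1 / n : ℝ) ^ 2 * (2 * ω * (k + 1 : ℕ)) ≤ (1 / n : ℝ) ^ 2 * (2 * ω * n) := by gcongr
          _ = 2 * ω / n := by field_simp
    _ = 2 * ω / n * ∑ k ∈ Finset.range n,
        ‖schwartzToL2 d (levelProj hω (k + 1) (schwartzToL2 d φ))‖ ^ 2 := by
        rw [Finset.mul_sum]
    _ ≤ 2 * ω / n * ‖schwartzToL2 d φ‖ ^ 2 := by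
        refine mul_le_mul_of_nonneg_left ?_ (by positivity)
        refine le_trans ?_ (sum_norm_sq_levelProj_le hω (n + 1) _)
        rw [Finset.sum_range_succ']
        exact le_add_of_nonneg_right (by positivity)

/-- Since a_μ P_{k+1} = P_k a_μ, this is Bessel's inequality for a_μφ; level 0 contributes nothing,
so m + 1 levels of φ correspond to m levels of a_μφ. -/
theorem sum_sum_norm_sq_bosonAnnihilation_le (m : ℕ) (φ : Schwartz d) :
    ∑ k ∈ Finset.range (m + 1), ∑ μ,
      ‖schwartzToL2 d (bosonAnnihilation ω μ (levelProj hω k (schwartzToL2 d φ)))‖ ^ 2 ≤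
    ∑ μ, ‖schwartzToL2 d (bosonAnnihilation ω μ φ)‖ ^ 2 := by
  rw [Finset.sum_comm]
  refine Finset.sum_le_sum fun μ _ => ?_
  refine le_trans (le_of_eq ?_) (sum_norm_sq_levelProj_le hω m _)
  rw [Finset.sum_range_succ', bosonAnnihilation_level_zero hω μ (levelProj_mem hω 0 _), map_zero,
    norm_zero, zero_pow two_ne_zero, add_zero]
  exact Finset.sum_congr rfl fun k _ => by rw [levelProj_bosonAnnihilation]

/-- The squared coefficient of the difference on level k is at most k/n, while ∑ ‖a_μ ·‖² carries
the weight 2ωk there; the ratio of the two is 1/(2ωn). -/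
theorem norm_regularizer_sub_regularizer_le {m n : ℕ} (hn : 0 < n) (hmn : n ≤ m)
    (φ : Schwartz d) :
    ‖schwartzToL2 d (regularizer hω m (schwartzToL2 d φ)) -
      schwartzToL2 d (regularizer hω n (schwartzToL2 d φ))‖ ^ 2 ≤
    1 / (2 * ω * n) * ∑ μ, ‖schwartzToL2 d (bosonAnnihilation ω μ φ)‖ ^ 2 := by
  have hn' : (0 : ℝ) < n := by positivity
  have hm' : (0 : ℝ) < m := by exact_mod_cast hn.trans_le hmn
  set c : ℕ → ℝ := fun k => (1 - k / m) - (if k < n then 1 - k / n else 0 : ℝ) with hc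
  have h : regularizer hω m (schwartzToL2 d φ) - regularizer hω n (schwartzToL2 d φ) =
      ∑ k ∈ Finset.range m, (c k : ℂ) • levelProj hω k (schwartzToL2 d φ) := by
    have h1 : regularizer hω n (schwartzToL2 d φ) = ∑ k ∈ Finset.range m,
        ((if k < n then 1 - k / n else 0 : ℝ) : ℂ) • levelProj hω k (schwartzToL2 d φ) := by
      rw [regularizer_apply]
      refine Finset.sum_subset_zero_on_sdiff (Finset.range_subset_range.2 hmn) ?_ ?_
      · intro k hk
        simp at hk
        simp [hk.2]
      · intro k hk
        simp [Finset.mem_range.1 hk]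
    rw [h1, regularizer_apply, ← Finset.sum_sub_distrib]
    refine Finset.sum_congr rfl fun k _ => ?_
    rw [← sub_smul, hc]
    push_cast
    rfl
  -- Below n the coefficient is k/n - k/m, which lies in [0, k/n] with k/n ≤ 1. From n on it is 1 -
  -- k/m, whose square is at most 1 ≤ k/n.
  have hck : ∀ k < m, c k ^ 2 ≤ k / n := fun k hk => by
    have h1 : (k : ℝ) / m ≤ 1 := div_le_one_of_le₀ (by exact_mod_cast hk.le) hm'.le
    have h2 : (k : ℝ) / m ≤ k / n := by gcongr
    have h3 : 0 ≤ (k : ℝ) / m := by positivity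
    simp only [hc]
    split_ifs with hkn
    · have h4 : (k : ℝ) / n ≤ 1 := div_le_one_of_le₀ (by exact_mod_cast hkn.le) hn'.le
      nlinarith
    · have h4 : 1 ≤ (k : ℝ) / n := (one_le_div hn').2 (by exact_mod_cast not_lt.1 hkn)
      nlinarith
  rw [← map_sub, h, norm_sq_sum_smul_levelProj]
  calc ∑ k ∈ Finset.range m, c k ^ 2 * ‖schwartzToL2 d (levelProj hω k (schwartzToL2 d φ))‖ ^ 2
      ≤ ∑ k ∈ Finset.range (m + 1),
        k / n * ‖schwartzToL2 d (levelProj hω k (schwartzToL2 d φ))‖ ^ 2 := by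
        rw [Finset.sum_range_succ]
        refine le_add_of_le_of_nonneg (Finset.sum_le_sum fun k hk => ?_) (by positivity)
        exact mul_le_mul_of_nonneg_right (hck k (Finset.mem_range.1 hk)) (by positivity)
    _ = ∑ k ∈ Finset.range (m + 1), 1 / (2 * ω * n) *
        ∑ μ, ‖schwartzToL2 d (bosonAnnihilation ω μ (levelProj hω k (schwartzToL2 d φ)))‖ ^ 2 := by
        refine Finset.sum_congr rfl fun k _ => ?_
        rw [sum_norm_sq_bosonAnnihilation hω (levelProj_mem hω k _)]
        field_simp
    _ ≤ _ := by
        rw [← Finset.mul_sum]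
        exact mul_le_mul_of_nonneg_left (sum_sum_norm_sq_bosonAnnihilation_le hω m φ)
          (by positivity)

end HarmonicOscillator

namespace HarmonicOscillator

/-! ### Completeness of the energy levels -/

open scoped FourierTransform RealInnerProductSpace in
-- Every smooth compactly supported test function is the Fourier transform of a Schwartz function χ.
-- The multiplication formula then turns its integral against f into that of χ against the transform
-- of f, which vanishes.
theorem ae_eq_zero_of_fourier_eq_zero {V E : Type*} [NormedAddCommGroup V] [InnerProductSpace ℝ V]
    [FiniteDimensional ℝ V] [MeasurableSpace V] [BorelSpace V] [NormedAddCommGroup E]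
    [NormedSpace ℂ E] [CompleteSpace E] {f : V → E} (hf : Integrable f)
    (h : ∀ w, ∫ x, Complex.exp ((⟪w, x⟫ : ℝ) * Complex.I) • f x = 0) : ∀ᵐ x, f x = 0 := by
  have h0 : ∀ w, VectorFourier.fourierIntegral Real.fourierChar volume (innerₗ V).flip f w = 0 := by
    intro w
    -- The Fourier integral has the kernel exp(-2πi⟨x, w⟩), so the hypothesis is used at the
    -- frequency -2πw.
    rw [Real.vector_fourierIntegral_eq_integral_exp_smul, ← h ((-2 * Real.pi) • w)]
    simp [inner_smul_left, real_inner_comm]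
  refine ae_eq_zero_of_integral_contDiff_smul_eq_zero hf.locallyIntegrable fun φ hφ hc => ?_
  have hφ' : ContDiff ℝ ((⊤ : ℕ∞) : WithTop ℕ∞) fun x => (φ x : ℂ) :=
    Complex.ofRealCLM.contDiff.comp hφ
  have hc' : HasCompactSupport fun x => (φ x : ℂ) := hc.comp_left (g := ((↑) : ℝ → ℂ)) rfl
  set χ : 𝓢(V, ℂ) := 𝓕⁻ (hc'.toSchwartzMap hφ') with hχ
  have h1 := VectorFourier.integral_fourierIntegral_smul_eq_flip (L := innerₗ V)
    (μ := volume) (ν := volume) Real.continuous_fourierChar continuous_inner χ.integrable hf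
  simp only [h0, smul_zero, integral_zero] at h1
  rw [← h1]
  refine integral_congr_ae (Filter.Eventually.of_forall fun x => ?_)
  have h2 : VectorFourier.fourierIntegral Real.fourierChar volume (innerₗ V) χ x = φ x := by
    change 𝓕 (χ : V → ℂ) x = φ x
    rw [← SchwartzMap.fourier_coe, hχ, FourierTransform.fourier_fourierInv_eq]
    rfl
  simp only [h2, Complex.coe_smul]

variable {d : ℕ} {ω : ℝ} (hω : 0 < ω)

/-- Since x_ν = (a_ν + a_ν^*)/(2ω), multiplication by a coordinate only moves between neighbouring
levels. -/
theorem position_mem_iSup_level (ν : Fin d) {f : Schwartz d} (hf : f ∈ ⨆ k, level hω k) :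
    position ν f ∈ ⨆ k, level hω k := by
  have key : (⨆ k, level (d := d) hω k) ≤
      (⨆ k, level (d := d) hω k).comap (position ν).toLinearMap := by
    refine iSup_le fun k g hg => ?_
    have h1 : position ν g =
        (2 * ω : ℂ)⁻¹ • (bosonAnnihilation ω ν g + bosonCreation ω ν g) := by
      have hω' : (ω : ℂ) ≠ 0 := by exact_mod_cast hω.ne'
      simp only [bosonAnnihilation, bosonCreation, add_apply, sub_apply, smul_apply]
      rw [add_add_sub_cancel, ← two_smul ℂ, smul_smul, smul_smul]
      rw [mul_assoc, inv_mul_cancel₀ (mul_ne_zero two_ne_zero hω'), one_smul]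
    have h2 : bosonCreation ω ν g ∈ ⨆ k, level hω k :=
      Submodule.mem_iSup_of_mem _ (bosonCreation_mem_level hω ν hg)
    have h3 : bosonAnnihilation ω ν g ∈ ⨆ k, level hω k := by
      cases k with
      | zero => rw [bosonAnnihilation_level_zero hω ν hg]; exact zero_mem _
      | succ k => exact Submodule.mem_iSup_of_mem _ (bosonAnnihilation_mem_level hω ν hg)
    rw [Submodule.mem_comap, ContinuousLinearMap.coe_coe, h1]
    exact Submodule.smul_mem _ _ (add_mem h3 h2)
  exact key hf

theorem exists_level_pow (t : EuclideanSpace ℝ (Fin d)) (v : FermionSpace d) (m : ℕ) :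
    ∃ f ∈ ⨆ k, level hω k, ∀ x, f x =
      ((inner ℝ t x : ℝ) : ℂ) ^ m • Real.exp (-(ω / 2) * ‖x‖ ^ 2) • v := by
  induction m with
  | zero =>
    exact ⟨vacuum hω v, Submodule.mem_iSup_of_mem 0 ⟨v, rfl⟩, fun x => by simp [vacuum_apply]⟩
  | succ m ih =>
    obtain ⟨f, hf, hfx⟩ := ih
    refine ⟨∑ ν, (t ν : ℂ) • position ν f, Submodule.sum_mem _ fun ν _ =>
      Submodule.smul_mem _ _ (position_mem_iSup_level hω ν hf), fun x => ?_⟩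
    have h : ((inner ℝ t x : ℝ) : ℂ) = ∑ ν, (t ν : ℂ) * x ν := by
      simp [PiLp.inner_apply, mul_comm]
    rw [pow_succ', mul_smul, ← hfx, h, Finset.sum_smul]
    simp [position_apply, mul_smul, sum_apply]

/-- By completing the square, half of the Gaussian exponent absorbs the linear growth of |⟨t, x⟩|;
the other half remains for integrability. -/
theorem exp_mul_gaussian_le (hω : 0 < ω) (t x : EuclideanSpace ℝ (Fin d)) :
    Real.exp |inner ℝ t x| * Real.exp (-(ω / 2) * ‖x‖ ^ 2) ≤
      Real.exp (‖t‖ ^ 2 / ω) * Real.exp (-(ω / 4) * ‖x‖ ^ 2) := by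
  rw [← Real.exp_add, ← Real.exp_add, Real.exp_le_exp]
  have h1 : |inner ℝ t x| ≤ ‖t‖ * ‖x‖ := abs_real_inner_le_norm t x
  have h2 : ‖t‖ ^ 2 / ω - ‖t‖ * ‖x‖ + ω / 4 * ‖x‖ ^ 2 = (‖t‖ - ω / 2 * ‖x‖) ^ 2 / ω := by
    field_simp; ring
  have h3 : 0 ≤ (‖t‖ - ω / 2 * ‖x‖) ^ 2 / ω := by positivity
  linarith

/-- The exponential is expanded in powers of i⟨t, x⟩ and integrated termwise, dominated by exp|⟨t,
x⟩| times the Gaussian times ‖ψ‖. Each term vanishes because ⟨t, x⟩^m times the Gaussian and a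
constant vector lies in the span of the levels. -/
theorem integral_exp_smul_gaussian_eq_zero {ψ : L2 d}
    (h : ∀ f ∈ ⨆ k, level hω k, inner ℂ (schwartzToL2 d f) ψ = 0)
    (t : EuclideanSpace ℝ (Fin d)) :
    ∫ x, Complex.exp ((inner ℝ t x : ℝ) * Complex.I) •
      Real.exp (-(ω / 2) * ‖x‖ ^ 2) • ψ x = 0 := by
  set B : EuclideanSpace ℝ (Fin d) → ℝ := fun x =>
    Real.exp |inner ℝ t x| * (Real.exp (-(ω / 2) * ‖x‖ ^ 2) * ‖ψ x‖) with hB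
  have hψ : AEStronglyMeasurable ψ volume := Lp.aestronglyMeasurable ψ
  have hcont : Continuous fun x : EuclideanSpace ℝ (Fin d) => Real.exp (-(ω / 2) * ‖x‖ ^ 2) := by
    fun_prop
  have hBi : Integrable B := by
    have h1 : Integrable fun x => gaussian (EuclideanSpace ℝ (Fin d)) (ω / 4) (by positivity) x *
        ‖ψ x‖ :=
      ((gaussian (EuclideanSpace ℝ (Fin d)) (ω / 4) (by positivity)).memLp 2).integrable_mul
        (Lp.memLp ψ).norm
    refine (h1.const_mul (Real.exp (‖t‖ ^ 2 / ω))).mono' ?_ (Filter.Eventually.of_forall fun x => ?_)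
    · have : Continuous fun x : EuclideanSpace ℝ (Fin d) => Real.exp |inner ℝ t x| := by fun_prop
      exact this.aestronglyMeasurable.mul (hcont.aestronglyMeasurable.mul hψ.norm)
    · rw [Real.norm_of_nonneg (by positivity), hB]
      simp only [← mul_assoc]
      exact mul_le_mul_of_nonneg_right (exp_mul_gaussian_le hω t x) (norm_nonneg _)
  set F : ℕ → EuclideanSpace ℝ (Fin d) → FermionSpace d := fun m x =>
    ((((inner ℝ t x : ℝ) : ℂ) * Complex.I) ^ m / m.factorial) •
      Real.exp (-(ω / 2) * ‖x‖ ^ 2) • ψ x with hF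
  set b : ℕ → EuclideanSpace ℝ (Fin d) → ℝ := fun m x =>
    |inner ℝ t x| ^ m / m.factorial * (Real.exp (-(ω / 2) * ‖x‖ ^ 2) * ‖ψ x‖) with hb
  have hsum : ∀ x, HasSum (fun m => b m x) (B x) := fun x => by
    have := NormedSpace.expSeries_div_hasSum_exp (𝔸 := ℝ) |inner ℝ t x|
    rw [← Real.exp_eq_exp_ℝ] at this
    exact this.mul_right _
  have hFb : ∀ m x, ‖F m x‖ ≤ b m x := fun m x => by
    simp [hF, hb, norm_smul]
  have hFm : ∀ m, AEStronglyMeasurable (F m) volume := fun m => by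
    have : Continuous fun x : EuclideanSpace ℝ (Fin d) =>
      ((((inner ℝ t x : ℝ) : ℂ) * Complex.I) ^ m / m.factorial) := by fun_prop
    exact this.aestronglyMeasurable.smul (hcont.aestronglyMeasurable.smul hψ)
  have hFi : ∀ m, Integrable (F m) := fun m => hBi.mono' (hFm m) (Filter.Eventually.of_forall
    fun x => (hFb m x).trans (le_hasSum (hsum x) m fun i _ => by positivity))
  have hF0 : ∀ m, ∫ x, F m x = 0 := fun m => by
    refine ext_inner_left ℂ fun v => ?_
    rw [inner_zero_right, ← integral_inner (hFi m)]
    obtain ⟨f, hf, hfx⟩ := exists_level_pow hω t v m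
    have h1 := h f hf
    rw [L2.inner_def] at h1
    -- The level vector carries only the real factor ⟨t, x⟩^m, which conjugation in the first slot
    -- leaves alone; the constant i^m/m! is taken outside.
    rw [← mul_zero (Complex.I ^ m / m.factorial), ← h1, ← integral_const_mul]
    refine integral_congr_ae ?_
    filter_upwards [f.coeFn_toLp 2 volume] with x hx
    have hx' : schwartzToL2 d f x = f x := hx
    rw [hx', hfx]
    simp only [hF, inner_smul_left, inner_smul_right, inner_smul_left_eq_smul,
      inner_smul_right_eq_smul, map_pow, Complex.conj_ofReal]
    simp only [Complex.real_smul]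
    ring
  have key := hasSum_integral_of_dominated_convergence b hFm
    (fun m => Filter.Eventually.of_forall (hFb m))
    (Filter.Eventually.of_forall fun x => (hsum x).summable)
    (by simpa only [fun x => (hsum x).tsum_eq] using hBi)
    (f := fun x => Complex.exp ((inner ℝ t x : ℝ) * Complex.I) •
      Real.exp (-(ω / 2) * ‖x‖ ^ 2) • ψ x)
    (Filter.Eventually.of_forall fun x => by
      have := NormedSpace.expSeries_div_hasSum_exp (𝔸 := ℂ) (((inner ℝ t x : ℝ) : ℂ) * Complex.I)
      rw [← Complex.exp_eq_exp_ℂ] at this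
      exact this.smul_const _)
  simp only [hF0] at key
  exact key.unique hasSum_zero

/-- The product of ψ with the ground state Gaussian is integrable with vanishing Fourier transform,
and the Gaussian has no zeros. -/
theorem eq_zero_of_orthogonal_level {ψ : L2 d}
    (h : ∀ f ∈ ⨆ k, level hω k, inner ℂ (schwartzToL2 d f) ψ = 0) : ψ = 0 := by
  have hi : Integrable fun x => Real.exp (-(ω / 2) * ‖x‖ ^ 2) • ψ x :=
    memLp_one_iff_integrable.1 ((Lp.memLp ψ).smul
      ((gaussian (EuclideanSpace ℝ (Fin d)) (ω / 2) (by positivity)).memLp 2))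
  have h1 := ae_eq_zero_of_fourier_eq_zero hi (integral_exp_smul_gaussian_eq_zero hω h)
  rw [Lp.eq_zero_iff_ae_eq_zero]
  filter_upwards [h1] with x hx
  exact (smul_eq_zero.1 hx).resolve_left (Real.exp_pos _).ne'

theorem topologicalClosure_level :
    ((⨆ k, level hω k).map (schwartzToL2 d)).topologicalClosure = ⊤ := by
  rw [Submodule.topologicalClosure_eq_top_iff, Submodule.eq_bot_iff]
  intro ψ hψ
  exact eq_zero_of_orthogonal_level hω fun f hf =>
    (Submodule.mem_orthogonal _ _).1 hψ _ (Submodule.mem_map_of_mem hf)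

open Filter Topology

theorem tendsto_regularizer_of_mem_level {k : ℕ} {f : Schwartz d} (hf : f ∈ level hω k) :
    Tendsto (fun n => schwartzToL2 d (regularizer hω n (schwartzToL2 d f))) atTop
      (𝓝 (schwartzToL2 d f)) := by
  have h : ∀ᶠ n : ℕ in atTop, ((1 - k / n : ℝ) : ℂ) • schwartzToL2 d f =
      schwartzToL2 d (regularizer hω n (schwartzToL2 d f)) := by
    filter_upwards [eventually_gt_atTop k] with n hn
    rw [regularizer_apply, Finset.sum_eq_single_of_mem k (Finset.mem_range.2 hn)
      (fun j _ hj => by rw [levelProj_of_ne hω hj.symm hf, smul_zero]), levelProj_self hω hf,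
      map_smul]
  refine Tendsto.congr' h ?_
  have h1 : Tendsto (fun n : ℕ => ((1 - k / n : ℝ) : ℂ)) atTop (𝓝 ((1 - 0 : ℝ) : ℂ)) :=
    (Complex.continuous_ofReal.tendsto _).comp
      (tendsto_const_nhds.sub (tendsto_const_div_atTop_nhds_zero_nat _))
  simpa using h1.smul_const (schwartzToL2 d f)

/-- Convergence is clear on each level since 1 - k/n → 1, hence on their dense span; the uniform
norm bound 1 extends it to all of L². -/
theorem tendsto_regularizer (ψ : L2 d) :
    Tendsto (fun n => schwartzToL2 d (regularizer hω n ψ)) atTop (𝓝 ψ) := by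
  have hlin : ∀ f ∈ ⨆ k, level (d := d) hω k, Tendsto (fun n => schwartzToL2 d
      (regularizer hω n (schwartzToL2 d f))) atTop (𝓝 (schwartzToL2 d f)) := fun f hf => by
    induction hf using Submodule.iSup_induction' with
    | mem k f hf => exact tendsto_regularizer_of_mem_level hω hf
    | zero => simp
    | add f g _ _ h1 h2 => simpa using h1.add h2
  rw [Metric.tendsto_atTop]
  intro ε hε
  have hψ : ψ ∈ closure (((⨆ k, level hω k).map (schwartzToL2 d) : Submodule ℂ (L2 d)) :
      Set (L2 d)) := by
    rw [← Submodule.topologicalClosure_coe, topologicalClosure_level]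
    trivial
  obtain ⟨_, ⟨f, hf, rfl⟩, hd⟩ := Metric.mem_closure_iff.1 hψ (ε / 3) (by positivity)
  obtain ⟨N, hN⟩ := Metric.tendsto_atTop.1 (hlin f hf) (ε / 3) (by positivity)
  refine ⟨N, fun n hn => ?_⟩
  have h1 := norm_regularizer_le hω n (ψ - schwartzToL2 d f)
  rw [map_sub, map_sub, ← dist_eq_norm, ← dist_eq_norm] at h1
  have h2 := hN n hn
  calc _ ≤ _ := dist_triangle4 _ (schwartzToL2 d (regularizer hω n (schwartzToL2 d f)))
        (schwartzToL2 d f) _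
    _ < ε := by rw [dist_comm _ ψ]; linarith

/-- The limit m → ∞ of `norm_regularizer_sub_regularizer_le`. This rate of convergence is what makes
the inclusions of domains compact. -/
theorem norm_sub_regularizer_le {n : ℕ} (hn : 0 < n) (φ : Schwartz d) :
    ‖schwartzToL2 d φ - schwartzToL2 d (regularizer hω n (schwartzToL2 d φ))‖ ^ 2 ≤
    1 / (2 * ω * n) * ∑ μ, ‖schwartzToL2 d (bosonAnnihilation ω μ φ)‖ ^ 2 := by
  have h := (((tendsto_regularizer hω (schwartzToL2 d φ)).sub_const
    (schwartzToL2 d (regularizer hω n (schwartzToL2 d φ)))).norm).pow 2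
  refine le_of_tendsto h ?_
  filter_upwards [eventually_ge_atTop n] with m hm
  exact norm_regularizer_sub_regularizer_le hω hn hm φ

end HarmonicOscillator

/-! ### Mollifier argument: weak and strong extensions, adjoints and sums of closures. -/

namespace HarmonicOscillator

open Filter Topology

variable {d : ℕ} {ω : ℝ} (hω : 0 < ω)

/-! ### Operators almost commuting with the regularizers -/

/-- The commutators of `L` with the regularizing operators tend to zero in norm. -/
def AlmostCommutes (L : Schwartz d →L[ℂ] Schwartz d) : Prop :=
  ∃ C : ℝ, ∀ (n : ℕ) (φ : Schwartz d),
    ‖schwartzToL2 d (regularizer hω n (schwartzToL2 d (L φ))) -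
      schwartzToL2 d (L (regularizer hω n (schwartzToL2 d φ)))‖ ≤ C / √n * ‖schwartzToL2 d φ‖

theorem schwartzToL2_fiberwise (c : FermionSpace d →L[ℂ] FermionSpace d) (φ : Schwartz d) :
    schwartzToL2 d (fiberwise c φ) = c.compLpL 2 volume (schwartzToL2 d φ) := by
  refine Lp.ext ?_
  filter_upwards [(fiberwise c φ).coeFn_toLp 2 volume, φ.coeFn_toLp 2 volume,
    c.coeFn_compLpL (schwartzToL2 d φ)] with x h1 h2 h3
  exact h1.trans ((fiberwise_apply c φ x).trans (by rw [h3]; exact congrArg c h2.symm))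

namespace AlmostCommutes

variable {hω} {L K : Schwartz d →L[ℂ] Schwartz d}

theorem add (hL : AlmostCommutes hω L) (hK : AlmostCommutes hω K) :
    AlmostCommutes hω (L + K) := by
  obtain ⟨C, hC⟩ := hL
  obtain ⟨C', hC'⟩ := hK
  refine ⟨C + C', fun n φ => ?_⟩
  simp only [add_apply, map_add]
  rw [add_sub_add_comm, add_div, add_mul]
  exact (norm_add_le _ _).trans (add_le_add (hC n φ) (hC' n φ))

theorem smul (hL : AlmostCommutes hω L) (z : ℂ) : AlmostCommutes hω (z • L) := by
  obtain ⟨C, hC⟩ := hL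
  refine ⟨‖z‖ * C, fun n φ => ?_⟩
  simp only [smul_apply, map_smul]
  rw [← smul_sub, norm_smul, mul_div_assoc, mul_assoc]
  exact mul_le_mul_of_nonneg_left (hC n φ) (norm_nonneg z)

theorem sub (hL : AlmostCommutes hω L) (hK : AlmostCommutes hω K) :
    AlmostCommutes hω (L - K) := by
  rw [sub_eq_add_neg, ← neg_one_smul ℂ K]
  exact hL.add (hK.smul _)

theorem zero : AlmostCommutes hω (0 : Schwartz d →L[ℂ] Schwartz d) := ⟨0, fun n φ => by simp⟩

theorem sum {ι : Type*} (s : Finset ι) {L : ι → Schwartz d →L[ℂ] Schwartz d}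
    (h : ∀ i, AlmostCommutes hω (L i)) : AlmostCommutes hω (∑ i ∈ s, L i) :=
  Finset.sum_induction _ _ (fun _ _ => add) zero fun i _ => h i

theorem mul_fiberwise (hL : AlmostCommutes hω L) (c : FermionSpace d →L[ℂ] FermionSpace d) :
    AlmostCommutes hω (L * fiberwise c) := by
  obtain ⟨C, hC⟩ := hL
  refine ⟨|C| * ‖c.compLpL 2 (volume : Measure (EuclideanSpace ℝ (Fin d)))‖, fun n φ => ?_⟩
  have h := hC n (fiberwise c φ)
  rw [regularizer_fiberwise] at h
  refine h.trans ?_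
  have h2 : ‖schwartzToL2 d (fiberwise c φ)‖ ≤
      ‖c.compLpL 2 (volume : Measure (EuclideanSpace ℝ (Fin d)))‖ * ‖schwartzToL2 d φ‖ := by
    rw [schwartzToL2_fiberwise]
    exact ContinuousLinearMap.le_opNorm _ _
  calc C / √n * ‖schwartzToL2 d (fiberwise c φ)‖
      ≤ |C| / √n * (‖c.compLpL 2 (volume : Measure (EuclideanSpace ℝ (Fin d)))‖ *
        ‖schwartzToL2 d φ‖) := by
        gcongr
        exact le_abs_self C
    _ = _ := by ring

/-- As the regularizers are symmetric, their commutators with L' are minus the adjoints of those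
with L. Pairing g = [R_n, L']φ with itself and moving the commutator onto g gives the bound. -/
theorem adjoint {L' : Schwartz d →L[ℂ] Schwartz d} (hL : AlmostCommutes hω L)
    (h : FormallyAdjoint L L') : AlmostCommutes hω L' := by
  obtain ⟨C, hC⟩ := hL
  refine ⟨|C|, fun n φ => ?_⟩
  set R := fun ψ => regularizer hω n (schwartzToL2 d ψ) with hR
  have hRs : ∀ f g, inner ℂ (schwartzToL2 d (R f)) (schwartzToL2 d g) =
      inner ℂ (schwartzToL2 d f) (schwartzToL2 d (R g)) := fun f g => inner_regularizer hω n _ _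
  set g := R (L' φ) - L' (R φ) with hg
  have h1 : inner ℂ (schwartzToL2 d g) (schwartzToL2 d g) =
      inner ℂ (schwartzToL2 d (L (R g)) - schwartzToL2 d (R (L g))) (schwartzToL2 d φ) := by
    have hv : ∀ v, inner ℂ v (schwartzToL2 d g) = inner ℂ v (schwartzToL2 d (R (L' φ))) -
        inner ℂ v (schwartzToL2 d (L' (R φ))) := fun v => by rw [hg, map_sub, inner_sub_right]
    rw [hv, inner_sub_left, h, hRs, hRs, ← h]
  have h2 : ‖schwartzToL2 d g‖ * ‖schwartzToL2 d g‖ ≤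
      |C| / √n * ‖schwartzToL2 d φ‖ * ‖schwartzToL2 d g‖ := by
    rw [← inner_self_eq_norm_mul_norm (𝕜 := ℂ), h1]
    refine (RCLike.re_le_norm _).trans ((norm_inner_le_norm _ _).trans ?_)
    rw [norm_sub_rev]
    refine (mul_le_mul_of_nonneg_right (hC n g) (norm_nonneg _)).trans ?_
    rw [mul_right_comm]
    gcongr
    exact le_abs_self C
  rw [← map_sub]
  change ‖schwartzToL2 d g‖ ≤ _
  rcases (norm_nonneg (schwartzToL2 d g)).eq_or_lt with h3 | h3
  · rw [← h3]
    positivity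
  · exact le_of_mul_le_mul_right h2 h3

theorem bosonAnnihilation (μ : Fin d) : AlmostCommutes hω (bosonAnnihilation ω μ) :=
  ⟨√(2 * ω), fun n φ => norm_regularizer_bosonAnnihilation_le hω n μ φ⟩

theorem bosonCreation (μ : Fin d) : AlmostCommutes hω (bosonCreation ω μ) :=
  (bosonAnnihilation μ).adjoint (formallyAdjoint_boson ω μ)

theorem position (μ : Fin d) : AlmostCommutes hω (position μ) := by
  have h : HarmonicOscillator.position μ = (2 * ω : ℂ)⁻¹ •
      (HarmonicOscillator.bosonAnnihilation ω μ + HarmonicOscillator.bosonCreation ω μ) := by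
    have hω' : (ω : ℂ) ≠ 0 := by exact_mod_cast hω.ne'
    rw [HarmonicOscillator.bosonAnnihilation, HarmonicOscillator.bosonCreation,
      add_add_sub_cancel, ← two_smul ℂ, smul_smul, smul_smul,
      mul_assoc, inv_mul_cancel₀ (mul_ne_zero two_ne_zero hω'), one_smul]
  rw [h]
  exact ((bosonAnnihilation μ).add (bosonCreation μ)).smul _

theorem partialDeriv (μ : Fin d) : AlmostCommutes hω (partialDeriv μ) := by
  have h : HarmonicOscillator.partialDeriv μ = (2 : ℂ)⁻¹ •
      (HarmonicOscillator.bosonAnnihilation ω μ - HarmonicOscillator.bosonCreation ω μ) := by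
    rw [HarmonicOscillator.bosonAnnihilation, HarmonicOscillator.bosonCreation]
    module
  rw [h]
  exact ((bosonAnnihilation μ).sub (bosonCreation μ)).smul _

end AlmostCommutes

/-! ### Closures of operators on Schwartz functions -/

/-- Formally adjoint operators which almost commute with the regularizers. -/
structure RegularPair (L L' : Schwartz d →L[ℂ] Schwartz d) : Prop where
  adj : FormallyAdjoint L L'
  comm : AlmostCommutes hω L

theorem RegularPair.symm {hω : 0 < ω} {L L' : Schwartz d →L[ℂ] Schwartz d}
    (h : RegularPair hω L L') : RegularPair hω L' L :=
  ⟨h.adj.symm, h.comm.adjoint h.adj⟩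

section Closure

variable {L L' : Schwartz d →L[ℂ] Schwartz d}

theorem mem_graph_ofSchwartz {p : L2 d × L2 d} :
    p ∈ (ofSchwartz L).graph ↔ ∃ f, schwartzToL2 d f = p.1 ∧ schwartzToL2 d (L f) = p.2 := by
  rw [LinearPMap.mem_graph_iff]
  constructor
  · rintro ⟨⟨_, f, rfl⟩, h1, h2⟩
    exact ⟨f, h1, (ofSchwartz_apply L f).symm.trans h2⟩
  · rintro ⟨f, h1, h2⟩
    exact ⟨⟨_, f, rfl⟩, h1, (ofSchwartz_apply L f).trans h2⟩

theorem ofSchwartz_le_iff {T : L2 d →ₗ.[ℂ] L2 d} : ofSchwartz L ≤ T ↔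
    ∀ f, (schwartzToL2 d f, schwartzToL2 d (L f)) ∈ T.graph := by
  rw [← LinearPMap.le_graph_iff]
  constructor
  · exact fun h f => h (mem_graph_ofSchwartz.2 ⟨f, rfl, rfl⟩)
  · rintro h ⟨ψ, χ⟩ hp
    obtain ⟨f, h1, h2⟩ := mem_graph_ofSchwartz.1 hp
    have := h f
    rwa [h1, h2] at this

theorem dense_domain_ofSchwartz : Dense ((ofSchwartz L).domain : Set (L2 d)) :=
  denseRange_schwartzToL2

theorem isClosable_ofSchwartz (h : FormallyAdjoint L L') : (ofSchwartz L).IsClosable := by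
  refine LinearPMap.isClosable_iff_exists_closed_extension.2
    ⟨(ofSchwartz L')†, LinearPMap.adjoint_isClosed dense_domain_ofSchwartz, ?_⟩
  refine LinearPMap.IsFormalAdjoint.le_adjoint dense_domain_ofSchwartz ?_
  rintro ⟨_, f, rfl⟩ ⟨_, g, rfl⟩
  rw [ofSchwartz_apply, ofSchwartz_apply]
  exact h.symm f g

/-- If Lψ = χ weakly, then g = L R_nψ - R_nχ is formally a commutator applied to ψ. Although L is
not defined on ψ, ‖g‖² = ⟨ψ, [R_n, L']g⟩ involves L' on Schwartz functions only, so ‖g‖ =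
O(n^{-1/2}), while R_nχ → χ. -/
theorem tendsto_apply_regularizer {hω : 0 < ω} (h : RegularPair hω L L') {ψ χ : L2 d}
    (hw : ∀ φ, inner ℂ χ (schwartzToL2 d φ) = inner ℂ ψ (schwartzToL2 d (L' φ))) :
    Tendsto (fun n => schwartzToL2 d (L (regularizer hω n ψ))) atTop (𝓝 χ) := by
  obtain ⟨C, hC⟩ := h.symm.comm
  have key : ∀ n : ℕ, ‖schwartzToL2 d (L (regularizer hω n ψ)) -
      schwartzToL2 d (regularizer hω n χ)‖ ≤ |C| / √n * ‖ψ‖ := fun n => by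
    set g := L (regularizer hω n ψ) - regularizer hω n χ with hg
    have h1 : inner ℂ (schwartzToL2 d g) (schwartzToL2 d g) =
        inner ℂ ψ (schwartzToL2 d (regularizer hω n (schwartzToL2 d (L' g))) -
          schwartzToL2 d (L' (regularizer hω n (schwartzToL2 d g)))) := by
      have hv : ∀ v, inner ℂ (schwartzToL2 d g) v =
          inner ℂ (schwartzToL2 d (L (regularizer hω n ψ))) v -
            inner ℂ (schwartzToL2 d (regularizer hω n χ)) v := fun v => by
        rw [hg, map_sub, inner_sub_left]
      rw [hv, h.adj, inner_regularizer, inner_regularizer, hw, inner_sub_right]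
    have h2 : ‖schwartzToL2 d g‖ * ‖schwartzToL2 d g‖ ≤
        |C| / √n * ‖ψ‖ * ‖schwartzToL2 d g‖ := by
      rw [← inner_self_eq_norm_mul_norm (𝕜 := ℂ), h1]
      refine (RCLike.re_le_norm _).trans ((norm_inner_le_norm _ _).trans ?_)
      refine (mul_le_mul_of_nonneg_left (hC n g) (norm_nonneg _)).trans ?_
      rw [← mul_assoc, mul_comm ‖ψ‖]
      gcongr
      exact le_abs_self C
    rw [← map_sub]
    rcases (norm_nonneg (schwartzToL2 d g)).eq_or_lt with h3 | h3
    · rw [← h3]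
      positivity
    · exact le_of_mul_le_mul_right h2 h3
  have h0 : Tendsto (fun n : ℕ => |C| / √n * ‖ψ‖) atTop (𝓝 0) := by
    have : Tendsto (fun n : ℕ => √(n : ℝ)) atTop atTop :=
      Real.tendsto_sqrt_atTop.comp tendsto_natCast_atTop_atTop
    simpa using (this.const_div_atTop |C|).mul_const ‖ψ‖
  have h1 := (squeeze_zero_norm key h0).add (tendsto_regularizer hω χ)
  simpa using h1

theorem mem_graph_closure_of_tendsto (h : FormallyAdjoint L L') {f : ℕ → Schwartz d} {ψ χ : L2 d}
    (h1 : Tendsto (fun n => schwartzToL2 d (f n)) atTop (𝓝 ψ))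
    (h2 : Tendsto (fun n => schwartzToL2 d (L (f n))) atTop (𝓝 χ)) :
    (ψ, χ) ∈ (ofSchwartz L).closure.graph := by
  rw [← (isClosable_ofSchwartz h).graph_closure_eq_closure_graph, ← SetLike.mem_coe,
    Submodule.topologicalClosure_coe]
  exact mem_closure_of_tendsto (h1.prodMk_nhds h2)
    (Eventually.of_forall fun n => mem_graph_ofSchwartz.2 ⟨f n, rfl, rfl⟩)

theorem inner_of_mem_graph_closure (h : FormallyAdjoint L L') {p : L2 d × L2 d}
    (hp : p ∈ (ofSchwartz L).closure.graph) (φ : Schwartz d) :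
    inner ℂ p.2 (schwartzToL2 d φ) = inner ℂ p.1 (schwartzToL2 d (L' φ)) := by
  rw [← (isClosable_ofSchwartz h).graph_closure_eq_closure_graph, ← SetLike.mem_coe,
    Submodule.topologicalClosure_coe] at hp
  have hcl : IsClosed {p : L2 d × L2 d |
      inner ℂ p.2 (schwartzToL2 d φ) = inner ℂ p.1 (schwartzToL2 d (L' φ))} :=
    isClosed_eq (by fun_prop) (by fun_prop)
  refine closure_minimal ?_ hcl hp
  rintro ⟨ψ, χ⟩ hq
  obtain ⟨f, rfl, rfl⟩ := mem_graph_ofSchwartz.1 hq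
  exact h f φ

variable {hω}

/-- Weak and strong extensions of a regular operator agree. -/
theorem mem_graph_closure_iff (h : RegularPair hω L L') {p : L2 d × L2 d} :
    p ∈ (ofSchwartz L).closure.graph ↔
      ∀ φ, inner ℂ p.2 (schwartzToL2 d φ) = inner ℂ p.1 (schwartzToL2 d (L' φ)) :=
  ⟨inner_of_mem_graph_closure h.adj, fun hw => mem_graph_closure_of_tendsto h.adj
    (tendsto_regularizer hω p.1) (tendsto_apply_regularizer h hw)⟩

theorem tendsto_closure (h : RegularPair hω L L') (ψ : (ofSchwartz L).closure.domain) :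
    Tendsto (fun n => schwartzToL2 d (L (regularizer hω n (ψ : L2 d)))) atTop
      (𝓝 ((ofSchwartz L).closure ψ)) :=
  tendsto_apply_regularizer h (inner_of_mem_graph_closure h.adj ((ofSchwartz L).closure.mem_graph ψ))

theorem dense_domain_closure : Dense ((ofSchwartz L).closure.domain : Set (L2 d)) :=
  dense_domain_ofSchwartz.mono (LinearPMap.le_closure _).1

/-- Membership in the graph of the adjoint says that L'ψ = χ holds weakly, and for a regular pair
this is membership in the closure. -/
theorem adjoint_closure (h : RegularPair hω L L') :
    (ofSchwartz L).closure† = (ofSchwartz L').closure := by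
  refine LinearPMap.eq_of_eq_graph ?_
  rw [LinearPMap.adjoint_graph_eq_graph_adjoint dense_domain_closure]
  ext ⟨ψ, χ⟩
  rw [Submodule.mem_adjoint_iff, mem_graph_closure_iff h.symm]
  constructor
  · intro hp φ
    have h1 := hp (schwartzToL2 d φ) (schwartzToL2 d (L φ)) (LinearPMap.le_graph_of_le
      (LinearPMap.le_closure _) (mem_graph_ofSchwartz.2 ⟨φ, rfl, rfl⟩))
    rw [sub_eq_zero] at h1
    rw [← inner_conj_symm, ← h1, inner_conj_symm]
  -- The adjoint relation holds for each R_nψ, which is Schwartz, and passes to the limit because L'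
  -- R_nψ → χ.
  · intro hw a b hab
    have h1 := tendsto_apply_regularizer h.symm (ψ := ψ) (χ := χ) hw
    have h2 := tendsto_regularizer hω ψ
    have h3 : ∀ n, inner ℂ b (schwartzToL2 d (regularizer hω n ψ)) =
        inner ℂ a (schwartzToL2 d (L' (regularizer hω n ψ))) := fun n =>
      inner_of_mem_graph_closure h.adj hab _
    have h4 : Tendsto (fun n => inner ℂ b (schwartzToL2 d (regularizer hω n ψ))) atTop
        (𝓝 (inner ℂ b ψ)) := tendsto_const_nhds.inner h2
    simp only [h3] at h4
    exact sub_eq_zero.2 (tendsto_nhds_unique h4 (tendsto_const_nhds.inner h1))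

theorem isSelfAdjoint_closure (h : RegularPair hω L L) : IsSelfAdjoint (ofSchwartz L).closure :=
  adjoint_closure h

/-- `T` lies between the restriction of `L` to the Schwartz functions and its closure. -/
def Realizes (T : L2 d →ₗ.[ℂ] L2 d) (L : Schwartz d →L[ℂ] Schwartz d) : Prop :=
  ofSchwartz L ≤ T ∧ T ≤ (ofSchwartz L).closure

theorem Realizes.of_closure (L : Schwartz d →L[ℂ] Schwartz d) :
    Realizes (ofSchwartz L).closure L :=
  ⟨LinearPMap.le_closure _, le_rfl⟩

theorem Realizes.closure_eq {T : L2 d →ₗ.[ℂ] L2 d} (h : Realizes T L)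
    (hL : FormallyAdjoint L L') : T.closure = (ofSchwartz L).closure := by
  have hc := isClosable_ofSchwartz hL
  refine le_antisymm ?_ ((hc.closureIsClosable.leIsClosable h.2).closure_mono h.1)
  have h1 := hc.closureIsClosable.closure_mono h.2
  have h2 : (ofSchwartz L).closure.closure = (ofSchwartz L).closure := by
    refine LinearPMap.eq_of_eq_graph ?_
    rw [← hc.closureIsClosable.graph_closure_eq_closure_graph]
    exact (hc.closure_isClosed).submodule_topologicalClosure_eq
  rwa [h2] at h1

/-- Only the weak relation has to be checked on the domain of T. For sums on an intersection of
domains this is immediate, with no simultaneous approximation to construct. -/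
theorem Realizes.of_mem_graph {T : L2 d →ₗ.[ℂ] L2 d} (h : RegularPair hω L L')
    (h1 : ∀ f, (schwartzToL2 d f, schwartzToL2 d (L f)) ∈ T.graph)
    (h2 : ∀ ψ : T.domain, ∀ φ, inner ℂ (T ψ) (schwartzToL2 d φ) =
      inner ℂ (ψ : L2 d) (schwartzToL2 d (L' φ))) : Realizes T L := by
  refine ⟨ofSchwartz_le_iff.2 h1, LinearPMap.le_of_le_graph ?_⟩
  rintro ⟨_, _⟩ hp
  obtain ⟨ψ, rfl, rfl⟩ := (LinearPMap.mem_graph_iff _).1 hp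
  exact (mem_graph_closure_iff h).2 (h2 ψ)

theorem Realizes.inner_apply {T : L2 d →ₗ.[ℂ] L2 d} (h : Realizes T L)
    (hL : FormallyAdjoint L L') (ψ : T.domain) (φ : Schwartz d) :
    inner ℂ (T ψ) (schwartzToL2 d φ) = inner ℂ (ψ : L2 d) (schwartzToL2 d (L' φ)) :=
  inner_of_mem_graph_closure hL (LinearPMap.le_graph_of_le h.2 (T.mem_graph ψ)) φ

theorem Realizes.exists_mem {T : L2 d →ₗ.[ℂ] L2 d} (h : Realizes T L) (f : Schwartz d) :
    ∃ hf : schwartzToL2 d f ∈ T.domain, T ⟨schwartzToL2 d f, hf⟩ = schwartzToL2 d (L f) := by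
  obtain ⟨⟨_, hy⟩, rfl, h2⟩ := (LinearPMap.mem_graph_iff _).1 (ofSchwartz_le_iff.1 h.1 f)
  exact ⟨hy, h2⟩

variable {K K' : Schwartz d →L[ℂ] Schwartz d} {T U : L2 d →ₗ.[ℂ] L2 d}

theorem RegularPair.add (h : RegularPair hω L L') (k : RegularPair hω K K') :
    RegularPair hω (L + K) (L' + K') := ⟨h.adj.add k.adj, h.comm.add k.comm⟩

theorem RegularPair.sub (h : RegularPair hω L L') (k : RegularPair hω K K') :
    RegularPair hω (L - K) (L' - K') := ⟨h.adj.sub k.adj, h.comm.sub k.comm⟩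

theorem RegularPair.smul (h : RegularPair hω L L') (z : ℂ) :
    RegularPair hω (z • L) ((starRingEnd ℂ) z • L') := ⟨h.adj.smul z, h.comm.smul z⟩

theorem Realizes.add (hT : Realizes T L) (hU : Realizes U K) (h : RegularPair hω L L')
    (k : RegularPair hω K K') : Realizes (T + U) (L + K) := by
  refine Realizes.of_mem_graph (h.add k) (fun f => ?_) fun ψ φ => ?_
  · obtain ⟨h1, h2⟩ := hT.exists_mem f
    obtain ⟨h3, h4⟩ := hU.exists_mem f
    exact (LinearPMap.mem_graph_iff _).2 ⟨⟨_, h1, h3⟩, rfl, by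
      rw [LinearPMap.add_apply, h2, h4, add_apply, map_add]⟩
  · rw [LinearPMap.add_apply, inner_add_left, hT.inner_apply h.adj, hU.inner_apply k.adj,
      add_apply, map_add, inner_add_right]

theorem Realizes.sub (hT : Realizes T L) (hU : Realizes U K) (h : RegularPair hω L L')
    (k : RegularPair hω K K') : Realizes (T - U) (L - K) := by
  refine Realizes.of_mem_graph (h.sub k) (fun f => ?_) fun ψ φ => ?_
  · obtain ⟨h1, h2⟩ := hT.exists_mem f
    obtain ⟨h3, h4⟩ := hU.exists_mem f
    exact (LinearPMap.mem_graph_iff _).2 ⟨⟨_, h1, h3⟩, rfl, by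
      rw [LinearPMap.sub_apply, h2, h4, sub_apply, map_sub]⟩
  · rw [LinearPMap.sub_apply, inner_sub_left, hT.inner_apply h.adj, hU.inner_apply k.adj,
      sub_apply, map_sub, inner_sub_right]

theorem Realizes.smul (hT : Realizes T L) (h : RegularPair hω L L') (z : ℂ) :
    Realizes (z • T) (z • L) := by
  refine Realizes.of_mem_graph (h.smul z) (fun f => ?_) fun ψ φ => ?_
  · obtain ⟨h1, h2⟩ := hT.exists_mem f
    exact (LinearPMap.mem_graph_iff _).2 ⟨⟨_, h1⟩, rfl, by
      rw [LinearPMap.smul_apply, h2, smul_apply, map_smul]⟩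
  · rw [LinearPMap.smul_apply, inner_smul_left, hT.inner_apply h.adj, smul_apply, map_smul,
      inner_smul_right]

theorem domRestrict_range (h : ofSchwartz L ≤ T) :
    T.domRestrict (LinearMap.range (schwartzToL2 d)) = ofSchwartz L := by
  refine (LinearPMap.eq_of_le_of_domain_eq ⟨le_inf le_rfl h.1, fun x y hxy => ?_⟩
    (le_antisymm (le_inf le_rfl h.1) inf_le_left)).symm
  exact (h.2 (y := ⟨y, y.2.2⟩) hxy).trans
    (LinearPMap.domRestrict_apply (x := y) (y := ⟨y, y.2.2⟩) rfl).symm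

theorem hasCore_closure (L : Schwartz d →L[ℂ] Schwartz d) :
    (ofSchwartz L).closure.HasCore (LinearMap.range (schwartzToL2 d)) :=
  LinearPMap.closureHasCore _

theorem Realizes.isEssentiallySelfAdjointOn (hT : Realizes T L) (h : RegularPair hω L L) :
    UnboundedOp.IsEssentiallySelfAdjointOn T (LinearMap.range (schwartzToL2 d)) := by
  refine ⟨hT.1.1, ?_⟩
  rw [domRestrict_range hT.1]
  exact isSelfAdjoint_closure h

/-- Intertwining relations on Schwartz functions extend to the closure. -/
theorem closure_intertwine (h : RegularPair hω L L') {a b c : L2 d →L[ℂ] L2 d}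
    (habc : ∀ f, ∃ g, schwartzToL2 d g = a (schwartzToL2 d f) ∧
      schwartzToL2 d (L g) = b (schwartzToL2 d (L f)) + c (schwartzToL2 d f))
    (ψ : (ofSchwartz L).closure.domain) : ∃ hψ : a ψ ∈ (ofSchwartz L).closure.domain,
      (ofSchwartz L).closure ⟨a ψ, hψ⟩ = b ((ofSchwartz L).closure ψ) + c ψ := by
  choose g hg1 hg2 using habc
  have h1 := tendsto_regularizer hω (ψ : L2 d)
  have h2 := tendsto_closure h ψ
  have h3 : (a ψ, b ((ofSchwartz L).closure ψ) + c ψ) ∈ (ofSchwartz L).closure.graph := by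
    refine mem_graph_closure_of_tendsto h.adj (f := fun n => g (regularizer hω n (ψ : L2 d))) ?_ ?_
    · simp only [hg1]
      exact (a.continuous.tendsto _).comp h1
    · simp only [hg2]
      exact ((b.continuous.tendsto _).comp h2).add ((c.continuous.tendsto _).comp h1)
  obtain ⟨⟨_, hy⟩, rfl, h5⟩ := (LinearPMap.mem_graph_iff _).1 h3
  exact ⟨hy, h5⟩

end Closure

end HarmonicOscillator

namespace FermionSpace

variable {d : ℕ}

/-! ### Clifford relations -/

theorem annihilation_annihilation (μ ν : Fin d) :
    annihilation μ * annihilation ν + annihilation ν * annihilation μ = 0 := by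
  have h := congrArg ContinuousLinearMap.adjoint (creation_creation ν μ)
  simpa [annihilation, ContinuousLinearMap.mul_def, ContinuousLinearMap.adjoint_comp] using h

/-- The Clifford generators `b_μ + b_μ^*` of square `1`. -/
def gammaPos (μ : Fin d) : FermionSpace d →L[ℂ] FermionSpace d := annihilation μ + creation μ

/-- The Clifford generators `b_μ^* - b_μ` of square `-1`. -/
def gammaNeg (μ : Fin d) : FermionSpace d →L[ℂ] FermionSpace d := creation μ - annihilation μ

theorem creation_annihilation (μ ν : Fin d) :
    creation μ * annihilation ν = -(annihilation ν * creation μ) + if μ = ν then 1 else 0 := by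
  have h := annihilation_creation ν μ
  simp only [eq_comm (a := ν)] at h
  rw [← h]
  abel

theorem gammaPos_gammaPos (μ ν : Fin d) :
    gammaPos μ * gammaPos ν + gammaPos ν * gammaPos μ = if μ = ν then 1 + 1 else 0 := by
  have h1 := eq_neg_of_add_eq_zero_left (annihilation_annihilation μ ν)
  have h2 := eq_neg_of_add_eq_zero_left (creation_creation μ ν)
  simp only [gammaPos, mul_add, add_mul, h1, h2, creation_annihilation, eq_comm (a := ν)]
  split_ifs <;> abel

theorem gammaNeg_gammaNeg (μ ν : Fin d) :
    gammaNeg μ * gammaNeg ν + gammaNeg ν * gammaNeg μ = if μ = ν then -(1 + 1) else 0 := by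
  have h1 := eq_neg_of_add_eq_zero_left (annihilation_annihilation μ ν)
  have h2 := eq_neg_of_add_eq_zero_left (creation_creation μ ν)
  simp only [gammaNeg, mul_sub, sub_mul, h1, h2, creation_annihilation, eq_comm (a := ν)]
  split_ifs <;> abel

theorem gammaNeg_gammaPos (μ ν : Fin d) :
    gammaNeg ν * gammaPos μ = -(gammaPos μ * gammaNeg ν) := by
  have h1 := eq_neg_of_add_eq_zero_left (annihilation_annihilation μ ν)
  have h2 := eq_neg_of_add_eq_zero_left (creation_creation μ ν)
  simp only [gammaNeg, gammaPos, mul_sub, sub_mul, mul_add, add_mul, h1, h2,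
    creation_annihilation, eq_comm (a := ν)]
  abel

theorem adjoint_gammaPos (μ : Fin d) :
    ContinuousLinearMap.adjoint (gammaPos μ) = gammaPos μ := by
  simp [gammaPos, annihilation, add_comm]

theorem adjoint_gammaNeg (μ : Fin d) :
    ContinuousLinearMap.adjoint (gammaNeg μ) = -gammaNeg μ := by
  simp [gammaNeg, annihilation]

/-! ### The grading -/

theorem grading_apply (ξ : FermionSpace d) (s : Finset (Fin d)) :
    grading d ξ s = (-1) ^ s.card * ξ s := rfl

theorem grading_single (s : Finset (Fin d)) (c : ℂ) :
    grading d (EuclideanSpace.single s c) = (-1 : ℂ) ^ s.card • EuclideanSpace.single s c := by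
  ext t
  by_cases h : t = s <;> simp [grading_apply, h]

theorem grading_mul_grading : grading d * grading d = 1 := by
  ext ξ s
  simp [grading_apply, ← mul_assoc, ← mul_pow]

theorem adjoint_grading : ContinuousLinearMap.adjoint (grading d) = grading d := by
  symm
  rw [ContinuousLinearMap.eq_adjoint_iff]
  intro ξ η
  simp only [PiLp.inner_apply, grading_apply]
  refine Finset.sum_congr rfl fun s _ => ?_
  simp
  ring

theorem creation_single (μ : Fin d) (s : Finset (Fin d)) :
    creation μ (EuclideanSpace.single s 1) =
      ofExterior d (ExteriorAlgebra.ι ℂ (Pi.single μ (1 : ℂ)) * wedgeBasis d s) := by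
  simp [creation, ← ofExterior_basis]

/-- On a basis vector, wedging with e_μ gives zero or adds one index, which flips the parity. -/
theorem grading_mul_creation (μ : Fin d) :
    grading d * creation μ = -(creation μ * grading d) := by
  refine ContinuousLinearMap.coe_injective
    ((EuclideanSpace.basisFun (Finset (Fin d)) ℂ).toBasis.ext fun s => ?_)
  simp only [OrthonormalBasis.coe_toBasis, EuclideanSpace.basisFun_apply,
    ContinuousLinearMap.coe_coe, mul_apply_eq_comp, neg_apply, grading_single, map_smul,
    creation_single]
  by_cases h : μ ∈ s
  · simp [ι_mul_basis_of_mem h]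
  · obtain ⟨u, hu⟩ := ι_mul_basis_of_notMem h
    rw [hu]
    have h2 : ofExterior d (u • wedgeBasis d (insert μ s)) =
        ((u : ℤ) : ℂ) • EuclideanSpace.single (insert μ s) (1 : ℂ) := by
      rcases Int.units_eq_one_or u with rfl | rfl <;> simp [ofExterior_basis]
    rw [h2, map_smul, grading_single, Finset.card_insert_of_notMem h, pow_succ]
    module

theorem grading_mul_annihilation (μ : Fin d) :
    grading d * annihilation μ = -(annihilation μ * grading d) := by
  have h := congrArg ContinuousLinearMap.adjoint (grading_mul_creation μ)
  simp only [ContinuousLinearMap.mul_def, ContinuousLinearMap.adjoint_comp, map_neg,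
    adjoint_grading] at h
  exact (neg_eq_iff_eq_neg.2 h).symm

theorem grading_mul_gammaPos (μ : Fin d) :
    grading d * gammaPos μ = -(gammaPos μ * grading d) := by
  rw [gammaPos, mul_add, add_mul, grading_mul_creation, grading_mul_annihilation, neg_add]

theorem grading_mul_gammaNeg (μ : Fin d) :
    grading d * gammaNeg μ = -(gammaNeg μ * grading d) := by
  rw [gammaNeg, mul_sub, sub_mul, grading_mul_creation, grading_mul_annihilation]
  abel

end FermionSpace

namespace HarmonicOscillator

open FermionSpace

variable {d : ℕ}

/-! ### The Clifford position and momentum operators -/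

/-- Separates scalar factors from fibre factors, so that anticommutators of X and P reduce to
Clifford relations and commutators of x and ∂. -/
theorem sum_mul_sum_add_sum_mul_sum {ι R : Type*} [Fintype ι] [Ring R] (A B c e : ι → R)
    (hc : ∀ μ ν, Commute (c μ) (B ν)) (he : ∀ μ ν, Commute (e ν) (A μ)) :
    (∑ μ, A μ * c μ) * (∑ ν, B ν * e ν) + (∑ ν, B ν * e ν) * (∑ μ, A μ * c μ) =
      ∑ μ, ∑ ν, (A μ * B ν * (c μ * e ν) + B ν * A μ * (e ν * c μ)) := by
  rw [Finset.sum_mul_sum, Finset.sum_mul_sum, Finset.sum_comm (f := fun ν μ => B ν * e ν * _),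
    ← Finset.sum_add_distrib]
  refine Finset.sum_congr rfl fun μ _ => ?_
  rw [← Finset.sum_add_distrib]
  refine Finset.sum_congr rfl fun ν _ => ?_
  rw [mul_assoc (A μ), ← mul_assoc (c μ), (hc μ ν).eq, mul_assoc (B ν) (e ν),
    ← mul_assoc (e ν), (he μ ν).eq]
  simp only [mul_assoc]

/-- Clifford multiplication `∑_μ x_μ ⊗ (b_μ + b_μ^*)` by the position. -/
def cliffordPosition (d : ℕ) : Schwartz d →L[ℂ] Schwartz d :=
  ∑ μ, position μ * fiberwise (gammaPos μ)

/-- The Dirac operator `∑_μ ∂_μ ⊗ (b_μ^* - b_μ)`. -/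
def dirac (d : ℕ) : Schwartz d →L[ℂ] Schwartz d :=
  ∑ μ, partialDeriv μ * fiberwise (gammaNeg μ)

theorem schwartzD₁_eq (ω : ℝ) : schwartzD₁ d ω = (ω : ℂ) • cliffordPosition d + dirac d := by
  rw [schwartzD₁, cliffordPosition, dirac, Finset.smul_sum, ← Finset.sum_add_distrib]
  refine Finset.sum_congr rfl fun μ _ => ?_
  simp only [← ContinuousLinearMap.mul_def, bosonAnnihilation, bosonCreation, gammaPos, gammaNeg,
    fiberwise_add, fiberwise_sub, add_mul, sub_mul, mul_add, mul_sub, smul_mul_assoc]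
  module

theorem schwartzD₂_eq (ω : ℝ) : schwartzD₂ d ω = (ω : ℂ) • cliffordPosition d - dirac d := by
  rw [schwartzD₂, cliffordPosition, dirac, Finset.smul_sum, ← Finset.sum_sub_distrib]
  refine Finset.sum_congr rfl fun μ _ => ?_
  simp only [← ContinuousLinearMap.mul_def, bosonAnnihilation, bosonCreation, gammaPos, gammaNeg,
    fiberwise_add, fiberwise_sub, add_mul, sub_mul, mul_add, mul_sub, smul_mul_assoc]
  module

theorem schwartzD_eq (ω : ℝ) :
    schwartzD d ω = (ω : ℂ) • cliffordPosition d + Complex.I • dirac d := by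
  rw [schwartzD, cliffordPosition, dirac, Finset.smul_sum, Finset.smul_sum,
    ← Finset.sum_add_distrib]
  refine Finset.sum_congr rfl fun μ _ => ?_
  simp only [← ContinuousLinearMap.mul_def, gammaPos, gammaNeg,
    fiberwise_add, fiberwise_sub, mul_add, mul_sub, smul_mul_assoc]
  module

/-- The coordinates commute, so only the symmetric part of the products of Clifford generators
survives, which is diagonal; twice the square is computed and then halved. -/
theorem cliffordPosition_mul_self :
    cliffordPosition d * cliffordPosition d = ∑ μ : Fin d, position μ * position μ := by
  have h := sum_mul_sum_add_sum_mul_sum (fun μ : Fin d => position μ) (fun μ => position μ)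
    (fun μ => fiberwise (gammaPos μ)) (fun μ => fiberwise (gammaPos μ))
    (fun μ ν => (position_commute_fiberwise ν _).symm)
    (fun μ ν => (position_commute_fiberwise μ _).symm)
  have h2 : ∀ μ ν : Fin d, position μ * position ν * (fiberwise (gammaPos μ) *
      fiberwise (gammaPos ν)) + position ν * position μ * (fiberwise (gammaPos ν) *
      fiberwise (gammaPos μ)) = if μ = ν then (2 : ℂ) • (position μ * position ν) else 0 := by
    intro μ ν
    rw [(position_commute ν μ).eq, ← mul_add, ← fiberwise_mul, ← fiberwise_mul, ← fiberwise_add,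
      gammaPos_gammaPos]
    split_ifs
    · rw [fiberwise_add, fiberwise_one, mul_add, mul_one, two_smul]
    · rw [fiberwise_zero, mul_zero]
  simp only [h2, Finset.sum_ite_eq, Finset.mem_univ, if_true, ← Finset.smul_sum] at h
  rw [← two_smul ℂ] at h
  exact smul_right_injective _ (two_ne_zero (α := ℂ)) h

theorem dirac_mul_self :
    dirac d * dirac d = -∑ μ : Fin d, partialDeriv μ * partialDeriv μ := by
  have h := sum_mul_sum_add_sum_mul_sum (fun μ : Fin d => partialDeriv μ) (fun μ => partialDeriv μ)
    (fun μ => fiberwise (gammaNeg μ)) (fun μ => fiberwise (gammaNeg μ))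
    (fun μ ν => (partialDeriv_commute_fiberwise ν _).symm)
    (fun μ ν => (partialDeriv_commute_fiberwise μ _).symm)
  have h2 : ∀ μ ν : Fin d, partialDeriv μ * partialDeriv ν * (fiberwise (gammaNeg μ) *
      fiberwise (gammaNeg ν)) + partialDeriv ν * partialDeriv μ * (fiberwise (gammaNeg ν) *
      fiberwise (gammaNeg μ)) =
        if μ = ν then (2 : ℂ) • -(partialDeriv μ * partialDeriv ν) else 0 := by
    intro μ ν
    rw [(partialDeriv_commute ν μ).eq, ← mul_add, ← fiberwise_mul, ← fiberwise_mul,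
      ← fiberwise_add, gammaNeg_gammaNeg]
    split_ifs
    · rw [fiberwise_neg, fiberwise_add, fiberwise_one, mul_neg, mul_add, mul_one, smul_neg,
        two_smul]
    · rw [fiberwise_zero, mul_zero]
  simp only [h2, Finset.sum_ite_eq, Finset.mem_univ, if_true, ← Finset.smul_sum,
    Finset.sum_neg_distrib] at h
  rw [← two_smul ℂ] at h
  exact smul_right_injective _ (two_ne_zero (α := ℂ)) h

/-- The bounded operator `-∑_μ (b_μ + b_μ^*)(b_μ^* - b_μ)` on the fibres. -/
def antiCommutator (d : ℕ) : FermionSpace d →L[ℂ] FermionSpace d :=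
  -∑ μ, gammaPos μ * gammaNeg μ

theorem fiberwise_sum {ι : Type*} (s : Finset ι) (c : ι → FermionSpace d →L[ℂ] FermionSpace d) :
    fiberwise (∑ i ∈ s, c i) = ∑ i ∈ s, fiberwise (c i) := by
  refine ContinuousLinearMap.ext fun f => SchwartzMap.ext fun x => ?_
  rw [fiberwise_apply, sum_apply, sum_apply, sum_apply]
  simp [fiberwise_apply]

/-- The two families of Clifford generators anticommute with each other, so only the commutators
[∂_ν, x_μ] = δ remain. -/
theorem cliffordPosition_dirac :
    cliffordPosition d * dirac d + dirac d * cliffordPosition d =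
      fiberwise (antiCommutator d) := by
  have h := sum_mul_sum_add_sum_mul_sum (fun μ : Fin d => position μ) (fun μ => partialDeriv μ)
    (fun μ => fiberwise (gammaPos μ)) (fun μ => fiberwise (gammaNeg μ))
    (fun μ ν => (partialDeriv_commute_fiberwise ν _).symm)
    (fun μ ν => (position_commute_fiberwise μ _).symm)
  have h2 : ∀ μ ν : Fin d, position μ * partialDeriv ν * (fiberwise (gammaPos μ) *
      fiberwise (gammaNeg ν)) + partialDeriv ν * position μ * (fiberwise (gammaNeg ν) *
      fiberwise (gammaPos μ)) =
        if μ = ν then -fiberwise (gammaPos μ * gammaNeg ν) else 0 := by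
    intro μ ν
    rw [partialDeriv_mul_position, ← fiberwise_mul, ← fiberwise_mul, gammaNeg_gammaPos,
      fiberwise_neg]
    by_cases h : μ = ν
    · simp only [h, if_true, add_mul, mul_neg, one_mul]
      abel
    · simp [h, Ne.symm h]
  simp only [h2, Finset.sum_ite_eq, Finset.mem_univ, if_true, Finset.sum_neg_distrib] at h
  rw [antiCommutator, fiberwise_neg, fiberwise_sum]
  exact h

variable {ω : ℝ} {hω : 0 < ω}

theorem regularPair_cliffordPosition :
    RegularPair hω (cliffordPosition d) (cliffordPosition d) := by
  refine ⟨FormallyAdjoint.sum _ fun μ => ?_,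
    AlmostCommutes.sum _ fun μ => (AlmostCommutes.position μ).mul_fiberwise _⟩
  have h := (FormallyAdjoint.position μ).mul (FormallyAdjoint.fiberwise (gammaPos μ))
  rwa [adjoint_gammaPos, ← (position_commute_fiberwise μ _).eq] at h

/-- Both ∂_μ and b_μ^* - b_μ are skew and they commute, so their product is symmetric. -/
theorem regularPair_dirac : RegularPair hω (dirac d) (dirac d) := by
  refine ⟨FormallyAdjoint.sum _ fun μ => ?_,
    AlmostCommutes.sum _ fun μ => (AlmostCommutes.partialDeriv μ).mul_fiberwise _⟩
  have h := (FormallyAdjoint.partialDeriv μ).mul (FormallyAdjoint.fiberwise (gammaNeg μ))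
  rwa [adjoint_gammaNeg, fiberwise_neg, neg_mul_neg, ← (partialDeriv_commute_fiberwise μ _).eq] at h

theorem RegularPair.real_smul {L L' : Schwartz d →L[ℂ] Schwartz d} (h : RegularPair hω L L')
    (κ : ℝ) : RegularPair hω ((κ : ℂ) • L) ((κ : ℂ) • L') := by
  have := h.smul (κ : ℂ)
  rwa [Complex.conj_ofReal] at this

/-- The formal adjoint of `schwartzD`. -/
def schwartzDAdjoint (d : ℕ) (ω : ℝ) : Schwartz d →L[ℂ] Schwartz d :=
  (ω : ℂ) • cliffordPosition d - Complex.I • dirac d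

theorem regularPair_schwartzD₁ : RegularPair hω (schwartzD₁ d ω) (schwartzD₁ d ω) := by
  rw [schwartzD₁_eq]
  exact (regularPair_cliffordPosition.real_smul ω).add regularPair_dirac

theorem regularPair_schwartzD₂ : RegularPair hω (schwartzD₂ d ω) (schwartzD₂ d ω) := by
  rw [schwartzD₂_eq]
  exact (regularPair_cliffordPosition.real_smul ω).sub regularPair_dirac

theorem regularPair_schwartzD : RegularPair hω (schwartzD d ω) (schwartzDAdjoint d ω) := by
  have h := (regularPair_cliffordPosition (d := d) (hω := hω).real_smul ω).add
    (regularPair_dirac.smul Complex.I)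
  rwa [Complex.conj_I, neg_smul, ← sub_eq_add_neg, ← schwartzD_eq] at h

end HarmonicOscillator

/-! ### The graded representation and bounded commutators. -/

namespace HarmonicOscillator

variable {d : ℕ}

/-! ### The Schwartz algebra in `C₀(ℝ^d)` -/

/-- A tent function cuts f off where it is already small, and the result is smoothed within its
support. The compact support is recorded for the proof of separability. -/
theorem exists_schwartzAlgebra_dist_lt (f : C₀(EuclideanSpace ℝ (Fin d), ℂ)) {ε : ℝ}
    (hε : 0 < ε) : ∃ h ∈ schwartzAlgebra d, dist f h < ε ∧
      ∃ n : ℕ, ∀ x, (n : ℝ) ≤ ‖x‖ → h x = 0 := by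
  obtain ⟨N, hN⟩ : ∃ N : ℕ, ∀ x, (N : ℝ) ≤ ‖x‖ → ‖f x‖ < ε / 4 := by
    have h := f.zero_at_infty'
    rw [Metric.tendsto_nhds] at h
    have h1 := h (ε / 4) (by positivity)
    rw [← Metric.cobounded_eq_cocompact, ← comap_norm_atTop, Filter.eventually_comap] at h1
    obtain ⟨r, hr⟩ := Filter.eventually_atTop.1 h1
    obtain ⟨N, hN⟩ := exists_nat_ge r
    exact ⟨N, fun x hx => by simpa using hr ‖x‖ (hN.trans hx) x rfl⟩
  set c : EuclideanSpace ℝ (Fin d) → ℝ := fun x => max 0 (min 1 (N + 1 - ‖x‖)) with hc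
  have hcc : Continuous c := by fun_prop
  have hc0 : ∀ x, 0 ≤ c x := fun x => le_max_left _ _
  have hc1 : ∀ x, c x ≤ 1 := fun x => max_le zero_le_one (min_le_left _ _)
  obtain ⟨g, hg, hgd, hgs⟩ := Continuous.exists_contDiff_approx (f := fun x => (c x : ℂ) * f x)
    (ε := fun _ => ε / 4) ⊤ ((Complex.continuous_ofReal.comp hcc).mul f.continuous)
    continuous_const (fun _ => by positivity)
  have hg0 : ∀ x, (N + 1 : ℝ) ≤ ‖x‖ → g x = 0 := fun x hx => by
    by_contra h
    -- The approximant is supported where the cut-off function is, and the tent vanishes from radius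
    -- N + 1 on.
    refine hgs h ?_
    have : c x = 0 := max_eq_left ((min_le_right _ _).trans (by linarith))
    simp [this]
  have hgc : HasCompactSupport g := by
    refine HasCompactSupport.intro (isCompact_closedBall 0 (N + 1 : ℝ)) fun x hx => hg0 x ?_
    simp at hx
    exact hx.le
  refine ⟨(hgc.toSchwartzMap hg).toZeroAtInfty, ⟨hgc.toSchwartzMap hg, fun x => rfl⟩, ?_,
    N + 1, fun x hx => hg0 x (by exact_mod_cast hx)⟩
  rw [← ZeroAtInftyContinuousMap.dist_toBCF_eq_dist]
  refine lt_of_le_of_lt ((BoundedContinuousFunction.dist_le (C := ε / 2) (by positivity)).2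
    fun x => ?_) (half_lt_self hε)
  change dist (f x) (g x) ≤ ε / 2
  have h1 : dist (f x) ((c x : ℂ) * f x) ≤ ε / 4 := by
    rcases le_or_gt (N : ℝ) ‖x‖ with hx | hx
    · have h2 : f x - c x * f x = ((1 - c x : ℝ) : ℂ) * f x := by push_cast; ring
      rw [dist_eq_norm, h2, norm_mul, Complex.norm_real, Real.norm_of_nonneg (by linarith [hc1 x])]
      exact (mul_le_of_le_one_left (norm_nonneg _) (by linarith [hc0 x])).trans (hN x hx).le
    · have : c x = 1 := by
        simp only [hc]
        rw [min_eq_left (by linarith), max_eq_right zero_le_one]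
      simp [this]
      positivity
  have h3 := hgd x
  rw [dist_comm] at h3
  linarith [dist_triangle (f x) ((c x : ℂ) * f x) (g x)]

theorem dense_schwartzAlgebra :
    Dense (schwartzAlgebra d : Set C₀(EuclideanSpace ℝ (Fin d), ℂ)) := fun f =>
  Metric.mem_closure_iff.2 fun _ hε =>
    let ⟨h, hh, hd, _⟩ := exists_schwartzAlgebra_dist_lt f hε
    ⟨h, hh, hd⟩

open TopologicalSpace in
-- Functions vanishing outside a ball embed isometrically into the separable space of continuous
-- functions on the closed ball, and the union of these countably many subspaces is dense.
theorem isSeparable_zeroAtInfty (s : Set C₀(EuclideanSpace ℝ (Fin d), ℂ)) : IsSeparable s := by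
  have hM : ∀ n : ℕ, IsSeparable {f : C₀(EuclideanSpace ℝ (Fin d), ℂ) |
      ∀ x, (n : ℝ) ≤ ‖x‖ → f x = 0} := fun n => by
    set M := {f : C₀(EuclideanSpace ℝ (Fin d), ℂ) | ∀ x, (n : ℝ) ≤ ‖x‖ → f x = 0}
    let ρ : M → C(Metric.closedBall (0 : EuclideanSpace ℝ (Fin d)) n, ℂ) := fun f =>
      ⟨fun x => f.1 x, f.1.continuous.comp continuous_subtype_val⟩
    have hρ : Isometry ρ := Isometry.of_dist_eq fun f g => by
      change _ = dist f.1 g.1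
      rw [← ZeroAtInftyContinuousMap.dist_toBCF_eq_dist]
      refine le_antisymm ?_ ?_
      · refine (ContinuousMap.dist_le dist_nonneg).2 fun x => ?_
        exact BoundedContinuousFunction.dist_coe_le_dist (f := f.1.toBCF) (g := g.1.toBCF) x.1
      · refine (BoundedContinuousFunction.dist_le dist_nonneg).2 fun x => ?_
        change dist (f.1 x) (g.1 x) ≤ _
        rcases le_or_gt ‖x‖ n with hx | hx
        · exact ContinuousMap.dist_apply_le_dist (f := ρ f) (g := ρ g) ⟨x, by simpa using hx⟩
        · rw [f.2 x hx.le, g.2 x hx.le, dist_self]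
          exact dist_nonneg
    have h1 := hρ.isUniformInducing.isInducing.isSeparable_preimage (IsSeparable.of_separableSpace
      (Set.univ : Set C(Metric.closedBall (0 : EuclideanSpace ℝ (Fin d)) n, ℂ)))
    rw [Set.preimage_univ] at h1
    have h2 := h1.image continuous_subtype_val
    rwa [Set.image_univ, Subtype.range_coe] at h2
  refine ((IsSeparable.iUnion hM).closure).mono fun f _ => ?_
  refine Metric.mem_closure_iff.2 fun ε hε => ?_
  obtain ⟨h, _, hd, n, hn⟩ := exists_schwartzAlgebra_dist_lt f hε
  exact ⟨h, Set.mem_iUnion.2 ⟨n, hn⟩, hd⟩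

/-! ### The grading -/

theorem grading_ae (ψ : L2 d) :
    grading d ψ =ᵐ[volume] fun x => FermionSpace.grading d (ψ x) :=
  (FermionSpace.grading d).coeFn_compLpL ψ

theorem isGradedRepresentation :
    IsGradedRepresentation (schwartzAlgebra d) (rep d) (grading d) where
  separableSpace := by
    have : Fact ((2 : ℝ≥0∞) ≠ ∞) := ⟨ENNReal.ofNat_ne_top⟩
    infer_instance
  isSelfAdjoint_grading := by
    rw [ContinuousLinearMap.isSelfAdjoint_iff', eq_comm, ContinuousLinearMap.eq_adjoint_iff]
    intro ψ χ
    rw [L2.inner_def, L2.inner_def]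
    refine integral_congr_ae ?_
    filter_upwards [grading_ae ψ, grading_ae χ] with x h1 h2
    rw [h1, h2]
    nth_rewrite 1 [← FermionSpace.adjoint_grading]
    rw [ContinuousLinearMap.adjoint_inner_left]
  grading_mul_self := by
    ext1 ψ
    refine Lp.ext ?_
    filter_upwards [grading_ae (grading d ψ), grading_ae ψ] with x h1 h2
    rw [mul_apply_eq_comp, h1, h2]
    exact congrArg (fun T => T (ψ x)) FermionSpace.grading_mul_grading
  even a := by
    ext1 ψ
    refine Lp.ext ?_
    change grading d (mulOp a ψ) =ᵐ[volume] mulOp a (grading d ψ)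
    filter_upwards [grading_ae (mulOp a ψ), mulOp_apply a ψ, mulOp_apply a (grading d ψ),
      grading_ae ψ] with x h1 h2 h3 h4
    rw [h1, h2, h3, h4, map_smul]
  isSeparable := isSeparable_zeroAtInfty _
  dense := dense_schwartzAlgebra

theorem fiberwise_grading_cliffordPosition :
    cliffordPosition d * fiberwise (FermionSpace.grading d) =
      -(fiberwise (FermionSpace.grading d) * cliffordPosition d) := by
  rw [cliffordPosition, Finset.sum_mul, Finset.mul_sum, ← Finset.sum_neg_distrib]
  refine Finset.sum_congr rfl fun μ _ => ?_
  rw [← mul_assoc, ← (position_commute_fiberwise μ _).eq, mul_assoc, mul_assoc, ← fiberwise_mul,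
    ← fiberwise_mul, FermionSpace.grading_mul_gammaPos, fiberwise_neg, mul_neg, neg_neg]

theorem fiberwise_grading_dirac :
    dirac d * fiberwise (FermionSpace.grading d) =
      -(fiberwise (FermionSpace.grading d) * dirac d) := by
  rw [dirac, Finset.sum_mul, Finset.mul_sum, ← Finset.sum_neg_distrib]
  refine Finset.sum_congr rfl fun μ _ => ?_
  rw [← mul_assoc, ← (partialDeriv_commute_fiberwise μ _).eq, mul_assoc, mul_assoc,
    ← fiberwise_mul, ← fiberwise_mul, FermionSpace.grading_mul_gammaNeg, fiberwise_neg, mul_neg,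
    neg_neg]

variable {ω : ℝ} {hω : 0 < ω}

/-- All operators in question have the form αX + βP, so this form is treated once; the sign change
under the grading passes to the closure by `closure_intertwine`. -/
theorem isOdd_closure {L' : Schwartz d →L[ℂ] Schwartz d} (α β : ℂ)
    (h : RegularPair hω (α • cliffordPosition d + β • dirac d) L') :
    UnboundedOp.IsOdd (grading d) (ofSchwartz (α • cliffordPosition d + β • dirac d)).closure := by
  have h2 : (α • cliffordPosition d + β • dirac d) * fiberwise (FermionSpace.grading d) =
      -(fiberwise (FermionSpace.grading d) * (α • cliffordPosition d + β • dirac d)) := by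
    simp only [add_mul, mul_add, smul_mul_assoc, mul_smul_comm,
      fiberwise_grading_cliffordPosition, fiberwise_grading_dirac]
    module
  have key : ∀ f, ∃ g, schwartzToL2 d g = grading d (schwartzToL2 d f) ∧
      schwartzToL2 d ((α • cliffordPosition d + β • dirac d) g) =
        (-grading d) (schwartzToL2 d ((α • cliffordPosition d + β • dirac d) f)) +
          (0 : L2 d →L[ℂ] L2 d) (schwartzToL2 d f) := fun f => by
    refine ⟨fiberwise (FermionSpace.grading d) f, schwartzToL2_fiberwise _ _, ?_⟩
    rw [zero_apply, add_zero, neg_apply, grading, ← schwartzToL2_fiberwise, ← map_neg]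
    exact congrArg (fun T : Schwartz d →L[ℂ] Schwartz d => schwartzToL2 d (T f)) h2
  intro ψ
  obtain ⟨hψ, h1⟩ := closure_intertwine h key ψ
  exact ⟨hψ, by simpa using h1⟩

/-! ### Commutators with multiplication operators -/

/-- Multiplication of vector valued Schwartz functions by a scalar Schwartz function. -/
def schwartzMul (g : 𝓢(EuclideanSpace ℝ (Fin d), ℂ)) : Schwartz d →L[ℂ] Schwartz d :=
  SchwartzMap.smulLeftCLM (FermionSpace d) g

theorem schwartzMul_apply (g : 𝓢(EuclideanSpace ℝ (Fin d), ℂ)) (f : Schwartz d)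
    (x : EuclideanSpace ℝ (Fin d)) : schwartzMul g f x = g x • f x :=
  SchwartzMap.smulLeftCLM_apply_apply g.hasTemperateGrowth f x

theorem schwartzToL2_schwartzMul {a : C₀(EuclideanSpace ℝ (Fin d), ℂ)}
    {g : 𝓢(EuclideanSpace ℝ (Fin d), ℂ)} (h : ∀ x, a x = g x) (f : Schwartz d) :
    schwartzToL2 d (schwartzMul g f) = rep d a (schwartzToL2 d f) := by
  refine Lp.ext ?_
  change _ =ᵐ[volume] mulOp a (schwartzToL2 d f)
  filter_upwards [(schwartzMul g f).coeFn_toLp 2 volume, f.coeFn_toLp 2 volume,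
    mulOp_apply a (schwartzToL2 d f)] with x h1 h2 h3
  rw [h3, h]
  exact h1.trans ((schwartzMul_apply g f x).trans (congrArg (g x • ·) h2.symm))

theorem cliffordPosition_schwartzMul (g : 𝓢(EuclideanSpace ℝ (Fin d), ℂ)) :
    cliffordPosition d * schwartzMul g = schwartzMul g * cliffordPosition d := by
  rw [cliffordPosition, Finset.sum_mul, Finset.mul_sum]
  refine Finset.sum_congr rfl fun μ _ => ?_
  refine ContinuousLinearMap.ext fun f => SchwartzMap.ext fun x => ?_
  simp [schwartzMul_apply, position_apply, fiberwise_apply, smul_comm (x μ : ℂ)]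

theorem dirac_schwartzMul (g : 𝓢(EuclideanSpace ℝ (Fin d), ℂ)) :
    dirac d * schwartzMul g = schwartzMul g * dirac d +
      ∑ μ, schwartzMul (∂_{EuclideanSpace.single μ (1 : ℝ)} g) *
        fiberwise (FermionSpace.gammaNeg μ) := by
  rw [dirac, Finset.sum_mul, Finset.mul_sum, ← Finset.sum_add_distrib]
  refine Finset.sum_congr rfl fun μ _ => ?_
  refine ContinuousLinearMap.ext fun f => SchwartzMap.ext fun x => ?_
  have h1 : (fiberwise (FermionSpace.gammaNeg μ) (schwartzMul g f) :
      EuclideanSpace ℝ (Fin d) → FermionSpace d) =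
      fun x => g x • fiberwise (FermionSpace.gammaNeg μ) f x := funext fun x => by
    rw [fiberwise_apply, schwartzMul_apply, fiberwise_apply, map_smul]
  have h2 : HasFDerivAt (fun x => g x • fiberwise (FermionSpace.gammaNeg μ) f x) _ x :=
    (g.hasFDerivAt x).smul ((fiberwise (FermionSpace.gammaNeg μ) f).hasFDerivAt x)
  change partialDeriv μ (fiberwise (FermionSpace.gammaNeg μ) (schwartzMul g f)) x =
    schwartzMul g (partialDeriv μ (fiberwise (FermionSpace.gammaNeg μ) f)) x +
      schwartzMul (∂_{EuclideanSpace.single μ (1 : ℝ)} g) (fiberwise (FermionSpace.gammaNeg μ) f) x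
  rw [partialDeriv_apply, h1, h2.fderiv, schwartzMul_apply, schwartzMul_apply, partialDeriv_apply,
    SchwartzMap.lineDerivOp_apply_eq_fderiv]
  simp

/-- The bounded commutator `∑_μ (∂_μ g) ⊗ (b_μ^* - b_μ)` of the Dirac operator with `g`. -/
def cliffordGradient (g : 𝓢(EuclideanSpace ℝ (Fin d), ℂ)) : L2 d →L[ℂ] L2 d :=
  ∑ μ, rep d (∂_{EuclideanSpace.single μ (1 : ℝ)} g).toZeroAtInfty *
    (FermionSpace.gammaNeg μ).compLpL 2 volume

/-- X commutes with multiplication by g, and by the Leibniz rule P contributes only the bounded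
Clifford action of the gradient, so the commutation rule survives the passage to the closure. -/
theorem closure_mul {L' : Schwartz d →L[ℂ] Schwartz d} {α β : ℂ}
    (h : RegularPair hω (α • cliffordPosition d + β • dirac d) L')
    {a : C₀(EuclideanSpace ℝ (Fin d), ℂ)} {g : 𝓢(EuclideanSpace ℝ (Fin d), ℂ)}
    (ha : ∀ x, a x = g x) (ψ : (ofSchwartz (α • cliffordPosition d + β • dirac d)).closure.domain) :
    ∃ hψ : rep d a ψ ∈ (ofSchwartz (α • cliffordPosition d + β • dirac d)).closure.domain,
      (ofSchwartz (α • cliffordPosition d + β • dirac d)).closure ⟨rep d a ψ, hψ⟩ =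
        rep d a ((ofSchwartz (α • cliffordPosition d + β • dirac d)).closure ψ) +
          (β • cliffordGradient g) ψ := by
  refine closure_intertwine h (fun f => ⟨schwartzMul g f, schwartzToL2_schwartzMul ha f, ?_⟩) ψ
  have h1 : (α • cliffordPosition d + β • dirac d) * schwartzMul g =
      schwartzMul g * (α • cliffordPosition d + β • dirac d) +
        β • ∑ μ, schwartzMul (∂_{EuclideanSpace.single μ (1 : ℝ)} g) *
          fiberwise (FermionSpace.gammaNeg μ) := by
    simp only [add_mul, mul_add, smul_mul_assoc, mul_smul_comm, cliffordPosition_schwartzMul,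
      dirac_schwartzMul, smul_add, add_assoc]
  have h2 := congrArg (fun T => schwartzToL2 d (T f)) h1
  have h3 : ∀ (μ : Fin d) (φ : Schwartz d),
      schwartzToL2 d (schwartzMul (∂_{EuclideanSpace.single μ (1 : ℝ)} g) φ) =
      rep d (∂_{EuclideanSpace.single μ (1 : ℝ)} g).toZeroAtInfty (schwartzToL2 d φ) :=
    fun μ φ => schwartzToL2_schwartzMul (fun x => rfl) φ
  simp only [mul_apply_eq_comp, add_apply (F := Schwartz d →L[ℂ] Schwartz d)] at h2
  refine h2.trans ?_
  rw [map_add, schwartzToL2_schwartzMul ha]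
  congr 1
  simp only [smul_apply, sum_apply, map_smul, map_sum, mul_apply_eq_comp, h3,
    schwartzToL2_fiberwise, cliffordGradient]

theorem hasBoundedCommutatorOn_closure {L' : Schwartz d →L[ℂ] Schwartz d} {α β : ℂ}
    (h : RegularPair hω (α • cliffordPosition d + β • dirac d) L')
    {a : C₀(EuclideanSpace ℝ (Fin d), ℂ)} (ha : a ∈ schwartzAlgebra d)
    {E : Submodule ℂ (L2 d)}
    (hE : E ≤ (ofSchwartz (α • cliffordPosition d + β • dirac d)).closure.domain) :
    UnboundedOp.HasBoundedCommutatorOn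
      (ofSchwartz (α • cliffordPosition d + β • dirac d)).closure (rep d a) E := by
  obtain ⟨g, hg⟩ := ha
  refine ⟨hE, ‖β • cliffordGradient g‖, fun ψ _ => ?_⟩
  obtain ⟨hψ, h1⟩ := closure_mul h hg ψ
  refine ⟨hψ, ?_⟩
  rw [h1, add_sub_cancel_left]
  exact ContinuousLinearMap.le_opNorm _ _

end HarmonicOscillator

/-! ### Compact inclusion of the domains, from elliptic estimates. -/

namespace HarmonicOscillator

open Filter Topology

variable {d : ℕ} {ω : ℝ} {hω : 0 < ω}

/-! ### Compactness -/

theorem finiteDimensional_range_regularizer (hω : 0 < ω) (n : ℕ) :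
    FiniteDimensional ℂ (LinearMap.range (schwartzToL2 d ∘ₗ regularizer hω n)) := by
  have h : LinearMap.range (regularizer (d := d) hω n) ≤ ⨆ k : Fin n, level hω k := by
    rintro _ ⟨ψ, rfl⟩
    rw [regularizer_apply]
    exact Submodule.sum_mem _ fun k hk => Submodule.smul_mem _ _
      (Submodule.mem_iSup_of_mem ⟨k, Finset.mem_range.1 hk⟩ (levelProj_mem hω k ψ))
  have := Submodule.finiteDimensional_of_le h
  rw [LinearMap.range_comp]
  infer_instance

/-- The Schwartz estimate is applied to R_mψ with m → ∞; one sequence approximates ψ in both graph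
norms. -/
theorem norm_sub_regularizer_closure_le {L₁ L₁' L₂ L₂' : Schwartz d →L[ℂ] Schwartz d}
    (h₁ : RegularPair hω L₁ L₁') (h₂ : RegularPair hω L₂ L₂') {K : ℝ}
    (hK : ∀ φ, ∑ μ, ‖schwartzToL2 d (bosonAnnihilation ω μ φ)‖ ^ 2 ≤
      K * (‖schwartzToL2 d φ‖ ^ 2 + ‖schwartzToL2 d (L₁ φ)‖ ^ 2 + ‖schwartzToL2 d (L₂ φ)‖ ^ 2))
    {n : ℕ} (hn : 0 < n)
    (ψ : ↥((ofSchwartz L₁).closure.domain ⊓ (ofSchwartz L₂).closure.domain)) :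
    ‖(ψ : L2 d) - schwartzToL2 d (regularizer hω n (ψ : L2 d))‖ ^ 2 ≤ 1 / (2 * ω * n) *
      (K * UnboundedOp.graphNormSq (ofSchwartz L₁).closure (ofSchwartz L₂).closure ψ) := by
  have h0 := tendsto_regularizer hω (ψ : L2 d)
  have h1 := tendsto_closure h₁ ⟨ψ, ψ.2.1⟩
  have h2 := tendsto_closure h₂ ⟨ψ, ψ.2.2⟩
  have hc : Tendsto (fun m => schwartzToL2 d (regularizer hω n
      (schwartzToL2 d (regularizer hω m (ψ : L2 d))))) atTop
      (𝓝 (schwartzToL2 d (regularizer hω n (ψ : L2 d)))) :=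
    ((((schwartzToL2 d ∘ₗ regularizer hω n).mkContinuous 1 fun χ => by
      rw [one_mul]; exact norm_regularizer_le hω n χ).continuous.tendsto _).comp h0)
  refine le_of_tendsto_of_tendsto' ((h0.sub hc).norm.pow 2)
    (((((h0.norm.pow 2).add (h1.norm.pow 2)).add (h2.norm.pow 2)).const_mul K).const_mul _)
    fun m => (norm_sub_regularizer_le hω hn _).trans ?_
  have := hω
  exact mul_le_mul_of_nonneg_left (hK _) (by positivity)

/-- The unit ball of the graph norm is uniformly close to its image under a finite rank regularizer,
hence totally bounded in L²; applying the continuous operator keeps it relatively compact. -/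
theorem isCompactOnDomain_closure {L₁ L₁' L₂ L₂' : Schwartz d →L[ℂ] Schwartz d}
    (h₁ : RegularPair hω L₁ L₁') (h₂ : RegularPair hω L₂ L₂') {K : ℝ}
    (hK : ∀ φ, ∑ μ, ‖schwartzToL2 d (bosonAnnihilation ω μ φ)‖ ^ 2 ≤
      K * (‖schwartzToL2 d φ‖ ^ 2 + ‖schwartzToL2 d (L₁ φ)‖ ^ 2 + ‖schwartzToL2 d (L₂ φ)‖ ^ 2))
    (a : L2 d →L[ℂ] L2 d) :
    UnboundedOp.IsCompactOnDomain a (ofSchwartz L₁).closure (ofSchwartz L₂).closure := by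
  set G := {ψ | UnboundedOp.graphNormSq (ofSchwartz L₁).closure (ofSchwartz L₂).closure ψ ≤ 1}
  have hB : TotallyBounded (Subtype.val '' G) := by
    rw [Metric.totallyBounded_iff]
    intro ε hε
    -- With this n the squared regularization error |K|/(2ωn) is below (ε/2)².
    obtain ⟨n, hn⟩ := exists_nat_gt (|K| / (2 * ω * (ε / 2) ^ 2))
    have hn0 : 0 < n := by
      have : (0 : ℝ) < n := lt_of_le_of_lt (by have := hω; positivity) hn
      exact_mod_cast this
    have := finiteDimensional_range_regularizer (d := d) hω n
    have := FiniteDimensional.proper ℂ (LinearMap.range (schwartzToL2 d ∘ₗ regularizer hω n))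
    have hC := ((isCompact_closedBall
      (0 : LinearMap.range (schwartzToL2 d ∘ₗ regularizer hω n)) 1).image
        continuous_subtype_val).totallyBounded
    obtain ⟨t, ht, hts⟩ := Metric.totallyBounded_iff.1 hC (ε / 2) (half_pos hε)
    refine ⟨t, ht, ?_⟩
    rintro _ ⟨ψ, hψ, rfl⟩
    have h1 : ‖(ψ : L2 d)‖ ≤ 1 := by
      have : ‖(ψ : L2 d)‖ ^ 2 ≤ 1 := by
        refine le_trans ?_ hψ
        rw [UnboundedOp.graphNormSq, add_assoc]
        exact le_add_of_nonneg_right (by positivity)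
      exact (sq_le_one_iff₀ (norm_nonneg _)).1 this
    have h2 : ‖(ψ : L2 d) - schwartzToL2 d (regularizer hω n (ψ : L2 d))‖ < ε / 2 := by
      refine (sq_lt_sq₀ (norm_nonneg _) (half_pos hε).le).1 ?_
      refine (norm_sub_regularizer_closure_le h₁ h₂ hK hn0 ψ).trans_lt ?_
      have hω' := hω
      have h3 : K * UnboundedOp.graphNormSq (ofSchwartz L₁).closure (ofSchwartz L₂).closure ψ ≤
          |K| := by
        have h0 : 0 ≤ UnboundedOp.graphNormSq (ofSchwartz L₁).closure (ofSchwartz L₂).closure ψ := by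
          rw [UnboundedOp.graphNormSq]
          positivity
        exact (mul_le_mul_of_nonneg_right (le_abs_self K) h0).trans
          (mul_le_of_le_one_right (abs_nonneg K) hψ)
      refine (mul_le_mul_of_nonneg_left h3 (by positivity)).trans_lt ?_
      rw [div_lt_iff₀ (by positivity)] at hn
      rw [one_div, inv_mul_lt_iff₀ (by positivity)]
      linarith
    have h4 := hts ⟨⟨_, (ψ : L2 d), rfl⟩, by
      rw [mem_closedBall_zero_iff]
      exact (norm_regularizer_le hω n (ψ : L2 d)).trans h1, rfl⟩
    simp only [Set.mem_iUnion] at h4 ⊢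
    obtain ⟨y, hy, h5⟩ := h4
    refine ⟨y, hy, ?_⟩
    rw [← dist_eq_norm] at h2
    have h6 := dist_triangle (ψ : L2 d) (schwartzToL2 d (regularizer hω n (ψ : L2 d))) y
    rw [Metric.mem_ball] at h5 ⊢
    exact h6.trans_lt ((add_lt_add h2 h5).trans_eq (add_halves ε))
  have hc := (hB.closure.isCompact_of_isClosed isClosed_closure).image a.continuous
  refine hc.of_isClosed_subset isClosed_closure (closure_minimal ?_ hc.isClosed)
  rintro _ ⟨ψ, hψ, rfl⟩
  exact ⟨ψ, subset_closure ⟨ψ, hψ, rfl⟩, rfl⟩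

/-! ### Elliptic estimates -/

theorem FormallyAdjoint.norm_sq {L L' : Schwartz d →L[ℂ] Schwartz d} (h : FormallyAdjoint L L')
    (φ : Schwartz d) : ((‖schwartzToL2 d (L φ)‖ ^ 2 : ℝ) : ℂ) =
      inner ℂ (schwartzToL2 d φ) (schwartzToL2 d ((L' * L) φ)) := by
  rw [mul_apply_eq_comp, ← h, inner_self_eq_norm_sq_to_K]
  push_cast
  rfl

theorem norm_sq_cliffordPosition (hω : 0 < ω) (φ : Schwartz d) :
    ‖schwartzToL2 d (cliffordPosition d φ)‖ ^ 2 = ∑ μ, ‖schwartzToL2 d (position μ φ)‖ ^ 2 := by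
  have h := (regularPair_cliffordPosition (d := d) (hω := hω)).adj.norm_sq φ
  rw [cliffordPosition_mul_self, sum_apply, map_sum, inner_sum] at h
  simp only [← (FormallyAdjoint.position _).norm_sq] at h
  exact_mod_cast h

theorem norm_sq_dirac (hω : 0 < ω) (φ : Schwartz d) :
    ‖schwartzToL2 d (dirac d φ)‖ ^ 2 = ∑ μ, ‖schwartzToL2 d (partialDeriv μ φ)‖ ^ 2 := by
  have h := (regularPair_dirac (d := d) (hω := hω)).adj.norm_sq φ
  rw [dirac_mul_self, ← Finset.sum_neg_distrib, sum_apply, map_sum, inner_sum] at h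
  simp only [← neg_mul, ← (FormallyAdjoint.partialDeriv _).norm_sq] at h
  exact_mod_cast h

theorem sum_norm_sq_bosonAnnihilation_le (φ : Schwartz d) (hω : 0 < ω) :
    ∑ μ, ‖schwartzToL2 d (bosonAnnihilation ω μ φ)‖ ^ 2 ≤
      2 * (‖schwartzToL2 d (((ω : ℂ) • cliffordPosition d) φ)‖ ^ 2 +
        ‖schwartzToL2 d (dirac d φ)‖ ^ 2) := by
  rw [smul_apply, map_smul, norm_smul, mul_pow, norm_sq_cliffordPosition hω, norm_sq_dirac hω,
    Finset.mul_sum, ← Finset.sum_add_distrib, Finset.mul_sum]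
  refine Finset.sum_le_sum fun μ _ => ?_
  rw [← mul_pow, ← norm_smul, ← map_smul, bosonAnnihilation, add_apply, map_add, smul_apply]
  have h := parallelogram_law_with_norm ℂ (schwartzToL2 d ((ω : ℂ) • position μ φ))
    (schwartzToL2 d (partialDeriv μ φ))
  nlinarith [norm_nonneg (schwartzToL2 d ((ω : ℂ) • position μ φ) -
    schwartzToL2 d (partialDeriv μ φ))]

/-- The parallelogram law for ωXφ and iPφ expresses 2(‖ωXφ‖² + ‖Pφ‖²) through ωX ± iP, which
explains the constant 1. -/
theorem sum_norm_sq_bosonAnnihilation_le_schwartzD (hω : 0 < ω) (φ : Schwartz d) :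
    ∑ μ, ‖schwartzToL2 d (bosonAnnihilation ω μ φ)‖ ^ 2 ≤
      1 * (‖schwartzToL2 d φ‖ ^ 2 + ‖schwartzToL2 d (schwartzD d ω φ)‖ ^ 2 +
        ‖schwartzToL2 d (schwartzDAdjoint d ω φ)‖ ^ 2) := by
  refine (sum_norm_sq_bosonAnnihilation_le φ hω).trans ?_
  have h := parallelogram_law_with_norm ℂ (schwartzToL2 d (((ω : ℂ) • cliffordPosition d) φ))
    (schwartzToL2 d ((Complex.I • dirac d) φ))
  rw [← map_add, ← map_sub, ← add_apply, ← sub_apply, ← schwartzD_eq, ← schwartzDAdjoint,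
    show (Complex.I • dirac d) φ = Complex.I • dirac d φ from rfl, map_smul _ Complex.I, norm_smul,
    Complex.norm_I, one_mul] at h
  nlinarith [sq_nonneg ‖schwartzToL2 d φ‖]

/-- The squares of ωX + P and ωX - P differ by 2ω(XP + PX), a bounded operator, so each operator
controls the other up to ‖φ‖². -/
theorem abs_norm_sq_schwartzD₁_sub_le (hω : 0 < ω) (φ : Schwartz d) :
    |‖schwartzToL2 d (schwartzD₁ d ω φ)‖ ^ 2 - ‖schwartzToL2 d (schwartzD₂ d ω φ)‖ ^ 2| ≤
      2 * ω * ‖(antiCommutator d).compLpL 2 (volume : Measure (EuclideanSpace ℝ (Fin d)))‖ *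
        ‖schwartzToL2 d φ‖ ^ 2 := by
  have h1 := (regularPair_schwartzD₁ (d := d) (hω := hω)).adj.norm_sq φ
  have h2 := (regularPair_schwartzD₂ (d := d) (hω := hω)).adj.norm_sq φ
  have h3 : schwartzD₁ d ω * schwartzD₁ d ω - schwartzD₂ d ω * schwartzD₂ d ω =
      (2 * ω : ℂ) • fiberwise (antiCommutator d) := by
    rw [schwartzD₁_eq, schwartzD₂_eq, ← cliffordPosition_dirac]
    simp only [add_mul, mul_add, sub_mul, mul_sub, smul_mul_assoc, mul_smul_comm]
    module
  have h4 : ((‖schwartzToL2 d (schwartzD₁ d ω φ)‖ ^ 2 -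
      ‖schwartzToL2 d (schwartzD₂ d ω φ)‖ ^ 2 : ℝ) : ℂ) = (2 * ω : ℂ) *
      inner ℂ (schwartzToL2 d φ) ((antiCommutator d).compLpL 2 volume (schwartzToL2 d φ)) := by
    rw [Complex.ofReal_sub, h1, h2, ← inner_sub_right, ← map_sub, ← sub_apply, h3, smul_apply,
      map_smul, inner_smul_right, schwartzToL2_fiberwise]
  rw [← Real.norm_eq_abs, ← Complex.norm_real, h4, norm_mul, norm_mul, Complex.norm_ofNat,
    Complex.norm_real, Real.norm_of_nonneg hω.le, mul_assoc (2 * ω)]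
  refine mul_le_mul_of_nonneg_left ((norm_inner_le_norm _ _).trans ?_) (by positivity)
  rw [sq, mul_left_comm]
  exact mul_le_mul_of_nonneg_left (ContinuousLinearMap.le_opNorm _ _) (norm_nonneg _)

theorem two_mul_norm_sq_add_norm_sq (φ : Schwartz d) :
    2 * (‖schwartzToL2 d (((ω : ℂ) • cliffordPosition d) φ)‖ ^ 2 +
      ‖schwartzToL2 d (dirac d φ)‖ ^ 2) =
      ‖schwartzToL2 d (schwartzD₁ d ω φ)‖ ^ 2 + ‖schwartzToL2 d (schwartzD₂ d ω φ)‖ ^ 2 := by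
  have h := parallelogram_law_with_norm ℂ (schwartzToL2 d (((ω : ℂ) • cliffordPosition d) φ))
    (schwartzToL2 d (dirac d φ))
  rw [← map_add, ← map_sub, ← add_apply, ← sub_apply, ← schwartzD₁_eq, ← schwartzD₂_eq] at h
  linarith

/-- The parallelogram law bounds the left side by ‖(ωX + P)φ‖² + ‖(ωX - P)φ‖², and the second term
is exchanged for the first at the cost c‖φ‖², with c = 2ω‖XP + PX‖. The repeated term matches the
combined graph norm of an operator with itself. -/
theorem exists_sum_norm_sq_bosonAnnihilation_le_schwartzD₁ (hω : 0 < ω) :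
    ∃ K : ℝ, ∀ φ, ∑ μ, ‖schwartzToL2 d (bosonAnnihilation ω μ φ)‖ ^ 2 ≤
      K * (‖schwartzToL2 d φ‖ ^ 2 + ‖schwartzToL2 d (schwartzD₁ d ω φ)‖ ^ 2 +
        ‖schwartzToL2 d (schwartzD₁ d ω φ)‖ ^ 2) := by
  refine ⟨1 + 2 * ω *
    ‖(antiCommutator d).compLpL 2 (volume : Measure (EuclideanSpace ℝ (Fin d)))‖, fun φ => ?_⟩
  have h1 := sum_norm_sq_bosonAnnihilation_le φ hω
  have h2 := abs_le.1 (abs_norm_sq_schwartzD₁_sub_le hω φ)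
  rw [two_mul_norm_sq_add_norm_sq] at h1
  have h3 : 0 ≤ 2 * ω *
    ‖(antiCommutator d).compLpL 2 (volume : Measure (EuclideanSpace ℝ (Fin d)))‖ := by positivity
  nlinarith [h2.1, mul_nonneg h3 (sq_nonneg ‖schwartzToL2 d (schwartzD₁ d ω φ)‖),
    sq_nonneg ‖schwartzToL2 d φ‖]

theorem exists_sum_norm_sq_bosonAnnihilation_le_schwartzD₂ (hω : 0 < ω) :
    ∃ K : ℝ, ∀ φ, ∑ μ, ‖schwartzToL2 d (bosonAnnihilation ω μ φ)‖ ^ 2 ≤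
      K * (‖schwartzToL2 d φ‖ ^ 2 + ‖schwartzToL2 d (schwartzD₂ d ω φ)‖ ^ 2 +
        ‖schwartzToL2 d (schwartzD₂ d ω φ)‖ ^ 2) := by
  refine ⟨1 + 2 * ω *
    ‖(antiCommutator d).compLpL 2 (volume : Measure (EuclideanSpace ℝ (Fin d)))‖, fun φ => ?_⟩
  have h1 := sum_norm_sq_bosonAnnihilation_le φ hω
  have h2 := abs_le.1 (abs_norm_sq_schwartzD₁_sub_le hω φ)
  rw [two_mul_norm_sq_add_norm_sq] at h1
  have h3 : 0 ≤ 2 * ω *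
    ‖(antiCommutator d).compLpL 2 (volume : Measure (EuclideanSpace ℝ (Fin d)))‖ := by positivity
  nlinarith [h2.2, mul_nonneg h3 (sq_nonneg ‖schwartzToL2 d (schwartzD₂ d ω φ)‖),
    sq_nonneg ‖schwartzToL2 d φ‖]

end HarmonicOscillator

namespace HarmonicOscillator

open Filter Topology

variable {d : ℕ} {ω : ℝ} {hω : 0 < ω}

/-! ### The resolvent of the Clifford position operator -/

/-- The function `(m² + κ²‖x‖²)⁻¹`. -/
def resolventWeight (d : ℕ) (κ m : ℝ) (x : EuclideanSpace ℝ (Fin d)) : ℂ :=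
  (((m ^ 2)⁻¹ * (1 + ‖(κ / m) • x‖ ^ 2) ^ (-1 : ℝ) : ℝ) : ℂ)

/-- The weight is a rescaled power of 1 + ‖x‖², for which temperate growth is known; this is why it
was written in that form. -/
theorem hasTemperateGrowth_resolventWeight (κ m : ℝ) :
    (resolventWeight d κ m).HasTemperateGrowth := by
  have h1 := (Function.hasTemperateGrowth_one_add_norm_sq_rpow
    (EuclideanSpace ℝ (Fin d)) (-1)).comp
      ((κ / m) • ContinuousLinearMap.id ℝ (EuclideanSpace ℝ (Fin d))).hasTemperateGrowth
  convert ((m ^ 2)⁻¹ • Complex.ofRealCLM).hasTemperateGrowth.comp h1 using 1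
  ext x
  simp [resolventWeight]

theorem mul_resolventWeight (κ : ℝ) {m : ℝ} (hm : m ≠ 0) (x : EuclideanSpace ℝ (Fin d)) :
    ((κ ^ 2 * ‖x‖ ^ 2 + m ^ 2 : ℝ) : ℂ) * resolventWeight d κ m x = 1 := by
  rw [resolventWeight, ← Complex.ofReal_mul, Complex.ofReal_eq_one, Real.rpow_neg_one, norm_smul,
    mul_pow, Real.norm_eq_abs, sq_abs, ← mul_inv, mul_add, ← mul_assoc, div_pow, mul_one,
    mul_div_cancel₀ _ (pow_ne_zero 2 hm), add_comm]
  exact mul_inv_cancel₀ (by positivity)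

/-- Multiplication by `(m² + κ²‖x‖²)⁻¹` on Schwartz functions. -/
def resolventMul (d : ℕ) (κ m : ℝ) : Schwartz d →L[ℂ] Schwartz d :=
  SchwartzMap.smulLeftCLM (FermionSpace d) (resolventWeight d κ m)

theorem resolventMul_apply (κ m : ℝ) (f : Schwartz d) (x : EuclideanSpace ℝ (Fin d)) :
    resolventMul d κ m f x = resolventWeight d κ m x • f x :=
  SchwartzMap.smulLeftCLM_apply_apply (hasTemperateGrowth_resolventWeight κ m) f x

theorem cliffordPosition_resolventMul (κ m : ℝ) :
    cliffordPosition d * resolventMul d κ m = resolventMul d κ m * cliffordPosition d := by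
  rw [cliffordPosition, Finset.sum_mul, Finset.mul_sum]
  refine Finset.sum_congr rfl fun μ _ => ?_
  refine ContinuousLinearMap.ext fun f => SchwartzMap.ext fun x => ?_
  simp [resolventMul_apply, position_apply, fiberwise_apply, smul_comm (x μ : ℂ)]

theorem cliffordPosition_mul_self_apply (f : Schwartz d) (x : EuclideanSpace ℝ (Fin d)) :
    (cliffordPosition d * cliffordPosition d) f x = ((‖x‖ ^ 2 : ℝ) : ℂ) • f x := by
  rw [cliffordPosition_mul_self, sum_apply, sum_apply, EuclideanSpace.norm_sq_eq,
    Complex.ofReal_sum, Finset.sum_smul]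
  refine Finset.sum_congr rfl fun μ _ => ?_
  rw [mul_apply_eq_comp, position_apply, position_apply, smul_smul, Real.norm_eq_abs, sq_abs]
  push_cast
  rw [sq]

/-- The resolvent `(κ X - im)⁻¹ = (κ X + im) (κ² X² + m²)⁻¹` on Schwartz functions. -/
def schwartzResolvent (d : ℕ) (κ m : ℝ) : Schwartz d →L[ℂ] Schwartz d :=
  ((κ : ℂ) • cliffordPosition d + (Complex.I * m) • 1) * resolventMul d κ m

theorem sub_mul_schwartzResolvent (κ : ℝ) {m : ℝ} (hm : m ≠ 0) :
    ((κ : ℂ) • cliffordPosition d - (Complex.I * m) • 1) * schwartzResolvent d κ m = 1 := by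
  have h1 : ((κ : ℂ) • cliffordPosition d - (Complex.I * m) • 1) *
      ((κ : ℂ) • cliffordPosition d + (Complex.I * m) • 1) =
      ((κ : ℂ) ^ 2) • (cliffordPosition d * cliffordPosition d) + ((m : ℂ) ^ 2) • 1 := by
    have h2 : (m : ℂ) ^ 2 = -(Complex.I * m) ^ 2 := by
      rw [mul_pow, Complex.I_sq]
      ring
    rw [h2]
    simp only [sub_mul, mul_add, smul_mul_assoc, mul_smul_comm, one_mul, mul_one]
    module
  rw [schwartzResolvent, ← mul_assoc, h1]
  refine ContinuousLinearMap.ext fun f => SchwartzMap.ext fun x => ?_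
  rw [mul_apply_eq_comp, add_apply, add_apply, smul_apply, smul_apply, smul_apply, smul_apply,
    cliffordPosition_mul_self_apply, one_apply_eq_self, smul_smul, ← add_smul,
    resolventMul_apply, smul_smul, one_apply_eq_self]
  have h3 := mul_resolventWeight κ hm x
  push_cast at h3 ⊢
  rw [h3, one_smul]

theorem schwartzResolvent_mul_sub (κ : ℝ) {m : ℝ} (hm : m ≠ 0) :
    schwartzResolvent d κ m * ((κ : ℂ) • cliffordPosition d - (Complex.I * m) • 1) = 1 := by
  refine Eq.trans ?_ (sub_mul_schwartzResolvent κ hm)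
  rw [schwartzResolvent]
  simp only [sub_mul, mul_sub, add_mul, mul_add, smul_mul_assoc, mul_smul_comm, one_mul, mul_one,
    mul_assoc, ← cliffordPosition_resolventMul]
  module

/-- For symmetric S the cross term vanishes, so ‖(S - im)g‖² = ‖Sg‖² + m²‖g‖². -/
theorem norm_schwartzResolvent_le (hω : 0 < ω) (κ : ℝ) {m : ℝ} (hm : m ≠ 0) (f : Schwartz d) :
    ‖schwartzToL2 d (schwartzResolvent d κ m f)‖ ≤ |m|⁻¹ * ‖schwartzToL2 d f‖ := by
  set g := schwartzResolvent d κ m f with hg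
  set S := (κ : ℂ) • cliffordPosition d with hS
  have hf : schwartzToL2 d f = schwartzToL2 d (S g) - (Complex.I * m) • schwartzToL2 d g := by
    have h : schwartzToL2 d (S g - (Complex.I * m) • g) = schwartzToL2 d f :=
      congrArg (fun T : Schwartz d →L[ℂ] Schwartz d => schwartzToL2 d (T f))
        (sub_mul_schwartzResolvent κ hm)
    rw [map_sub, map_smul] at h
    exact h.symm
  have hs : FormallyAdjoint S S :=
    ((regularPair_cliffordPosition (d := d) (hω := hω)).real_smul κ).adj
  have him : (inner ℂ (schwartzToL2 d (S g)) (schwartzToL2 d g)).im = 0 := by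
    rw [← Complex.conj_eq_iff_im, inner_conj_symm, hs]
  have h1 : ‖schwartzToL2 d f‖ ^ 2 = ‖schwartzToL2 d (S g)‖ ^ 2 +
      (|m| * ‖schwartzToL2 d g‖) ^ 2 := by
    rw [hf, norm_sub_sq (𝕜 := ℂ), inner_smul_right, norm_smul]
    simp [him]
  rw [le_inv_mul_iff₀ (abs_pos.2 hm)]
  refine (sq_le_sq₀ (by positivity) (norm_nonneg _)).1 ?_
  rw [h1]
  exact le_add_of_nonneg_left (sq_nonneg _)

/-- The resolvent `(κ X - im)⁻¹` on `L²`. -/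
def resolvent (d : ℕ) (κ m : ℝ) : L2 d →L[ℂ] L2 d :=
  (schwartzToL2 d ∘ₗ (schwartzResolvent d κ m).toLinearMap).extendOfNorm (schwartzToL2 d)

theorem resolvent_schwartzToL2 (hω : 0 < ω) (κ : ℝ) {m : ℝ} (hm : m ≠ 0) (f : Schwartz d) :
    resolvent d κ m (schwartzToL2 d f) = schwartzToL2 d (schwartzResolvent d κ m f) :=
  LinearMap.extendOfNorm_eq denseRange_schwartzToL2
    ⟨|m|⁻¹, norm_schwartzResolvent_le hω κ hm⟩ f

/-- Both inverse identities hold on Schwartz functions and extend along the regularizations of the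
given vector. -/
theorem isResolvent_resolvent (hω : 0 < ω) (κ : ℝ) {m : ℝ} (hm : m ≠ 0) :
    UnboundedOp.IsResolvent (ofSchwartz ((κ : ℂ) • cliffordPosition d)).closure (Complex.I * m)
      (resolvent d κ m) := by
  have hS := (regularPair_cliffordPosition (d := d) (hω := hω)).real_smul κ
  set S := (κ : ℂ) • cliffordPosition d with hSdef
  have h1 : ∀ f, schwartzToL2 d (S (schwartzResolvent d κ m f)) = schwartzToL2 d f +
      (Complex.I * m) • schwartzToL2 d (schwartzResolvent d κ m f) := fun f => by
    have h : schwartzToL2 d (S (schwartzResolvent d κ m f) -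
        (Complex.I * m) • schwartzResolvent d κ m f) = schwartzToL2 d f :=
      congrArg (fun T : Schwartz d →L[ℂ] Schwartz d => schwartzToL2 d (T f))
        (sub_mul_schwartzResolvent κ hm)
    rw [map_sub, map_smul] at h
    exact sub_eq_iff_eq_add.1 h
  have h2 : ∀ f, resolvent d κ m (schwartzToL2 d (S f) - (Complex.I * m) • schwartzToL2 d f) =
      schwartzToL2 d f := fun f => by
    have h : schwartzToL2 d (schwartzResolvent d κ m (S f - (Complex.I * m) • f)) =
        schwartzToL2 d f :=
      congrArg (fun T : Schwartz d →L[ℂ] Schwartz d => schwartzToL2 d (T f))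
        (schwartzResolvent_mul_sub κ hm)
    rw [← resolvent_schwartzToL2 hω κ hm, map_sub, map_smul] at h
    exact h
  refine ⟨fun ξ => ?_, fun ψ => ?_⟩
  · have h3 := tendsto_regularizer hω ξ
    have h4 := (((resolvent d κ m).continuous.tendsto _).comp h3)
    simp only [Function.comp_def, resolvent_schwartzToL2 hω κ hm] at h4
    have h5 := mem_graph_closure_of_tendsto hS.adj h4
      (χ := ξ + (Complex.I * m) • resolvent d κ m ξ) (by
        simp only [h1]
        exact h3.add (h4.const_smul _))
    obtain ⟨⟨_, hy⟩, rfl, h6⟩ := (LinearPMap.mem_graph_iff _).1 h5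
    exact ⟨hy, sub_eq_iff_eq_add.2 h6⟩
  · have h3 := tendsto_regularizer hω (ψ : L2 d)
    have h4 := ((resolvent d κ m).continuous.tendsto _).comp
      ((tendsto_closure hS ψ).sub (h3.const_smul (Complex.I * (m : ℂ))))
    simp only [Function.comp_def, h2] at h4
    exact tendsto_nhds_unique h4 h3

/-- The resolvent maps the Schwartz core into itself, so every composition is literal there, and the
anticommutator equals κτ(XP + PX), a bounded fibre operator, after the resolvent. -/
theorem isAlmostAntiCommuting_closure (hω : 0 < ω) (κ τ : ℝ) :
    UnboundedOp.IsAlmostAntiCommuting (ofSchwartz ((κ : ℂ) • cliffordPosition d)).closure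
      (ofSchwartz ((τ : ℂ) • dirac d)).closure := by
  refine ⟨isSelfAdjoint_closure ((regularPair_cliffordPosition (hω := hω)).real_smul κ),
    isSelfAdjoint_closure ((regularPair_dirac (hω := hω)).real_smul τ), _, hasCore_closure _,
    fun m hm => ⟨resolvent d κ m, isResolvent_resolvent hω κ hm,
      ((κ * τ : ℝ) : ℂ) • ((antiCommutator d).compLpL 2 volume * resolvent d κ m), ?_⟩⟩
  rintro _ ⟨f, rfl⟩
  have hS := Realizes.of_closure ((κ : ℂ) • cliffordPosition d)
  have hT := Realizes.of_closure ((τ : ℂ) • dirac d)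
  obtain ⟨s1, s2⟩ := hS.exists_mem (schwartzResolvent d κ m f)
  obtain ⟨t1, t2⟩ := hT.exists_mem (schwartzResolvent d κ m f)
  obtain ⟨u1, u2⟩ := hS.exists_mem (((τ : ℂ) • dirac d) (schwartzResolvent d κ m f))
  obtain ⟨v1, v2⟩ := hT.exists_mem (((κ : ℂ) • cliffordPosition d) (schwartzResolvent d κ m f))
  simp only [resolvent_schwartzToL2 hω κ hm, smul_apply, mul_apply_eq_comp]
  refine ⟨s1, t1, t2 ▸ u1, s2 ▸ v1, ?_⟩
  simp only [s2, t2, u2, v2]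
  rw [← schwartzToL2_fiberwise, ← cliffordPosition_dirac]
  simp only [smul_apply, add_apply, mul_apply_eq_comp, map_smul, map_add]
  push_cast
  module

end HarmonicOscillator

namespace HarmonicOscillator

open Filter Topology

variable {d : ℕ} {ω : ℝ}

/-! ### The spectral triples of the harmonic oscillator -/

theorem isEvenSpectralTriple_closure {hω : 0 < ω} (α β : ℂ)
    (h : RegularPair hω (α • cliffordPosition d + β • dirac d)
      (α • cliffordPosition d + β • dirac d))
    (hK : ∃ K : ℝ, ∀ φ, ∑ μ, ‖schwartzToL2 d (bosonAnnihilation ω μ φ)‖ ^ 2 ≤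
      K * (‖schwartzToL2 d φ‖ ^ 2 +
        ‖schwartzToL2 d ((α • cliffordPosition d + β • dirac d) φ)‖ ^ 2 +
        ‖schwartzToL2 d ((α • cliffordPosition d + β • dirac d) φ)‖ ^ 2)) :
    IsEvenSpectralTriple (schwartzAlgebra d) (rep d) (grading d)
      (ofSchwartz (α • cliffordPosition d + β • dirac d)).closure where
  toIsGradedRepresentation := isGradedRepresentation
  isSelfAdjoint := isSelfAdjoint_closure h
  odd := isOdd_closure α β h
  bounded_commutator _ ha := hasBoundedCommutatorOn_closure h ha le_rfl
  locally_compact a := isCompactOnDomain_closure h h hK.choose_spec (rep d a)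

theorem isEvenSpectralTriple_D₁ (hω : 0 < ω) :
    IsEvenSpectralTriple (schwartzAlgebra d) (rep d) (grading d) (D₁ d ω) := by
  have h1 := regularPair_schwartzD₁ (d := d) (hω := hω)
  have h2 := exists_sum_norm_sq_bosonAnnihilation_le_schwartzD₁ (d := d) hω
  have h3 : schwartzD₁ d ω = (ω : ℂ) • cliffordPosition d + (1 : ℂ) • dirac d := by
    rw [schwartzD₁_eq, one_smul]
  rw [D₁]
  rw [h3] at h1 h2 ⊢
  exact isEvenSpectralTriple_closure _ _ h1 h2

theorem isEvenSpectralTriple_D₂ (hω : 0 < ω) :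
    IsEvenSpectralTriple (schwartzAlgebra d) (rep d) (grading d) (D₂ d ω) := by
  have h1 := regularPair_schwartzD₂ (d := d) (hω := hω)
  have h2 := exists_sum_norm_sq_bosonAnnihilation_le_schwartzD₂ (d := d) hω
  have h3 : schwartzD₂ d ω = (ω : ℂ) • cliffordPosition d + (-1 : ℂ) • dirac d := by
    rw [schwartzD₂_eq, neg_one_smul, sub_eq_add_neg]
  rw [D₂]
  rw [h3] at h1 h2 ⊢
  exact isEvenSpectralTriple_closure _ _ h1 h2

theorem schwartzD₁_add_schwartzD₂ :
    schwartzD₁ d ω + schwartzD₂ d ω = ((2 * ω : ℝ) : ℂ) • cliffordPosition d := by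
  rw [schwartzD₁_eq, schwartzD₂_eq]
  push_cast
  module

theorem schwartzD₁_sub_schwartzD₂ :
    schwartzD₁ d ω - schwartzD₂ d ω = ((2 : ℝ) : ℂ) • dirac d := by
  rw [schwartzD₁_eq, schwartzD₂_eq]
  push_cast
  module

theorem realizes_D₁_add_D₂ (hω : 0 < ω) :
    Realizes (D₁ d ω + D₂ d ω) (((2 * ω : ℝ) : ℂ) • cliffordPosition d) := by
  rw [← schwartzD₁_add_schwartzD₂]
  exact (Realizes.of_closure _).add (Realizes.of_closure _)
    (regularPair_schwartzD₁ (hω := hω)) regularPair_schwartzD₂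

theorem realizes_D₁_sub_D₂ (hω : 0 < ω) :
    Realizes (D₁ d ω - D₂ d ω) (((2 : ℝ) : ℂ) • dirac d) := by
  rw [← schwartzD₁_sub_schwartzD₂ (ω := ω)]
  exact (Realizes.of_closure _).sub (Realizes.of_closure _)
    (regularPair_schwartzD₁ (hω := hω)) regularPair_schwartzD₂

theorem isEvenPairOfSpectralTriples (hω : 0 < ω) :
    IsEvenPairOfSpectralTriples (schwartzAlgebra d) (rep d) (grading d) (D₁ d ω) (D₂ d ω) := by
  have hX := (regularPair_cliffordPosition (d := d) (hω := hω)).real_smul (2 * ω)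
  have hP := (regularPair_dirac (d := d) (hω := hω)).real_smul 2
  refine ⟨isEvenSpectralTriple_D₁ hω, isEvenSpectralTriple_D₂ hω, ⟨_, hasCore_closure _,
    hasCore_closure _, (realizes_D₁_add_D₂ hω).isEssentiallySelfAdjointOn hX,
    (realizes_D₁_sub_D₂ hω).isEssentiallySelfAdjointOn hP⟩, ?_⟩
  rw [(realizes_D₁_add_D₂ hω).closure_eq hX.adj, (realizes_D₁_sub_D₂ hω).closure_eq hP.adj]
  exact isAlmostAntiCommuting_closure hω _ _

/-- The combination lies between ωX + iP on Schwartz functions and its closure, so closing it gives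
that closure, whatever the intersection of the domains is. -/
theorem reverseWick_D₁_D₂ (hω : 0 < ω) :
    UnboundedOp.reverseWick (D₁ d ω) (D₂ d ω) = D d ω := by
  have hX := (regularPair_cliffordPosition (d := d) (hω := hω)).real_smul (2 * ω)
  have hP := (regularPair_dirac (d := d) (hω := hω)).real_smul 2
  have h1 := ((realizes_D₁_add_D₂ (d := d) hω).smul hX (1 / 2)).add
    ((realizes_D₁_sub_D₂ (d := d) hω).smul hP (Complex.I / 2)) (hX.smul _) (hP.smul _)
  have h2 : (1 / 2 : ℂ) • ((2 * ω : ℝ) : ℂ) • cliffordPosition d +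
      (Complex.I / 2 : ℂ) • ((2 : ℝ) : ℂ) • dirac d = schwartzD d ω := by
    rw [schwartzD_eq]
    push_cast
    module
  rw [h2] at h1
  exact h1.closure_eq (regularPair_schwartzD (hω := hω)).adj

theorem adjoint_D (hω : 0 < ω) : (D d ω)† = (ofSchwartz (schwartzDAdjoint d ω)).closure :=
  adjoint_closure (regularPair_schwartzD (hω := hω))

theorem realizes_re_D (hω : 0 < ω) :
    Realizes ((1 / 2 : ℂ) • (D d ω + (D d ω)†)) ((ω : ℂ) • cliffordPosition d) := by
  have h := regularPair_schwartzD (d := d) (hω := hω)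
  have h1 := ((Realizes.of_closure (schwartzD d ω)).add
    (Realizes.of_closure (schwartzDAdjoint d ω)) h h.symm).smul (h.add h.symm) (1 / 2)
  have h2 : (1 / 2 : ℂ) • (schwartzD d ω + schwartzDAdjoint d ω) =
      (ω : ℂ) • cliffordPosition d := by
    rw [schwartzD_eq, schwartzDAdjoint]
    module
  rwa [h2, ← adjoint_D hω] at h1

theorem realizes_im_D (hω : 0 < ω) :
    Realizes ((-(Complex.I / 2) : ℂ) • (D d ω - (D d ω)†)) (((1 : ℝ) : ℂ) • dirac d) := by
  have h := regularPair_schwartzD (d := d) (hω := hω)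
  have h1 := ((Realizes.of_closure (schwartzD d ω)).sub
    (Realizes.of_closure (schwartzDAdjoint d ω)) h h.symm).smul (h.sub h.symm) (-(Complex.I / 2))
  have h2 : (-(Complex.I / 2) : ℂ) • (schwartzD d ω - schwartzDAdjoint d ω) =
      ((1 : ℝ) : ℂ) • dirac d := by
    rw [schwartzD_eq, schwartzDAdjoint, add_sub_sub_cancel, ← add_smul, smul_smul]
    congr 1
    rw [Complex.ofReal_one]
    linear_combination -Complex.I_mul_I
  rwa [h2, ← adjoint_D hω] at h1

/-- The regularizations R_nψ do not depend on the operator, so they converge to ψ in both graph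
norms at once. -/
theorem exists_range_graphNormSq_sub_lt {hω : 0 < ω} {L₁ L₁' L₂ L₂' : Schwartz d →L[ℂ] Schwartz d}
    (h₁ : RegularPair hω L₁ L₁') (h₂ : RegularPair hω L₂ L₂')
    (ψ : ↥((ofSchwartz L₁).closure.domain ⊓ (ofSchwartz L₂).closure.domain)) {ε : ℝ} (hε : 0 < ε) :
    ∃ φ : ↥((ofSchwartz L₁).closure.domain ⊓ (ofSchwartz L₂).closure.domain),
      (φ : L2 d) ∈ LinearMap.range (schwartzToL2 d) ∧
        UnboundedOp.graphNormSq (ofSchwartz L₁).closure (ofSchwartz L₂).closure (ψ - φ) < ε := by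
  have h0 := tendsto_regularizer hω (ψ : L2 d)
  have h1 := tendsto_closure h₁ ⟨ψ, ψ.2.1⟩
  have h2 := tendsto_closure h₂ ⟨ψ, ψ.2.2⟩
  have h3 := ((((h0.const_sub (ψ : L2 d)).norm.pow 2).add
    ((h1.const_sub ((ofSchwartz L₁).closure ⟨ψ, ψ.2.1⟩)).norm.pow 2)).add
    ((h2.const_sub ((ofSchwartz L₂).closure ⟨ψ, ψ.2.2⟩)).norm.pow 2))
  simp only [sub_self, norm_zero, zero_pow two_ne_zero, add_zero] at h3
  obtain ⟨n, hn⟩ := (h3.eventually (gt_mem_nhds hε)).exists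
  obtain ⟨s1, s2⟩ := (Realizes.of_closure L₁).exists_mem (regularizer hω n (ψ : L2 d))
  obtain ⟨t1, t2⟩ := (Realizes.of_closure L₂).exists_mem (regularizer hω n (ψ : L2 d))
  refine ⟨⟨_, s1, t1⟩, ⟨_, rfl⟩, ?_⟩
  rw [← s2, ← t2, ← LinearPMap.map_sub, ← LinearPMap.map_sub] at hn
  exact hn

theorem isEvenIndefiniteSpectralTriple (hω : 0 < ω) :
    IsEvenIndefiniteSpectralTriple (schwartzAlgebra d) (rep d) (grading d) (D d ω) := by
  have h := regularPair_schwartzD (d := d) (hω := hω)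
  have hX := (regularPair_cliffordPosition (d := d) (hω := hω)).real_smul ω
  have hP := (regularPair_dirac (d := d) (hω := hω)).real_smul 1
  have hre : UnboundedOp.realPart (D d ω) =
      (ofSchwartz ((ω : ℂ) • cliffordPosition d)).closure := (realizes_re_D hω).closure_eq hX.adj
  have him : UnboundedOp.imagPart (D d ω) =
      (ofSchwartz (((1 : ℝ) : ℂ) • dirac d)).closure := (realizes_im_D hω).closure_eq hP.adj
  have hD' : schwartzDAdjoint d ω = (ω : ℂ) • cliffordPosition d + (-Complex.I) • dirac d := by
    rw [schwartzDAdjoint, neg_smul, sub_eq_add_neg]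
  have h' := h.symm
  have hc : ∀ L : Schwartz d →L[ℂ] Schwartz d,
      LinearMap.range (schwartzToL2 d) ≤ (ofSchwartz L).closure.domain :=
    fun L => (LinearPMap.le_closure (ofSchwartz L)).1
  have hcomm : ∀ a ∈ schwartzAlgebra d, UnboundedOp.HasBoundedCommutatorOn (D d ω) (rep d a)
      (LinearMap.range (schwartzToL2 d)) := by
    rw [schwartzD_eq] at h
    rw [D, schwartzD_eq]
    exact fun a ha => hasBoundedCommutatorOn_closure h ha (hc _)
  have hcomm' : ∀ a ∈ schwartzAlgebra d, UnboundedOp.HasBoundedCommutatorOn (D d ω)† (rep d a)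
      (LinearMap.range (schwartzToL2 d)) := by
    rw [hD'] at h'
    rw [adjoint_D hω, hD']
    exact fun a ha => hasBoundedCommutatorOn_closure h' ha (hc _)
  refine { toIsGradedRepresentation := isGradedRepresentation, isClosed := ?_, dense_domain := ?_,
           odd := ?_, exists_core := ⟨LinearMap.range (schwartzToL2 d), ?_, ?_, ?_, ?_, ?_, ?_, ?_⟩,
           almost_antiCommuting := ?_, locally_compact := ?_ }
  · exact (isClosable_ofSchwartz h.adj).closure_isClosed
  · exact dense_domain_closure
  · rw [D]
    rw [schwartzD_eq] at h ⊢
    exact isOdd_closure _ _ h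
  · rw [adjoint_D hω]
    exact le_inf (hc _) (hc _)
  · rw [adjoint_D hω]
    exact fun ψ ε hε => exists_range_graphNormSq_sub_lt h h' ψ hε
  · exact hasCore_closure _
  · rw [adjoint_D hω]
    exact hasCore_closure _
  · rw [hre]
    exact (Realizes.of_closure _).isEssentiallySelfAdjointOn hX
  · rw [him]
    exact (Realizes.of_closure _).isEssentiallySelfAdjointOn hP
  · intro a ha
    refine ⟨fun ψ hψ => ⟨?_, ?_⟩, hcomm a ha, hcomm' a ha⟩
    · obtain ⟨h1, _, h2⟩ := hcomm a ha
      exact (h2 ⟨ψ, h1 hψ⟩ hψ).1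
    · obtain ⟨h1, _, h2⟩ := hcomm' a ha
      exact (h2 ⟨ψ, h1 hψ⟩ hψ).1
  · rw [hre, him]
    exact isAlmostAntiCommuting_closure hω _ _
  · rw [adjoint_D hω]
    exact fun a => isCompactOnDomain_closure h h'
      (sum_norm_sq_bosonAnnihilation_le_schwartzD hω) (rep d a)

end HarmonicOscillator

end

theorem mainTheorem8 (d : ℕ) (ω : ℝ) (hω : 0 < ω) :
    IsEvenPairOfSpectralTriples (HarmonicOscillator.schwartzAlgebra d) (HarmonicOscillator.rep d)
      (HarmonicOscillator.grading d) (HarmonicOscillator.D₁ d ω) (HarmonicOscillator.D₂ d ω) ∧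
    UnboundedOp.reverseWick (HarmonicOscillator.D₁ d ω) (HarmonicOscillator.D₂ d ω) =
      HarmonicOscillator.D d ω ∧
    IsEvenIndefiniteSpectralTriple (HarmonicOscillator.schwartzAlgebra d)
      (HarmonicOscillator.rep d) (HarmonicOscillator.grading d) (HarmonicOscillator.D d ω) :=
  ⟨HarmonicOscillator.isEvenPairOfSpectralTriples hω, HarmonicOscillator.reverseWick_D₁_D₂ hω,
    HarmonicOscillator.isEvenIndefiniteSpectralTriple hω⟩
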